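/- Let $\Sigma$ be an alphabet, finite or infinite. \textbf{Ipomsets.} A \emph{lo-set} is a finite strictly totally ordered set with labels in $\Sigma$. A \emph{labelled iposet} $(P,<,\dashrightarrow,S,T,\lambda)$ is a finite set $P$ with two strict partial orders, precedence $<$ and event order $\dashrightarrow$, such that any two distinct elements are comparable by $<$ or by $\dashrightarrow$, a labelling $\lambda:P\to\Sigma$, and interfaces $S,T\subseteq P$ whose elements are $<$-minimal and $<$-maximal, respectively; hence $(S,\dashrightarrow)$ and $(T,\dashrightarrow)$ are lo-sets. A \emph{subsumption} $f:P\to Q$ is a label-preserving bijection with $f(S_P)=S_Q$ and $f(T_P)=T_Q$ such that $f(x)<_Q f(y)$ implies $x<_P y$, and such that $x\dashrightarrow_P y$ with $x,y$ $<_P$-incomparable implies $f(x)\dashrightarrow_Q f(y)$. We write $P\sqsubseteq Q$ if there is a subsumption $P\to Q$. An \emph{isomorphism} is a subsumption that is an isomorphism for $<$; an \emph{ipomset} is an isomorphism class of labelled iposets. An ipomset is \emph{interval} if there are $b,e:P\to\mathbb{R}$ with $b\le e$ and $x<y\iff e(x)<b(y)$. For lo-sets $S,T\subseteq U$, ${}_SU_T$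 denotes the ipomset $U$ with empty precedence, the event order of $U$ and interfaces $S,T$. The \emph{parallel composition} $P\parallel Q$ is the disjoint union, with ${<}={<_P}\cup{<_Q}$, with the unions of the source and of the target interfaces, and with $x\dashrightarrow y$ iff $x\dashrightarrow_P y$, $x\dashrightarrow_Q y$, or $x\in P$ and $y\in Q$. The \emph{gluing} $P*Q$ is defined if $T_P\simeq S_Q$ as lo-sets; it is the disjoint union of $P$ and $Q$ with $T_P$ and $S_Q$ identified along the unique isomorphism, with source interface $S_P$, target interface $T_Q$, event order the transitive closure of ${\dashrightarrow_P}\cup{\dashrightarrow_Q}$, and $x<y$ iff $x<_P y$, $x<_Q y$, or $x\in P\setminus T_P$ and $y\in Q\setminus S_Q$. \textbf{Rational languages.} For a set $A$ of ipomsets let $A{\downarrow}$ be the set of interval ipomsets $P$ with $P\sqsubseteq Q$ for some $Q\in A$. A \emph{language} is a set $L$ of interval ipomsets with $L{\downarrow}=L$. Put $L*M=\{P*Q\mid P\in L,\,Q\in M,\,T_P\simeq S_Q\}{\downarrow}$, $L\parallel M=\{P\parallel Q\mid P\in L,\,Q\in M\}{\downarrow}$, and $L^+=\bigcup_{n\ge1}L^n$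 with $L^1=L$ and $L^{n+1}=L*L^n$. The \emph{rational} languages form the smallest class that contains $\emptyset$, $\{\epsilon\}$ (with $\epsilon$ the empty ipomset) and, for each $a\in\Sigma$, the four languages consisting of a single one-element ipomset with label $a$, whose point lies in neither interface, only in the source, only in the target, or in both, and that is closed under $\cup$, $*$, $\parallel$ and ${}^+$. \textbf{Regular languages.} The \emph{labelled precube category} $\square$ has words over $\Sigma$ (isomorphism classes of lo-sets) as objects; a morphism $d_{A,B}:U\to V$ is an order and label preserving injection with image $V\setminus(A\cup B)$, together with the disjoint sets $A,B\subseteq V$; for $d_{A,B}$ with injection $f$ and $d_{C,D}:V\to W$ with injection $g$, the composite $d_{C,D}\circ d_{A,B}$ is $g\circ f$ with the sets $g(A)\cup C$ and $g(B)\cup D$. A \emph{higher-dimensional automaton} (HDA) is a presheaf $X:\square^{\mathrm{op}}\to\mathrm{Set}$ with finitely many cells (elements of the sets $X[U]$) in total, together with sets of start cells and of accept cells. Write $\delta^0_A=X[d_{A,\emptyset}]$ and $\delta^1_B=X[d_{\emptyset,B}]$. A \emph{path} is a finite sequence of cells in which consecutive cells are related by an up-step from $\delta^0_A(x)$ to $x$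 or by a down-step from $x$ to $\delta^1_B(x)$. For $x\in X[U]$, the ipomset of the up-step is ${}_{U\setminus A}U_U$, that of the down-step is ${}_UU_{U\setminus B}$, and that of the path of length $0$ at $x$ is ${}_UU_U$; the ipomset of a path of positive length is the gluing of the ipomsets of its steps. A language is \emph{regular} if it is the set of ipomsets of all paths from a start cell to an accept cell of some HDA. \textbf{Corollary.} Every rational language is regular. -/

import Mathlib

open CategoryTheory Opposite

universe u

/-! ### Lo-sets -/

/-- A lo-set: a finite set, totally ordered by a strict order, with labels in `α`. -/
structure LoSet (α : Type u) where
  carrier : Type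
  finite : Finite carrier
  ord : carrier → carrier → Prop
  label : carrier → α
  irrefl : ∀ x, ¬ ord x x
  trans : ∀ x y z, ord x y → ord y z → ord x z
  total : ∀ x y, x = y ∨ ord x y ∨ ord y x

/-- Isomorphisms of lo-sets: order and label preserving bijections. -/
structure LoIso {α : Type u} (U V : LoSet α) where
  toEquiv : U.carrier ≃ V.carrier
  map_ord : ∀ x y, U.ord x y ↔ V.ord (toEquiv x) (toEquiv y)
  map_label : ∀ x, V.label (toEquiv x) = U.label x

namespace LoIso

variable {α : Type u} {U V W : LoSet α}

def symm (f : LoIso U V) : LoIso V U where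
  toEquiv := f.toEquiv.symm
  map_ord x y := by rw [f.map_ord]; simp
  map_label x := by rw [← f.map_label]; simp

def trans (f : LoIso U V) (g : LoIso V W) : LoIso U W where
  toEquiv := f.toEquiv.trans g.toEquiv
  map_ord x y := by rw [f.map_ord, g.map_ord]; rfl
  map_label x := by rw [← f.map_label, ← g.map_label]; rfl

end LoIso

/-! ### Labelled iposets and ipomsets -/

/-- Labelled iposets: finite sets with a precedence order `prec`, an event order `evord`,
a source interface, a target interface and a labelling. -/
structure Iposet (α : Type u) where
  carrier : Type
  finite : Finite carrier
  prec : carrier → carrier → Prop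
  evord : carrier → carrier → Prop
  src : Set carrier
  tgt : Set carrier
  label : carrier → α
  prec_irrefl : ∀ x, ¬ prec x x
  prec_trans : ∀ x y z, prec x y → prec y z → prec x z
  evord_irrefl : ∀ x, ¬ evord x x
  evord_trans : ∀ x y z, evord x y → evord y z → evord x z
  comparable : ∀ x y, x = y ∨ prec x y ∨ prec y x ∨ evord x y ∨ evord y x
  src_min : ∀ x ∈ src, ∀ y, ¬ prec y x
  tgt_max : ∀ x ∈ tgt, ∀ y, ¬ prec x y

namespace Iposet

variable {α : Type u}

/-- The source interface, as a lo-set with respect to the event order. -/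
abbrev srcLo (P : Iposet α) : LoSet α where
  carrier := P.src
  finite := by have := P.finite; infer_instance
  ord x y := P.evord x y
  label x := P.label x
  irrefl x := P.evord_irrefl x
  trans x y z := P.evord_trans x y z
  total x y := by
    rcases P.comparable x y with h | h | h | h | h
    · exact Or.inl (Subtype.ext h)
    · exact absurd h (P.src_min _ y.2 _)
    · exact absurd h (P.src_min _ x.2 _)
    · exact Or.inr (Or.inl h)
    · exact Or.inr (Or.inr h)

/-- The target interface, as a lo-set with respect to the event order. -/
abbrev tgtLo (P : Iposet α) : LoSet α where
  carrier := P.tgt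
  finite := by have := P.finite; infer_instance
  ord x y := P.evord x y
  label x := P.label x
  irrefl x := P.evord_irrefl x
  trans x y z := P.evord_trans x y z
  total x y := by
    rcases P.comparable x y with h | h | h | h | h
    · exact Or.inl (Subtype.ext h)
    · exact absurd h (P.tgt_max _ x.2 _)
    · exact absurd h (P.tgt_max _ y.2 _)
    · exact Or.inr (Or.inl h)
    · exact Or.inr (Or.inr h)

/-- `f : P → Q` is a subsumption: a label and interface preserving bijection that reflects
precedence and preserves the event order on `prec`-incomparable pairs. -/
structure IsSubsumption (P Q : Iposet α) (f : P.carrier → Q.carrier) : Prop where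
  bijective : Function.Bijective f
  label : ∀ x, Q.label (f x) = P.label x
  src : f '' P.src = Q.src
  tgt : f '' P.tgt = Q.tgt
  prec : ∀ x y, Q.prec (f x) (f y) → P.prec x y
  evord : ∀ x y, P.evord x y → ¬ P.prec x y → ¬ P.prec y x → Q.evord (f x) (f y)

/-- `P ⊑ Q`: there is a subsumption `P → Q`. -/
def Subsumed (P Q : Iposet α) : Prop := ∃ f, IsSubsumption P Q f

/-- `P ≅ Q`: there is a subsumption `P → Q` that is an isomorphism for the precedence order. -/
def Isomorphic (P Q : Iposet α) : Prop :=
  ∃ f, IsSubsumption P Q f ∧ ∀ x y, P.prec x y → Q.prec (f x) (f y)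

theorem IsSubsumption.id (P : Iposet α) : IsSubsumption P P _root_.id where
  bijective := Function.bijective_id
  label _ := rfl
  src := Set.image_id _
  tgt := Set.image_id _
  prec _ _ h := h
  evord _ _ h _ _ := h

theorem IsSubsumption.comp {P Q R : Iposet α} {f : P.carrier → Q.carrier}
    {g : Q.carrier → R.carrier} (hg : IsSubsumption Q R g) (hf : IsSubsumption P Q f) :
    IsSubsumption P R (g ∘ f) where
  bijective := hg.bijective.comp hf.bijective
  label x := (hg.label _).trans (hf.label x)
  src := by rw [Set.image_comp, hf.src, hg.src]
  tgt := by rw [Set.image_comp, hf.tgt, hg.tgt]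
  prec x y h := hf.prec _ _ (hg.prec _ _ h)
  evord x y h h₁ h₂ := hg.evord _ _ (hf.evord _ _ h h₁ h₂)
    (fun h => h₁ (hf.prec _ _ h)) (fun h => h₂ (hf.prec _ _ h))

theorem Subsumed.trans {P Q R : Iposet α} (h : Subsumed P Q) (h' : Subsumed Q R) :
    Subsumed P R := by
  obtain ⟨f, hf⟩ := h
  obtain ⟨g, hg⟩ := h'
  exact ⟨g ∘ f, hg.comp hf⟩

theorem Isomorphic.subsumed {P Q : Iposet α} (h : Isomorphic P Q) : Subsumed P Q := by
  obtain ⟨f, hf, -⟩ := h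
  exact ⟨f, hf⟩

theorem Isomorphic.symm {P Q : Iposet α} (h : Isomorphic P Q) : Isomorphic Q P := by
  obtain ⟨f, hf, hp⟩ := h
  obtain ⟨g, hgf, hfg⟩ := Function.bijective_iff_has_inverse.mp hf.bijective
  refine ⟨g, ⟨?_, ?_, ?_, ?_, ?_, ?_⟩, ?_⟩
  · exact Function.bijective_iff_has_inverse.mpr ⟨f, hfg, hgf⟩
  · intro x; rw [← hf.label, hfg]
  · rw [← hf.src, ← Set.image_comp, hgf.comp_eq_id, Set.image_id]
  · rw [← hf.tgt, ← Set.image_comp, hgf.comp_eq_id, Set.image_id]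
  · intro x y h; have := hp _ _ h; rwa [hfg, hfg] at this
  · intro x y h h₁ h₂
    have k₁ : ¬ P.prec (g x) (g y) := fun k => h₁ (by simpa only [hfg x, hfg y] using hp _ _ k)
    have k₂ : ¬ P.prec (g y) (g x) := fun k => h₂ (by simpa only [hfg x, hfg y] using hp _ _ k)
    rcases P.comparable (g x) (g y) with k | k | k | k | k
    · rw [hfg.injective k] at h; exact absurd h (Q.evord_irrefl _)
    · exact absurd k k₁
    · exact absurd k k₂
    · exact k
    · have := hf.evord _ _ k k₂ k₁
      rw [hfg, hfg] at this
      exact absurd (Q.evord_trans _ _ _ h this) (Q.evord_irrefl _)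
  · intro x y h; apply hf.prec; rwa [hfg, hfg]

theorem Isomorphic.trans {P Q R : Iposet α} (h : Isomorphic P Q) (h' : Isomorphic Q R) :
    Isomorphic P R := by
  obtain ⟨f, hf, hp⟩ := h
  obtain ⟨g, hg, hq⟩ := h'
  exact ⟨g ∘ f, hg.comp hf, fun x y h => hq _ _ (hp _ _ h)⟩

instance isoSetoid (α : Type u) : Setoid (Iposet α) where
  r := Isomorphic
  iseqv := ⟨fun P => ⟨id, IsSubsumption.id P, fun _ _ h => h⟩, Isomorphic.symm, Isomorphic.trans⟩

/-- `P` is an interval iposet: it has an interval representation over the reals. -/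
def IsInterval (P : Iposet α) : Prop :=
  ∃ b e : P.carrier → ℝ, (∀ x, b x ≤ e x) ∧ ∀ x y, P.prec x y ↔ e x < b y

theorem IsInterval.of_isomorphic {P Q : Iposet α} (h : Isomorphic P Q) (hQ : Q.IsInterval) :
    P.IsInterval := by
  obtain ⟨f, hf, hp⟩ := h
  obtain ⟨b, e, hbe, h⟩ := hQ
  exact ⟨b ∘ f, e ∘ f, fun x => hbe _, fun x y =>
    ⟨fun k => (h _ _).1 (hp _ _ k), fun k => hf.prec _ _ ((h _ _).2 k)⟩⟩

/-- The discrete iposet on the word `w` (empty precedence, event order given by the positions in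
the word) with interfaces `S` and `T`. -/
def discrete (w : List α) (S T : Set (Fin w.length)) : Iposet α where
  carrier := Fin w.length
  finite := inferInstance
  prec _ _ := False
  evord x y := x < y
  src := S
  tgt := T
  label := w.get
  prec_irrefl _ h := h
  prec_trans _ _ _ h _ := h
  evord_irrefl := lt_irrefl
  evord_trans _ _ _ := lt_trans
  comparable x y := by rcases lt_trichotomy x y with h | h | h <;> simp [h]
  src_min _ _ _ h := h
  tgt_max _ _ _ h := h

/-- Parallel composition. -/
def par (P Q : Iposet α) : Iposet α where
  carrier := P.carrier ⊕ Q.carrier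
  finite := by have := P.finite; have := Q.finite; infer_instance
  prec := Sum.LiftRel P.prec Q.prec
  evord := Sum.Lex P.evord Q.evord
  src := Sum.inl '' P.src ∪ Sum.inr '' Q.src
  tgt := Sum.inl '' P.tgt ∪ Sum.inr '' Q.tgt
  label := Sum.elim P.label Q.label
  prec_irrefl x := by
    rcases x with x | x
    · simpa using P.prec_irrefl x
    · simpa using Q.prec_irrefl x
  prec_trans x y z := by
    rcases x with x | x <;> rcases y with y | y <;> rcases z with z | z <;> simp
    · exact P.prec_trans x y z
    · exact Q.prec_trans x y z
  evord_irrefl x := by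
    rcases x with x | x
    · simpa using P.evord_irrefl x
    · simpa using Q.evord_irrefl x
  evord_trans x y z := by
    rcases x with x | x <;> rcases y with y | y <;> rcases z with z | z <;> simp
    · exact P.evord_trans x y z
    · exact Q.evord_trans x y z
  comparable x y := by
    rcases x with x | x <;> rcases y with y | y <;> simp
    · exact P.comparable x y
    · exact Q.comparable x y
  src_min x hx y := by
    rcases x with x | x <;> rcases y with y | y <;> simp at hx ⊢
    · exact P.src_min x hx y
    · exact Q.src_min x hx y
  tgt_max x hx y := by
    rcases x with x | x <;> rcases y with y | y <;> simp at hx ⊢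
    · exact P.tgt_max x hx y
    · exact Q.tgt_max x hx y

/-! ### Gluing composition

Let `f : T_P ≃ S_Q` be an isomorphism of lo-sets. The carrier of the gluing, the quotient of the
disjoint union of `P` and `Q` by `x ≡ f x`, is realised as `P ⊕ (Q ∖ S_Q)`. The structural
inclusions are `Sum.inl` and `glueInr f`. -/

section Glue

variable {P Q : Iposet α}

open Classical in
/-- The structural inclusion of `Q` in the gluing of `P` and `Q`. -/
noncomputable def glueInr (f : LoIso P.tgtLo Q.srcLo) (q : Q.carrier) :
    P.carrier ⊕ {q : Q.carrier // q ∉ Q.src} :=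
  if h : q ∈ Q.src then Sum.inl (f.toEquiv.symm ⟨q, h⟩ : P.tgt).1 else Sum.inr ⟨q, h⟩

/-- The precedence order of the gluing. -/
def gluePrec (f : LoIso P.tgtLo Q.srcLo) (x y : P.carrier ⊕ {q : Q.carrier // q ∉ Q.src}) : Prop :=
  (∃ p p', x = Sum.inl p ∧ y = Sum.inl p' ∧ P.prec p p') ∨
  (∃ q q', x = glueInr f q ∧ y = glueInr f q' ∧ Q.prec q q') ∨
  (∃ p q, x = Sum.inl p ∧ y = glueInr f q ∧ p ∉ P.tgt ∧ q ∉ Q.src)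

/-- The union of the two event orders on the gluing. -/
def glueEvStep (f : LoIso P.tgtLo Q.srcLo) (x y : P.carrier ⊕ {q : Q.carrier // q ∉ Q.src}) :
    Prop :=
  (∃ p p', x = Sum.inl p ∧ y = Sum.inl p' ∧ P.evord p p') ∨
  (∃ q q', x = glueInr f q ∧ y = glueInr f q' ∧ Q.evord q q')

variable (f : LoIso P.tgtLo Q.srcLo)

theorem glueInr_of_notMem {q : Q.carrier} (h : q ∉ Q.src) : glueInr f q = Sum.inr ⟨q, h⟩ := by
  simp [glueInr, h]

theorem inl_eq_glueInr_iff {p : P.carrier} {q : Q.carrier} :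
    Sum.inl p = glueInr f q ↔ ∃ h : p ∈ P.tgt, (f.toEquiv ⟨p, h⟩ : Q.src).1 = q := by
  constructor
  · intro h
    by_cases hq : q ∈ Q.src
    · simp only [glueInr, hq, dif_pos, Sum.inl.injEq] at h
      subst h
      exact ⟨Subtype.property _, by simp⟩
    · simp [glueInr, hq] at h
  · rintro ⟨h, rfl⟩
    have hq := (f.toEquiv ⟨p, h⟩ : Q.src).2
    simp [glueInr, hq]

theorem glueInr_injective : Function.Injective (glueInr f) := by
  intro q q' h
  by_cases hq : q ∈ Q.src
  · by_cases hq' : q' ∈ Q.src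
    · simp only [glueInr, hq, hq', dif_pos, Sum.inl.injEq] at h
      have := f.toEquiv.symm.injective (Subtype.ext h)
      exact congrArg Subtype.val this
    · simp [glueInr, hq, hq'] at h
  · by_cases hq' : q' ∈ Q.src
    · simp [glueInr, hq, hq'] at h
    · simpa [glueInr, hq, hq'] using h

theorem gluePrec_irrefl (x) : ¬ gluePrec f x x := by
  rintro (⟨p, p', rfl, h, h'⟩ | ⟨q, q', rfl, h, h'⟩ | ⟨p, q, rfl, h, h₁, h₂⟩)
  · cases h; exact P.prec_irrefl _ h'
  · rw [glueInr_injective f h] at h'; exact Q.prec_irrefl _ h'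
  · exact h₁ ((inl_eq_glueInr_iff f).1 h).1

theorem gluePrec_trans (x y z) (h : gluePrec f x y) (h' : gluePrec f y z) : gluePrec f x z := by
  have hS : ∀ q q', Q.prec q q' → q' ∉ Q.src := fun q q' h h' => Q.src_min _ h' _ h
  have hT : ∀ p p', P.prec p p' → p ∉ P.tgt := fun p p' h h' => P.tgt_max _ h' _ h
  have hne : ∀ p q, q ∉ Q.src → Sum.inl p ≠ glueInr f q := by
    intro p q hq h
    rw [glueInr_of_notMem f hq] at h
    cases h
  rcases h with ⟨p, p', rfl, rfl, h⟩ | ⟨q, q', rfl, rfl, h⟩ | ⟨p, q, rfl, rfl, h₁, h₂⟩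
  · rcases h' with ⟨r, r', e, rfl, k⟩ | ⟨r, r', e, rfl, k⟩ | ⟨r, r', e, rfl, k₁, k₂⟩
    · cases e; exact Or.inl ⟨p, r', rfl, rfl, P.prec_trans _ _ _ h k⟩
    · exact Or.inr (Or.inr ⟨p, r', rfl, rfl, hT _ _ h, hS _ _ k⟩)
    · exact Or.inr (Or.inr ⟨p, r', rfl, rfl, hT _ _ h, k₂⟩)
  · rcases h' with ⟨r, r', e, rfl, k⟩ | ⟨r, r', e, rfl, k⟩ | ⟨r, r', e, rfl, k₁, k₂⟩
    · exact absurd e.symm (hne _ _ (hS _ _ h))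
    · rw [glueInr_injective f e] at h
      exact Or.inr (Or.inl ⟨q, r', rfl, rfl, Q.prec_trans _ _ _ h k⟩)
    · exact absurd e.symm (hne _ _ (hS _ _ h))
  · rcases h' with ⟨r, r', e, rfl, k⟩ | ⟨r, r', e, rfl, k⟩ | ⟨r, r', e, rfl, k₁, k₂⟩
    · exact absurd e.symm (hne _ _ h₂)
    · exact Or.inr (Or.inr ⟨p, r', rfl, rfl, h₁, hS _ _ k⟩)
    · exact absurd e.symm (hne _ _ h₂)

theorem glueEv_irrefl (x) : ¬ Relation.TransGen (glueEvStep f) x x := by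
  have hf : ∀ (t t' : P.carrier) (h : t ∈ P.tgt) (h' : t' ∈ P.tgt), P.evord t t' ↔
      Q.evord (f.toEquiv ⟨t, h⟩ : Q.src).1 (f.toEquiv ⟨t', h'⟩ : Q.src).1 :=
    fun t t' h h' => f.map_ord ⟨t, h⟩ ⟨t', h'⟩
  have key : ∀ y, Relation.TransGen (glueEvStep f) x y →
      (∃ p p', x = Sum.inl p ∧ y = Sum.inl p' ∧ P.evord p p') ∨
      (∃ q q', x = glueInr f q ∧ y = glueInr f q' ∧ Q.evord q q') ∨
      (∃ p, ∃ t, ∃ h : t ∈ P.tgt, ∃ q, x = Sum.inl p ∧ y = glueInr f q ∧ P.evord p t ∧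
        Q.evord (f.toEquiv ⟨t, h⟩ : Q.src).1 q) ∨
      (∃ q, ∃ t, ∃ h : t ∈ P.tgt, ∃ p, x = glueInr f q ∧ y = Sum.inl p ∧
        Q.evord q (f.toEquiv ⟨t, h⟩ : Q.src).1 ∧ P.evord t p) := by
    intro y h
    induction h with
    | single h =>
      rcases h with h | h
      · exact Or.inl h
      · exact Or.inr (Or.inl h)
    | tail _ h ih =>
      rcases ih with ⟨p, p', rfl, rfl, i⟩ | ⟨q, q', rfl, rfl, i⟩ | ⟨p, t, ht, q, rfl, rfl, i, j⟩ |
        ⟨q, t, ht, p, rfl, rfl, i, j⟩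
      · rcases h with ⟨r, r', e, rfl, k⟩ | ⟨r, r', e, rfl, k⟩
        · cases e; exact Or.inl ⟨p, r', rfl, rfl, P.evord_trans _ _ _ i k⟩
        · obtain ⟨hp, rfl⟩ := (inl_eq_glueInr_iff f).1 e
          exact Or.inr (Or.inr (Or.inl ⟨p, p', hp, r', rfl, rfl, i, k⟩))
      · rcases h with ⟨r, r', e, rfl, k⟩ | ⟨r, r', e, rfl, k⟩
        · obtain ⟨hp, rfl⟩ := (inl_eq_glueInr_iff f).1 e.symm
          exact Or.inr (Or.inr (Or.inr ⟨q, r, hp, r', rfl, rfl, i, k⟩))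
        · rw [← glueInr_injective f e] at k
          exact Or.inr (Or.inl ⟨q, r', rfl, rfl, Q.evord_trans _ _ _ i k⟩)
      · rcases h with ⟨r, r', e, rfl, k⟩ | ⟨r, r', e, rfl, k⟩
        · obtain ⟨hp, rfl⟩ := (inl_eq_glueInr_iff f).1 e.symm
          have := (hf _ _ ht hp).2 j
          exact Or.inl ⟨p, r', rfl, rfl,
            P.evord_trans _ _ _ (P.evord_trans _ _ _ i this) k⟩
        · rw [← glueInr_injective f e] at k
          exact Or.inr (Or.inr (Or.inl
            ⟨p, t, ht, r', rfl, rfl, i, Q.evord_trans _ _ _ j k⟩))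
      · rcases h with ⟨r, r', e, rfl, k⟩ | ⟨r, r', e, rfl, k⟩
        · cases e
          exact Or.inr (Or.inr (Or.inr
            ⟨q, t, ht, r', rfl, rfl, i, P.evord_trans _ _ _ j k⟩))
        · obtain ⟨hp, rfl⟩ := (inl_eq_glueInr_iff f).1 e
          have := (hf _ _ ht hp).1 j
          exact Or.inr (Or.inl ⟨q, r', rfl, rfl,
            Q.evord_trans _ _ _ (Q.evord_trans _ _ _ i this) k⟩)
  intro h
  rcases key x h with ⟨p, p', rfl, e, i⟩ | ⟨q, q', rfl, e, i⟩ | ⟨p, t, ht, q, rfl, e, i, j⟩ |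
    ⟨q, t, ht, p, rfl, e, i, j⟩
  · cases e; exact P.evord_irrefl _ i
  · rw [glueInr_injective f e] at i; exact Q.evord_irrefl _ i
  · obtain ⟨hp, rfl⟩ := (inl_eq_glueInr_iff f).1 e
    exact Q.evord_irrefl _ (Q.evord_trans _ _ _ ((hf _ _ hp ht).1 i) j)
  · obtain ⟨hp, rfl⟩ := (inl_eq_glueInr_iff f).1 e.symm
    exact Q.evord_irrefl _ (Q.evord_trans _ _ _ i ((hf _ _ ht hp).1 j))

theorem glue_comparable (x y) : x = y ∨ gluePrec f x y ∨ gluePrec f y x ∨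
    Relation.TransGen (glueEvStep f) x y ∨ Relation.TransGen (glueEvStep f) y x := by
  have hP : ∀ p p' : P.carrier, (Sum.inl p : P.carrier ⊕ {q : Q.carrier // q ∉ Q.src}) = Sum.inl p' ∨
      gluePrec f (Sum.inl p) (Sum.inl p') ∨ gluePrec f (Sum.inl p') (Sum.inl p) ∨
      Relation.TransGen (glueEvStep f) (Sum.inl p) (Sum.inl p') ∨
      Relation.TransGen (glueEvStep f) (Sum.inl p') (Sum.inl p) := by
    intro p p'
    rcases P.comparable p p' with h | h | h | h | h
    · exact Or.inl (by rw [h])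
    · exact Or.inr (Or.inl (Or.inl ⟨p, p', rfl, rfl, h⟩))
    · exact Or.inr (Or.inr (Or.inl (Or.inl ⟨p', p, rfl, rfl, h⟩)))
    · exact Or.inr (Or.inr (Or.inr (Or.inl (.single (Or.inl ⟨p, p', rfl, rfl, h⟩)))))
    · exact Or.inr (Or.inr (Or.inr (Or.inr (.single (Or.inl ⟨p', p, rfl, rfl, h⟩)))))
  have hQ : ∀ q q' : Q.carrier, glueInr f q = glueInr f q' ∨
      gluePrec f (glueInr f q) (glueInr f q') ∨ gluePrec f (glueInr f q') (glueInr f q) ∨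
      Relation.TransGen (glueEvStep f) (glueInr f q) (glueInr f q') ∨
      Relation.TransGen (glueEvStep f) (glueInr f q') (glueInr f q) := by
    intro q q'
    rcases Q.comparable q q' with h | h | h | h | h
    · exact Or.inl (by rw [h])
    · exact Or.inr (Or.inl (Or.inr (Or.inl ⟨q, q', rfl, rfl, h⟩)))
    · exact Or.inr (Or.inr (Or.inl (Or.inr (Or.inl ⟨q', q, rfl, rfl, h⟩))))
    · exact Or.inr (Or.inr (Or.inr (Or.inl (.single (Or.inr ⟨q, q', rfl, rfl, h⟩)))))
    · exact Or.inr (Or.inr (Or.inr (Or.inr (.single (Or.inr ⟨q', q, rfl, rfl, h⟩)))))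
  rcases x with p | ⟨q, hq⟩ <;> rcases y with p' | ⟨q', hq'⟩
  · exact hP p p'
  · rw [← glueInr_of_notMem f hq']
    by_cases hp : p ∈ P.tgt
    · rw [(inl_eq_glueInr_iff f).2 ⟨hp, rfl⟩]; exact hQ _ _
    · exact Or.inr (Or.inl (Or.inr (Or.inr ⟨p, q', rfl, rfl, hp, hq'⟩)))
  · rw [← glueInr_of_notMem f hq]
    by_cases hp : p' ∈ P.tgt
    · rw [(inl_eq_glueInr_iff f).2 ⟨hp, rfl⟩]; exact hQ _ _
    · exact Or.inr (Or.inr (Or.inl (Or.inr (Or.inr ⟨p', q, rfl, rfl, hp, hq⟩))))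
  · rw [← glueInr_of_notMem f hq, ← glueInr_of_notMem f hq']; exact hQ _ _

/-- The gluing composition `P * Q` along the isomorphism `f : T_P ≃ S_Q`. -/
noncomputable def glue (P Q : Iposet α) (f : LoIso P.tgtLo Q.srcLo) : Iposet α where
  carrier := P.carrier ⊕ {q : Q.carrier // q ∉ Q.src}
  finite := by have := P.finite; have := Q.finite; infer_instance
  prec := gluePrec f
  evord := Relation.TransGen (glueEvStep f)
  src := Sum.inl '' P.src
  tgt := glueInr f '' Q.tgt
  label := Sum.elim P.label (fun q => Q.label q)
  prec_irrefl := gluePrec_irrefl f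
  prec_trans := gluePrec_trans f
  evord_irrefl := glueEv_irrefl f
  evord_trans _ _ _ := Relation.TransGen.trans
  comparable := glue_comparable f
  src_min := by
    rintro _ ⟨s, hs, rfl⟩ y (⟨p, p', rfl, e, h⟩ | ⟨q, q', rfl, e, h⟩ | ⟨p, q, rfl, e, -, h⟩)
    · cases e; exact P.src_min _ hs _ h
    · obtain ⟨_, rfl⟩ := (inl_eq_glueInr_iff f).1 e
      exact Q.src_min _ (Subtype.property _) _ h
    · obtain ⟨_, rfl⟩ := (inl_eq_glueInr_iff f).1 e
      exact h (Subtype.property _)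
  tgt_max := by
    rintro _ ⟨t, ht, rfl⟩ y (⟨p, p', e, rfl, h⟩ | ⟨q, q', e, rfl, h⟩ | ⟨p, q, e, rfl, h, -⟩)
    · obtain ⟨k, -⟩ := (inl_eq_glueInr_iff f).1 e.symm
      exact P.tgt_max _ k _ h
    · rw [← glueInr_injective f e] at h; exact Q.tgt_max _ ht _ h
    · exact h ((inl_eq_glueInr_iff f).1 e.symm).1

theorem glue_label_glueInr (q : Q.carrier) : (glue P Q f).label (glueInr f q) = Q.label q := by
  by_cases hq : q ∈ Q.src
  · have := f.symm.map_label ⟨q, hq⟩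
    simpa [glue, glueInr, hq, LoIso.symm] using this
  · simp [glue, glueInr, hq]

/-- An order and label preserving bijection between lo-sets is an isomorphism. -/
noncomputable def _root_.LoIso.ofBijective {U V : LoSet α} (g : U.carrier → V.carrier)
    (hg : Function.Bijective g) (hord : ∀ x y, U.ord x y → V.ord (g x) (g y))
    (hlab : ∀ x, V.label (g x) = U.label x) : LoIso U V where
  toEquiv := Equiv.ofBijective g hg
  map_ord x y := by
    refine ⟨hord x y, fun h => ?_⟩
    rcases U.total x y with k | k | k
    · subst k; exact absurd h (V.irrefl _)
    · exact k
    · exact absurd (V.trans _ _ _ h (hord _ _ k)) (V.irrefl _)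
  map_label := hlab

/-- The source interface of `P * Q` is that of `P`. -/
noncomputable def glueSrc : LoIso P.srcLo (glue P Q f).srcLo :=
  LoIso.ofBijective (fun s => ⟨Sum.inl s.1, s.1, s.2, rfl⟩)
    ⟨fun s s' h => Subtype.ext (Sum.inl_injective (congrArg Subtype.val h)),
      by rintro ⟨_, s, hs, rfl⟩; exact ⟨⟨s, hs⟩, rfl⟩⟩
    (fun s s' h => .single (Or.inl ⟨s.1, s'.1, rfl, rfl, h⟩))
    (fun _ => rfl)

/-- The target interface of `P * Q` is that of `Q`. -/
noncomputable def glueTgt : LoIso Q.tgtLo (glue P Q f).tgtLo :=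
  LoIso.ofBijective (fun t => ⟨glueInr f t.1, t.1, t.2, rfl⟩)
    ⟨fun t t' h => Subtype.ext (glueInr_injective f (congrArg Subtype.val h)),
      by rintro ⟨_, t, ht, rfl⟩; exact ⟨⟨t, ht⟩, rfl⟩⟩
    (fun t t' h => .single (Or.inr ⟨t.1, t'.1, rfl, rfl, h⟩))
    (fun t => glue_label_glueInr f t.1)

end Glue

end Iposet

/-- An ipomset is an isomorphism class of labelled iposets. -/
def Ipomset (α : Type u) := Quotient (Iposet.isoSetoid α)

namespace Ipomset

variable {α : Type u}

/-- The isomorphism class of a labelled iposet. -/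
def mk (P : Iposet α) : Ipomset α := Quotient.mk _ P

/-- The subsumption relation `P ⊑ Q` on ipomsets. -/
def Subsumed : Ipomset α → Ipomset α → Prop :=
  Quotient.lift₂ Iposet.Subsumed fun _ _ _ _ h h' => propext
    ⟨fun k => (h.symm.subsumed.trans k).trans h'.subsumed,
      fun k => (h.subsumed.trans k).trans h'.symm.subsumed⟩

/-- Interval ipomsets. -/
def IsInterval : Ipomset α → Prop :=
  Quotient.lift Iposet.IsInterval fun _ _ h => propext
    ⟨fun k => k.of_isomorphic h.symm, fun k => k.of_isomorphic h⟩

/-- The down-closure of a set of ipomsets in the set of interval ipomsets. -/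
def down (A : Set (Ipomset α)) : Set (Ipomset α) :=
  {P | P.IsInterval ∧ ∃ Q ∈ A, P.Subsumed Q}

/-- Interval ipomset languages: down-closed sets of interval ipomsets. -/
structure IsLanguage (L : Set (Ipomset α)) : Prop where
  interval : ∀ P ∈ L, P.IsInterval
  down_closed : ∀ P Q : Ipomset α, P.IsInterval → P.Subsumed Q → Q ∈ L → P ∈ L

/-- Gluing composition of languages. -/
def langGlue (L M : Set (Ipomset α)) : Set (Ipomset α) :=
  down {R | ∃ (P Q : Iposet α) (f : LoIso P.tgtLo Q.srcLo),
    mk P ∈ L ∧ mk Q ∈ M ∧ R = mk (P.glue Q f)}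

/-- Parallel composition of languages. -/
def langPar (L M : Set (Ipomset α)) : Set (Ipomset α) :=
  down {R | ∃ P Q : Iposet α, mk P ∈ L ∧ mk Q ∈ M ∧ R = mk (P.par Q)}

/-- `langPow L n` is the power of `L` with exponent `n + 1`. -/
def langPow (L : Set (Ipomset α)) : ℕ → Set (Ipomset α)
  | 0 => L
  | n + 1 => langGlue L (langPow L n)

/-- Kleene plus: the union of all powers of `L` with positive exponent. -/
def langPlus (L : Set (Ipomset α)) : Set (Ipomset α) := ⋃ n, langPow L n

/-- The rational languages: the smallest class that contains the empty language, the language of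
the empty ipomset and the singleton languages `{[a]}`, `{[• a]}`, `{[a •]}`, `{[• a •]}`, and is
closed under union, gluing composition, parallel composition and Kleene plus. -/
inductive IsRational : Set (Ipomset α) → Prop
  | empty : IsRational ∅
  | epsilon : IsRational {mk (Iposet.discrete [] ∅ ∅)}
  | letter (a : α) : IsRational {mk (Iposet.discrete [a] ∅ ∅)}
  | letterSrc (a : α) : IsRational {mk (Iposet.discrete [a] Set.univ ∅)}
  | letterTgt (a : α) : IsRational {mk (Iposet.discrete [a] ∅ Set.univ)}
  | letterSrcTgt (a : α) : IsRational {mk (Iposet.discrete [a] Set.univ Set.univ)}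
  | union {L M : Set (Ipomset α)} : IsRational L → IsRational M → IsRational (L ∪ M)
  | glue {L M : Set (Ipomset α)} : IsRational L → IsRational M → IsRational (langGlue L M)
  | par {L M : Set (Ipomset α)} : IsRational L → IsRational M → IsRational (langPar L M)
  | plus {L : Set (Ipomset α)} : IsRational L → IsRational (langPlus L)

end Ipomset

/-! ### The labelled precube category -/

/-- Objects of the labelled precube category: words over `α`, that is, isomorphism classes of
lo-sets. The word `w` stands for the lo-set of its positions. -/
structure Precube (α : Type u) where
  word : List α

namespace Precube

variable {α : Type u}

/-- The lo-set of positions of a word. -/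
abbrev lo (U : Precube α) : LoSet α where
  carrier := Fin U.word.length
  finite := inferInstance
  ord x y := x < y
  label := U.word.get
  irrefl := lt_irrefl
  trans _ _ _ := lt_trans
  total x y := by rcases lt_trichotomy x y with h | h | h <;> simp [h]

/-- Coface maps `d_{A,B} : U ⟶ V`: an order and label preserving map `U → V` whose image is
`V ∖ (A ∪ B)`, with disjoint sets `A` of unstarted and `B` of terminated events. -/
@[ext]
structure Coface (U V : Precube α) where
  emb : Fin U.word.length → Fin V.word.length
  A : Set (Fin V.word.length)
  B : Set (Fin V.word.length)
  strictMono : StrictMono emb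
  label : ∀ i, V.word.get (emb i) = U.word.get i
  disjoint : Disjoint A B
  range : Set.range emb = (A ∪ B)ᶜ

/-- The identity coface map. -/
def Coface.id (U : Precube α) : Coface U U where
  emb := _root_.id
  A := ∅
  B := ∅
  strictMono := strictMono_id
  label _ := rfl
  disjoint := by simp
  range := by simp

theorem Coface.notMem {U V : Precube α} (d : Coface U V) (i) : d.emb i ∉ d.A ∧ d.emb i ∉ d.B := by
  have : d.emb i ∈ (d.A ∪ d.B)ᶜ := d.range ▸ Set.mem_range_self i
  simpa using this

/-- Composition of coface maps. -/
def Coface.comp {U V W : Precube α} (d : Coface U V) (e : Coface V W) : Coface U W where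
  emb := e.emb ∘ d.emb
  A := e.emb '' d.A ∪ e.A
  B := e.emb '' d.B ∪ e.B
  strictMono := e.strictMono.comp d.strictMono
  label i := by rw [← d.label, ← e.label]; rfl
  disjoint := by
    have hd := Set.disjoint_left.1 d.disjoint
    have he := Set.disjoint_left.1 e.disjoint
    rw [Set.disjoint_left]
    rintro _ (⟨i, hi, rfl⟩ | hx) (⟨j, hj, h⟩ | hx')
    · rw [e.strictMono.injective h] at hj; exact hd hi hj
    · exact (e.notMem i).2 hx'
    · subst h; exact (e.notMem j).1 hx
    · exact he hx hx'
  range := by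
    rw [Set.range_comp, d.range, Set.image_compl_eq_range_sdiff_image e.strictMono.injective,
      e.range]
    ext x
    simp only [Set.mem_sdiff, Set.mem_compl_iff, Set.mem_union, Set.image_union]
    tauto

instance : Category (Precube α) where
  Hom := Coface
  id := Coface.id
  comp := Coface.comp
  id_comp d := by ext <;> simp [Coface.comp, Coface.id]
  comp_id d := by ext <;> simp [Coface.comp, Coface.id]
  assoc d e f := by ext <;> simp [Coface.comp, Set.image_union, Set.image_image, or_assoc]

end Precube

/-! ### Ipomsets of steps -/

/-- Labelled iposets with source interface `U` and target interface `V` (up to unique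
isomorphism of lo-sets). -/
structure IposetHom {α : Type u} (U V : LoSet α) where
  iposet : Iposet α
  srcIso : LoIso U iposet.srcLo
  tgtIso : LoIso V iposet.tgtLo

namespace IposetHom

variable {α : Type u}

/-- Gluing composition, which is always defined on matching interfaces. -/
noncomputable def comp {U V W : LoSet α} (P : IposetHom U V) (Q : IposetHom V W) :
    IposetHom U W where
  iposet := P.iposet.glue Q.iposet (P.tgtIso.symm.trans Q.srcIso)
  srcIso := P.srcIso.trans (Iposet.glueSrc _)
  tgtIso := Q.tgtIso.trans (Iposet.glueTgt _)

/-- A coface map is an isomorphism onto its image, seen as a source interface. -/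
noncomputable def rangeSrc {U V : Precube α} (d : U ⟶ V) (S T : Set (Fin V.word.length))
    (hS : Set.range d.emb = S) : LoIso U.lo (Iposet.discrete V.word S T).srcLo :=
  LoIso.ofBijective (V := (Iposet.discrete V.word S T).srcLo)
    (fun i => ⟨d.emb i, hS ▸ Set.mem_range_self i⟩)
    ⟨fun _ _ h => d.strictMono.injective (congrArg Subtype.val h), by
      subst hS; rintro ⟨_, i, rfl⟩; exact ⟨i, rfl⟩⟩
    (fun _ _ h => d.strictMono h) d.label

/-- A coface map is an isomorphism onto its image, seen as a target interface. -/
noncomputable def rangeTgt {U V : Precube α} (d : U ⟶ V) (S T : Set (Fin V.word.length))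
    (hT : Set.range d.emb = T) : LoIso U.lo (Iposet.discrete V.word S T).tgtLo :=
  LoIso.ofBijective (V := (Iposet.discrete V.word S T).tgtLo)
    (fun i => ⟨d.emb i, hT ▸ Set.mem_range_self i⟩)
    ⟨fun _ _ h => d.strictMono.injective (congrArg Subtype.val h), by
      subst hT; rintro ⟨_, i, rfl⟩; exact ⟨i, rfl⟩⟩
    (fun _ _ h => d.strictMono h) d.label

theorem range_id (U : Precube α) : Set.range (Precube.Coface.emb (𝟙 U)) = Set.univ :=
  Set.range_id

/-- The identity ipomset on `U`: all events are in both interfaces. -/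
noncomputable def identity (U : Precube α) : IposetHom U.lo U.lo where
  iposet := Iposet.discrete U.word Set.univ Set.univ
  srcIso := rangeSrc (𝟙 U) _ _ (range_id U)
  tgtIso := rangeTgt (𝟙 U) _ _ (range_id U)

/-- The ipomset of an up-step along `d_A^0 : U ⟶ V`: the events of `V`, with source interface
`V ∖ A` and target interface `V`. -/
noncomputable def upStep {U V : Precube α} (d : U ⟶ V) (hd : d.B = ∅) : IposetHom U.lo V.lo where
  iposet := Iposet.discrete V.word (d.A)ᶜ Set.univ
  srcIso := rangeSrc d _ _ (by rw [d.range, hd, Set.union_empty])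
  tgtIso := rangeTgt (𝟙 V) _ _ (range_id V)

/-- The ipomset of a down-step along `d_B^1 : V ⟶ U`: the events of `U`, with source interface
`U` and target interface `U ∖ B`. -/
noncomputable def downStep {U V : Precube α} (d : V ⟶ U) (hd : d.A = ∅) : IposetHom U.lo V.lo where
  iposet := Iposet.discrete U.word Set.univ (d.B)ᶜ
  srcIso := rangeSrc (𝟙 U) _ _ (range_id U)
  tgtIso := rangeTgt d _ _ (by rw [d.range, hd, Set.empty_union])

end IposetHom

/-! ### Higher-dimensional automata -/

/-- Higher-dimensional automata over `α`: finite precubical sets (presheaves on the labelled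
precube category with finitely many cells) with sets of start and accept cells. -/
structure HDA (α : Type u) where
  cells : (Precube α)ᵒᵖ ⥤ Type
  finite : Finite (Σ U : Precube α, cells.obj (op U))
  start : ∀ U : Precube α, Set (cells.obj (op U))
  accept : ∀ U : Precube α, Set (cells.obj (op U))

namespace HDA

variable {α : Type u}

/-- `Path X x y` is the type of paths in the precubical set `X` from the cell `x` to the cell `y`:
sequences of up-steps from `δ_A^0 y` to `y` and of down-steps from `x` to `δ_B^1 x`. -/
inductive Path (X : (Precube α)ᵒᵖ ⥤ Type) :
    {U V : Precube α} → X.obj (op U) → X.obj (op V) → Type u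
  | nil {U : Precube α} (x : X.obj (op U)) : Path X x x
  | up {U V W : Precube α} (d : U ⟶ V) (hd : d.B = ∅) (y : X.obj (op V)) {z : X.obj (op W)}
      (p : Path X y z) : Path X (X.map d.op y) z
  | down {U V W : Precube α} (d : V ⟶ U) (hd : d.A = ∅) (x : X.obj (op U)) {z : X.obj (op W)}
      (p : Path X (X.map d.op x) z) : Path X x z

/-- The ipomset of a path: the gluing composition of the ipomsets of its steps (and of the
identity ipomset on its last cell, which is neutral). -/
noncomputable def Path.ev {X : (Precube α)ᵒᵖ ⥤ Type} :
    {U V : Precube α} → {x : X.obj (op U)} → {y : X.obj (op V)} → Path X x y →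
      IposetHom U.lo V.lo
  | U, _, _, _, .nil _ => IposetHom.identity U
  | _, _, _, _, .up d hd _ p => (IposetHom.upStep d hd).comp p.ev
  | _, _, _, _, .down d hd _ p => (IposetHom.downStep d hd).comp p.ev

/-- The set of ipomsets recognised by an HDA: the ipomsets of its accepting paths. -/
def lang (X : HDA α) : Set (Ipomset α) :=
  {P | ∃ (U V : Precube α) (x : X.cells.obj (op U)) (y : X.cells.obj (op V)) (p : Path X.cells x y),
    x ∈ X.start U ∧ y ∈ X.accept V ∧ P = Ipomset.mk p.ev.iposet}

end HDA

/-- A language is regular if it is recognised by an HDA. -/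
def Ipomset.IsRegular {α : Type u} (L : Set (Ipomset α)) : Prop :=
  Ipomset.IsLanguage L ∧ ∃ X : HDA α, X.lang = L

/-! ### Rigidity of finite total orders -/

/-- Two strictly monotone maps with the same range on a finite totally ordered set agree. -/
theorem eq_of_strictMono_of_range_eq {X Y : Type*} [Finite X] {r : X → X → Prop}
    {s : Y → Y → Prop} (rirr : ∀ x, ¬ r x x) (rtrans : ∀ x y z, r x y → r y z → r x z)
    (rtot : ∀ x y, x = y ∨ r x y ∨ r y x) (sirr : ∀ x, ¬ s x x)
    (strans : ∀ x y z, s x y → s y z → s x z) {f g : X → Y}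
    (hf : ∀ x y, r x y → s (f x) (f y)) (hg : ∀ x y, r x y → s (g x) (g y))
    (hfg : Set.range f = Set.range g) : f = g := by
  have : IsTrans X r := ⟨rtrans⟩
  have : Std.Irrefl r := ⟨rirr⟩
  have wf : WellFounded r := Finite.wellFounded_of_trans_of_irrefl r
  funext x
  induction x using wf.induction with
  | _ x ih =>
    obtain ⟨y, hy⟩ : f x ∈ Set.range g := hfg ▸ Set.mem_range_self x
    rcases rtot x y with rfl | h | h
    · exact hy.symm
    -- Here `g x` is below `g y = f x`, so a preimage `w` of `g x` under `f` must be below `x`. The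
    -- induction hypothesis then gives `g w = g x`, contradicting monotonicity of `g`.
    · obtain ⟨w, hw⟩ : g x ∈ Set.range f := hfg ▸ Set.mem_range_self x
      have h₁ : s (f w) (f x) := by rw [hw, ← hy]; exact hg _ _ h
      rcases rtot w x with rfl | k | k
      · exact absurd h₁ (sirr _)
      · have h₂ := hg _ _ k
        rw [← ih w k, hw] at h₂
        exact absurd h₂ (sirr _)
      · exact absurd (strans _ _ _ h₁ (hf _ _ k)) (sirr _)
    · have h₁ := hf _ _ h
      rw [ih y h, hy] at h₁
      exact absurd h₁ (sirr _)

namespace Iposet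

variable {α : Type u}

/-! ### Refining maps and embeddings -/

/-- An injective label preserving map that reflects precedence and preserves the event order on
incomparable pairs; a subsumption without the conditions on surjectivity and interfaces. -/
structure IsRefining (P Q : Iposet α) (f : P.carrier → Q.carrier) : Prop where
  injective : Function.Injective f
  label : ∀ x, Q.label (f x) = P.label x
  prec : ∀ x y, Q.prec (f x) (f y) → P.prec x y
  evord : ∀ x y, P.evord x y → ¬ P.prec x y → ¬ P.prec y x → Q.evord (f x) (f y)

/-- A refining map that also preserves precedence. -/
structure IsEmbedding (P Q : Iposet α) (f : P.carrier → Q.carrier) : Prop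
    extends IsRefining P Q f where
  map_prec : ∀ x y, P.prec x y → Q.prec (f x) (f y)

variable {P Q R : Iposet α}

theorem IsSubsumption.isRefining {f : P.carrier → Q.carrier} (h : IsSubsumption P Q f) :
    IsRefining P Q f :=
  ⟨h.bijective.injective, h.label, h.prec, h.evord⟩

theorem IsRefining.comp {f : P.carrier → Q.carrier} {g : Q.carrier → R.carrier}
    (hg : IsRefining Q R g) (hf : IsRefining P Q f) : IsRefining P R (g ∘ f) where
  injective := hg.injective.comp hf.injective
  label x := (hg.label _).trans (hf.label x)
  prec _ _ h := hf.prec _ _ (hg.prec _ _ h)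
  evord _ _ h h₁ h₂ := hg.evord _ _ (hf.evord _ _ h h₁ h₂)
    (fun h => h₁ (hf.prec _ _ h)) (fun h => h₂ (hf.prec _ _ h))

theorem IsEmbedding.comp {f : P.carrier → Q.carrier} {g : Q.carrier → R.carrier}
    (hg : IsEmbedding Q R g) (hf : IsEmbedding P Q f) : IsEmbedding P R (g ∘ f) :=
  ⟨hg.toIsRefining.comp hf.toIsRefining, fun _ _ h => hg.map_prec _ _ (hf.map_prec _ _ h)⟩

theorem IsEmbedding.id (P : Iposet α) : IsEmbedding P P _root_.id :=
  ⟨(IsSubsumption.id P).isRefining, fun _ _ h => h⟩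

theorem IsEmbedding.prec_iff {f : P.carrier → Q.carrier} (h : IsEmbedding P Q f) (x y) :
    Q.prec (f x) (f y) ↔ P.prec x y :=
  ⟨h.prec x y, h.map_prec x y⟩

/-- Embeddings reflect the event order on incomparable pairs. -/
theorem IsEmbedding.reflect_evord {f : P.carrier → Q.carrier} (h : IsEmbedding P Q f) {x y}
    (hxy : Q.evord (f x) (f y)) (h₁ : ¬ P.prec x y) (h₂ : ¬ P.prec y x) : P.evord x y := by
  rcases P.comparable x y with k | k | k | k | k
  · subst k; exact absurd hxy (Q.evord_irrefl _)
  · exact absurd k h₁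
  · exact absurd k h₂
  · exact k
  · exact absurd (Q.evord_trans _ _ _ hxy (h.evord _ _ k h₂ h₁)) (Q.evord_irrefl _)

/-- A refining map that factors pointwise through an embedding. -/
theorem IsRefining.of_comp {f : P.carrier → R.carrier} (hf : IsRefining P R f)
    {g : Q.carrier → R.carrier} (hg : IsEmbedding Q R g) {h : P.carrier → Q.carrier}
    (hgh : ∀ x, g (h x) = f x) : IsRefining P Q h where
  injective x y hxy := hf.injective (by rw [← hgh, ← hgh, hxy])
  label x := by rw [← hg.label, hgh, hf.label]
  prec x y hxy := hf.prec _ _ (by rw [← hgh, ← hgh]; exact hg.map_prec _ _ hxy)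
  evord x y hxy h₁ h₂ := by
    refine hg.reflect_evord ?_ (fun k => h₁ ?_) (fun k => h₂ ?_)
    · rw [hgh, hgh]; exact hf.evord _ _ hxy h₁ h₂
    · exact hf.prec _ _ (by rw [← hgh, ← hgh]; exact hg.map_prec _ _ k)
    · exact hf.prec _ _ (by rw [← hgh, ← hgh]; exact hg.map_prec _ _ k)

theorem IsEmbedding.of_comp {f : P.carrier → R.carrier} (hf : IsEmbedding P R f)
    {g : Q.carrier → R.carrier} (hg : IsEmbedding Q R g) {h : P.carrier → Q.carrier}
    (hgh : ∀ x, g (h x) = f x) : IsEmbedding P Q h :=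
  ⟨hf.toIsRefining.of_comp hg hgh, fun x y hxy =>
    hg.prec _ _ (by rw [hgh, hgh]; exact hf.map_prec _ _ hxy)⟩

theorem IsRefining.isSubsumption {f : P.carrier → Q.carrier} (h : IsRefining P Q f)
    (hsurj : Function.Surjective f) (hs : f '' P.src = Q.src) (ht : f '' P.tgt = Q.tgt) :
    IsSubsumption P Q f :=
  ⟨⟨h.injective, hsurj⟩, h.label, hs, ht, h.prec, h.evord⟩

theorem IsEmbedding.isomorphic {f : P.carrier → Q.carrier} (h : IsEmbedding P Q f)
    (hsurj : Function.Surjective f) (hs : f '' P.src = Q.src) (ht : f '' P.tgt = Q.tgt) :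
    Isomorphic P Q :=
  ⟨f, h.toIsRefining.isSubsumption hsurj hs ht, h.map_prec⟩

/-! ### Reversal -/

/-- The reversal of an iposet. -/
def rev (P : Iposet α) : Iposet α where
  carrier := P.carrier
  finite := P.finite
  prec x y := P.prec y x
  evord := P.evord
  src := P.tgt
  tgt := P.src
  label := P.label
  prec_irrefl := P.prec_irrefl
  prec_trans x y z h h' := P.prec_trans z y x h' h
  evord_irrefl := P.evord_irrefl
  evord_trans := P.evord_trans
  comparable x y := by
    rcases P.comparable x y with h | h | h | h | h <;> simp [h]
  src_min x hx y := P.tgt_max x hx y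
  tgt_max x hx y := P.src_min x hx y

theorem IsEmbedding.rev {f : P.carrier → Q.carrier} (h : IsEmbedding P Q f) :
    IsEmbedding P.rev Q.rev f :=
  ⟨⟨h.injective, h.label, fun x y => h.prec y x, fun x y k k₁ k₂ => h.evord x y k k₂ k₁⟩,
    fun x y => h.map_prec y x⟩

/-! ### Restrictions -/

/-- The restriction of `P` to `C`, with source interface the minimal elements in `S` and target
interface the maximal elements in `T`. -/
def sub (P : Iposet α) (C S T : Set P.carrier) : Iposet α where
  carrier := C
  finite := by have := P.finite; infer_instance
  prec x y := P.prec x y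
  evord x y := P.evord x y
  src := {x | x.1 ∈ S ∧ ∀ y ∈ C, ¬ P.prec y x}
  tgt := {x | x.1 ∈ T ∧ ∀ y ∈ C, ¬ P.prec x y}
  label x := P.label x
  prec_irrefl x := P.prec_irrefl x
  prec_trans x y z := P.prec_trans x y z
  evord_irrefl x := P.evord_irrefl x
  evord_trans x y z := P.evord_trans x y z
  comparable x y := by
    rcases P.comparable x y with h | h | h | h | h
    · exact Or.inl (Subtype.ext h)
    all_goals simp [h]
  src_min x hx y := hx.2 y y.2
  tgt_max x hx y := hx.2 y y.2

/-- The inclusion of a restriction. -/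
def subVal {C S T : Set P.carrier} (x : (P.sub C S T).carrier) : P.carrier := Subtype.val x

/-- An element of `C`, as an event of a restriction to `C`. -/
def subMk {C : Set P.carrier} (S T : Set P.carrier) (x : P.carrier) (hx : x ∈ C) :
    (P.sub C S T).carrier := ⟨x, hx⟩

theorem subVal_subMk {C S T : Set P.carrier} (x : P.carrier) (hx : x ∈ C) :
    subVal (subMk S T x hx) = x := rfl

theorem subVal_mem {C S T : Set P.carrier} (x : (P.sub C S T).carrier) : subVal x ∈ C :=
  Subtype.property x

theorem sub_isEmbedding (P : Iposet α) (C S T : Set P.carrier) :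
    IsEmbedding (P.sub C S T) P subVal where
  injective := Subtype.val_injective
  label _ := rfl
  prec _ _ h := h
  evord _ _ h _ _ := h
  map_prec _ _ h := h

theorem range_subVal {C S T : Set P.carrier} :
    Set.range (subVal : (P.sub C S T).carrier → P.carrier) = C :=
  Subtype.range_val

/-- The minimality clause in `sub` only serves to make the restriction defined for arbitrary `S`; it
discards nothing when `S` is already minimal in `C`. -/
theorem sub_src {C S T : Set P.carrier} (h : ∀ x ∈ S, ∀ y ∈ C, ¬ P.prec y x) (hS : S ⊆ C) :
    subVal '' (P.sub C S T).src = S := by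
  ext x
  constructor
  · rintro ⟨y, hy, rfl⟩; exact hy.1
  · intro hx; exact ⟨subMk S T x (hS hx), ⟨hx, h x hx⟩, rfl⟩

theorem sub_tgt {C S T : Set P.carrier} (h : ∀ x ∈ T, ∀ y ∈ C, ¬ P.prec x y) (hT : T ⊆ C) :
    subVal '' (P.sub C S T).tgt = T := by
  ext x
  constructor
  · rintro ⟨y, hy, rfl⟩; exact hy.1
  · intro hx; exact ⟨subMk S T x (hT hx), ⟨hx, h x hx⟩, rfl⟩

/-! ### Gluing as a relation -/

/-- `P` is the gluing composition of `R` and `Z`, with structural inclusions `u` and `v`. -/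
structure Glued (R Z P : Iposet α) (u : R.carrier → P.carrier) (v : Z.carrier → P.carrier) :
    Prop where
  left : IsEmbedding R P u
  right : IsEmbedding Z P v
  src : u '' R.src = P.src
  tgt : v '' Z.tgt = P.tgt
  mid : u '' R.tgt = v '' Z.src
  meet : ∀ x y, u x = v y → x ∈ R.tgt
  cover : ∀ x, x ∈ Set.range u ∨ x ∈ Set.range v
  lt : ∀ x ∉ R.tgt, ∀ y ∉ Z.src, P.prec (u x) (v y)

namespace Glued

variable {Z : Iposet α} {u : R.carrier → P.carrier} {v : Z.carrier → P.carrier}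

theorem meet' (h : Glued R Z P u v) (x y) (hxy : u x = v y) : y ∈ Z.src := by
  have : u x ∈ v '' Z.src := h.mid ▸ Set.mem_image_of_mem u (h.meet x y hxy)
  obtain ⟨y', hy', e⟩ := this
  rwa [← h.right.injective (e.trans hxy)]

/-- Events of the first factor are never preceded by events of the second one. -/
theorem not_prec (h : Glued R Z P u v) (x y) : ¬ P.prec (v y) (u x) := by
  intro k
  by_cases hx : x ∈ R.tgt
  · obtain ⟨y', hy', e⟩ : u x ∈ v '' Z.src := h.mid ▸ Set.mem_image_of_mem u hx
    rw [← e, h.right.prec_iff] at k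
    exact Z.src_min _ hy' _ k
  · by_cases hy : y ∈ Z.src
    · obtain ⟨x', hx', e⟩ : v y ∈ u '' R.tgt := h.mid ▸ Set.mem_image_of_mem v hy
      rw [← e, h.left.prec_iff] at k
      exact R.tgt_max _ hx' _ k
    · exact P.prec_irrefl _ (P.prec_trans _ _ _ (h.lt x hx y hy) k)

theorem exists_right (h : Glued R Z P u v) {x} (hx : x ∈ R.tgt) : ∃ y ∈ Z.src, v y = u x := by
  have : u x ∈ v '' Z.src := h.mid ▸ Set.mem_image_of_mem u hx
  exact this

theorem exists_left (h : Glued R Z P u v) {y} (hy : y ∈ Z.src) : ∃ x ∈ R.tgt, u x = v y := by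
  have : v y ∈ u '' R.tgt := h.mid ▸ Set.mem_image_of_mem v hy
  exact this

theorem rev (h : Glued R Z P u v) : Glued Z.rev R.rev P.rev v u where
  left := h.right.rev
  right := h.left.rev
  src := h.tgt
  tgt := h.src
  mid := h.mid.symm
  meet x y hxy := h.meet' y x hxy.symm
  cover x := (h.cover x).symm
  lt x hx y hy := h.lt y hy x hx

/-- Structural inclusions agree with any pair of refining maps on the common interface. -/
theorem agree (h : Glued R Z P u v) {φ : R.carrier → Q.carrier} {ψ : Z.carrier → Q.carrier}
    (hφ : IsRefining R Q φ) (hψ : IsRefining Z Q ψ) (hmid : φ '' R.tgt = ψ '' Z.src) {x y}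
    (hxy : u x = v y) : φ x = ψ y := by
  have hx := h.meet x y hxy
  have := R.finite
  choose m hm hm' using fun x : R.tgt => h.exists_right x.2
  -- Both maps are strictly monotone from the target interface, totally ordered by the event order,
  -- and have the same image, so rigidity forces them to agree.
  have key : (fun x : R.tgt => φ x.1) = fun x : R.tgt => ψ (m x) := by
    apply eq_of_strictMono_of_range_eq (r := R.tgtLo.ord) (s := Q.evord) R.tgtLo.irrefl
      R.tgtLo.trans R.tgtLo.total Q.evord_irrefl Q.evord_trans
    · exact fun x y k => hφ.evord _ _ k (R.tgt_max _ x.2 _) (R.tgt_max _ y.2 _)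
    · intro x y k
      have h₁ := Z.src_min _ (hm y) (m x)
      have h₂ := Z.src_min _ (hm x) (m y)
      refine hψ.evord _ _ (h.right.reflect_evord ?_ h₁ h₂) h₁ h₂
      rw [hm', hm']
      exact h.left.evord _ _ k (R.tgt_max _ x.2 _) (R.tgt_max _ y.2 _)
    · ext q
      constructor
      · rintro ⟨x, rfl⟩
        obtain ⟨y, hy, e⟩ : φ x.1 ∈ ψ '' Z.src := hmid ▸ Set.mem_image_of_mem φ x.2
        obtain ⟨x', hx', e'⟩ := h.exists_left hy
        refine ⟨⟨x', hx'⟩, ?_⟩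
        simp only
        rw [← e, h.right.injective ((hm' ⟨x', hx'⟩).trans e')]
      · rintro ⟨x, rfl⟩
        obtain ⟨y, hy, e⟩ : ψ (m x) ∈ φ '' R.tgt := hmid ▸ Set.mem_image_of_mem ψ (hm x)
        exact ⟨⟨y, hy⟩, e⟩
  have := congrFun key ⟨x, hx⟩
  rw [← h.right.injective ((hm' ⟨x, hx⟩).trans hxy)]
  exact this

/-- Universal property of gluing compositions for refining maps. -/
theorem exists_map (h : Glued R Z P u v) {φ : R.carrier → Q.carrier} {ψ : Z.carrier → Q.carrier}
    (hφ : IsRefining R Q φ) (hψ : IsRefining Z Q ψ) (hmid : φ '' R.tgt = ψ '' Z.src)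
    (hmeet : ∀ x y, φ x = ψ y → x ∈ R.tgt)
    (hback : ∀ x ∉ R.tgt, ∀ y ∉ Z.src, ¬ Q.prec (ψ y) (φ x)) :
    ∃ f, IsRefining P Q f ∧ (∀ x, f (u x) = φ x) ∧ ∀ y, f (v y) = ψ y := by
  classical
  -- Both factors may prescribe the value at `x`; by `agree` the prescriptions are consistent.
  have hP : ∀ x, ∃ q, (∀ a, u a = x → φ a = q) ∧ ∀ b, v b = x → ψ b = q := by
    intro x
    by_cases hx : x ∈ Set.range u
    · obtain ⟨a, rfl⟩ := hx
      refine ⟨φ a, fun a' e => by rw [h.left.injective e], fun b e => ?_⟩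
      exact (h.agree hφ hψ hmid e.symm).symm
    · obtain ⟨b, rfl⟩ := (h.cover x).resolve_left hx
      exact ⟨ψ b, fun a e => absurd ⟨a, e⟩ hx, fun b' e => by rw [h.right.injective e]⟩
  choose f hf hf' using hP
  have hu : ∀ x, f (u x) = φ x := fun x => (hf _ x rfl).symm
  have hv : ∀ x, f (v x) = ψ x := fun x => (hf' _ x rfl).symm
  have hcross : ∀ a b, φ a = ψ b → u a = v b := by
    intro a b e
    obtain ⟨b', hb', e'⟩ := h.exists_right (hmeet a b e)
    have := h.agree hφ hψ hmid e'.symm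
    rw [← e', hψ.injective (this.symm.trans e)]
  -- Two events of a gluing either lie in a common factor, or are proper to different factors and
  -- hence ordered by precedence. Each condition on `f` is checked in these cases.
  have hpair : ∀ x y, (∃ a a', u a = x ∧ u a' = y) ∨ (∃ b b', v b = x ∧ v b' = y) ∨
      (∃ a ∉ R.tgt, ∃ b ∉ Z.src, u a = x ∧ v b = y) ∨
      (∃ a ∉ R.tgt, ∃ b ∉ Z.src, u a = y ∧ v b = x) := by
    intro x y
    by_cases hx : x ∈ Set.range u
    · by_cases hy : y ∈ Set.range u
      · obtain ⟨a, rfl⟩ := hx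
        obtain ⟨a', rfl⟩ := hy
        exact Or.inl ⟨a, a', rfl, rfl⟩
      · obtain ⟨a, rfl⟩ := hx
        obtain ⟨b, rfl⟩ := (h.cover y).resolve_left hy
        by_cases ha : a ∈ R.tgt
        · obtain ⟨b', -, e⟩ := h.exists_right ha
          exact Or.inr (Or.inl ⟨b', b, e, rfl⟩)
        · refine Or.inr (Or.inr (Or.inl ⟨a, ha, b, fun hb => hy ?_, rfl, rfl⟩))
          obtain ⟨a', -, e⟩ := h.exists_left hb
          exact ⟨a', e⟩
    · obtain ⟨b, rfl⟩ := (h.cover x).resolve_left hx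
      by_cases hy : y ∈ Set.range u
      · obtain ⟨a, rfl⟩ := hy
        by_cases ha : a ∈ R.tgt
        · obtain ⟨b', -, e⟩ := h.exists_right ha
          exact Or.inr (Or.inl ⟨b, b', rfl, e⟩)
        · refine Or.inr (Or.inr (Or.inr ⟨a, ha, b, fun hb => hx ?_, rfl, rfl⟩))
          obtain ⟨a', -, e⟩ := h.exists_left hb
          exact ⟨a', e⟩
      · obtain ⟨b', rfl⟩ := (h.cover y).resolve_left hy
        exact Or.inr (Or.inl ⟨b, b', rfl, rfl⟩)
  refine ⟨f, ⟨?_, ?_, ?_, ?_⟩, hu, hv⟩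
  · intro x y e
    rcases hpair x y with ⟨a, a', rfl, rfl⟩ | ⟨b, b', rfl, rfl⟩ | ⟨a, ha, b, hb, rfl, rfl⟩ |
      ⟨a, ha, b, hb, rfl, rfl⟩
    · rw [hu, hu] at e; rw [hφ.injective e]
    · rw [hv, hv] at e; rw [hψ.injective e]
    · rw [hu, hv] at e; exact hcross _ _ e
    · rw [hu, hv] at e; exact (hcross _ _ e.symm).symm
  · intro x
    rcases h.cover x with ⟨a, rfl⟩ | ⟨b, rfl⟩
    · rw [hu, hφ.label, h.left.label]
    · rw [hv, hψ.label, h.right.label]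
  · intro x y e
    rcases hpair x y with ⟨a, a', rfl, rfl⟩ | ⟨b, b', rfl, rfl⟩ | ⟨a, ha, b, hb, rfl, rfl⟩ |
      ⟨a, ha, b, hb, rfl, rfl⟩
    · rw [hu, hu] at e; exact h.left.map_prec _ _ (hφ.prec _ _ e)
    · rw [hv, hv] at e; exact h.right.map_prec _ _ (hψ.prec _ _ e)
    · exact h.lt a ha b hb
    · rw [hu, hv] at e; exact absurd e (hback a ha b hb)
  · intro x y e h₁ h₂
    rcases hpair x y with ⟨a, a', rfl, rfl⟩ | ⟨b, b', rfl, rfl⟩ | ⟨a, ha, b, hb, rfl, rfl⟩ |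
      ⟨a, ha, b, hb, rfl, rfl⟩
    · rw [h.left.prec_iff] at h₁ h₂
      rw [hu, hu]; exact hφ.evord _ _ (h.left.reflect_evord e h₁ h₂) h₁ h₂
    · rw [h.right.prec_iff] at h₁ h₂
      rw [hv, hv]; exact hψ.evord _ _ (h.right.reflect_evord e h₁ h₂) h₁ h₂
    · exact absurd (h.lt a ha b hb) h₁
    · exact absurd (h.lt a ha b hb) h₂

/-- A gluing composition is subsumed by `Q` if its factors map to `Q` in a compatible way. -/
theorem subsumed_of_maps (h : Glued R Z P u v) {φ : R.carrier → Q.carrier}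
    {ψ : Z.carrier → Q.carrier} (hφ : IsRefining R Q φ) (hψ : IsRefining Z Q ψ)
    (hmid : φ '' R.tgt = ψ '' Z.src) (hmeet : ∀ x y, φ x = ψ y → x ∈ R.tgt)
    (hback : ∀ x ∉ R.tgt, ∀ y ∉ Z.src, ¬ Q.prec (ψ y) (φ x))
    (hcover : ∀ x, x ∈ Set.range φ ∨ x ∈ Set.range ψ) (hsrc : φ '' R.src = Q.src)
    (htgt : ψ '' Z.tgt = Q.tgt) : Subsumed P Q := by
  obtain ⟨f, hf, hu, hv⟩ := h.exists_map hφ hψ hmid hmeet hback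
  refine ⟨f, hf.isSubsumption (fun x => ?_) ?_ ?_⟩
  · rcases hcover x with ⟨y, rfl⟩ | ⟨y, rfl⟩
    exacts [⟨_, hu y⟩, ⟨_, hv y⟩]
  · rw [← h.src, ← hsrc, Set.image_image]
    simp only [hu]
  · rw [← h.tgt, ← htgt, Set.image_image]
    simp only [hv]

/-- Universal property of gluing compositions for embeddings. -/
theorem exists_embedding (h : Glued R Z P u v) {φ : R.carrier → Q.carrier}
    {ψ : Z.carrier → Q.carrier} (hφ : IsEmbedding R Q φ) (hψ : IsEmbedding Z Q ψ)
    (hmid : φ '' R.tgt = ψ '' Z.src) (hmeet : ∀ x y, φ x = ψ y → x ∈ R.tgt)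
    (hlt : ∀ x ∉ R.tgt, ∀ y ∉ Z.src, Q.prec (φ x) (ψ y)) :
    ∃ f, IsEmbedding P Q f ∧ (∀ x, f (u x) = φ x) ∧ ∀ y, f (v y) = ψ y := by
  obtain ⟨f, hf, hu, hv⟩ := h.exists_map hφ.toIsRefining hψ.toIsRefining hmid hmeet
    (fun x hx y hy k => Q.prec_irrefl _ (Q.prec_trans _ _ _ (hlt x hx y hy) k))
  refine ⟨f, ⟨hf, fun x y e => ?_⟩, hu, hv⟩
  rcases h.cover x with ⟨a, rfl⟩ | ⟨b, rfl⟩ <;> rcases h.cover y with ⟨a', rfl⟩ | ⟨b', rfl⟩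
  · rw [hu, hu]; exact hφ.map_prec _ _ (h.left.prec _ _ e)
  · by_cases ha : a ∈ R.tgt
    · obtain ⟨b, -, eb⟩ := h.exists_right ha
      rw [← eb] at e ⊢
      rw [hv, hv]; exact hψ.map_prec _ _ (h.right.prec _ _ e)
    · by_cases hb : b' ∈ Z.src
      · obtain ⟨a', -, ea⟩ := h.exists_left hb
        rw [← ea] at e ⊢
        rw [hu, hu]; exact hφ.map_prec _ _ (h.left.prec _ _ e)
      · rw [hu, hv]; exact hlt a ha b' hb
  · exact absurd e (h.not_prec _ _)
  · rw [hv, hv]; exact hψ.map_prec _ _ (h.right.prec _ _ e)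

end Glued

end Iposet

/-! ### Gluing compositions: existence, monotonicity, uniqueness, associativity -/

namespace Iposet

variable {α : Type u} {P Q R Z : Iposet α}

/-- Connects the concrete quotient with the relation `Glued`. The relation allows any carrier for
the result, so that iterated gluings can be rebracketed inside a fixed iposet. -/
theorem glued_glue (f : LoIso P.tgtLo Q.srcLo) :
    Glued P Q (glue P Q f) Sum.inl (glueInr f) where
  left := by
    refine ⟨⟨Sum.inl_injective, fun _ => rfl, ?_, ?_⟩, ?_⟩
    · rintro x y (⟨p, p', e, e', h⟩ | ⟨q, q', e, e', h⟩ | ⟨p, q, e, e', -, h⟩)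
      · cases e; cases e'; exact h
      · obtain ⟨_, rfl⟩ := (inl_eq_glueInr_iff f).1 e'
        exact absurd h (Q.src_min _ (Subtype.property _) _)
      · obtain ⟨_, rfl⟩ := (inl_eq_glueInr_iff f).1 e'
        exact absurd (Subtype.property _) h
    · exact fun x y h _ _ => .single (Or.inl ⟨x, y, rfl, rfl, h⟩)
    · exact fun x y h => Or.inl ⟨x, y, rfl, rfl, h⟩
  right := by
    refine ⟨⟨glueInr_injective f, glue_label_glueInr f, ?_, ?_⟩, ?_⟩
    · rintro x y (⟨p, p', e, e', h⟩ | ⟨q, q', e, e', h⟩ | ⟨p, q, e, e', h, -⟩)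
      · exact absurd h (P.tgt_max _ ((inl_eq_glueInr_iff f).1 e.symm).1 _)
      · rwa [glueInr_injective f e, glueInr_injective f e']
      · exact absurd ((inl_eq_glueInr_iff f).1 e.symm).1 h
    · exact fun x y h _ _ => .single (Or.inr ⟨x, y, rfl, rfl, h⟩)
    · exact fun x y h => Or.inr (Or.inl ⟨x, y, rfl, rfl, h⟩)
  src := rfl
  tgt := rfl
  mid := by
    ext x
    constructor
    · rintro ⟨p, hp, rfl⟩
      exact ⟨_, (f.toEquiv ⟨p, hp⟩).2, ((inl_eq_glueInr_iff f).2 ⟨hp, rfl⟩).symm⟩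
    · rintro ⟨q, hq, rfl⟩
      refine ⟨_, (f.toEquiv.symm ⟨q, hq⟩).2, (inl_eq_glueInr_iff f).2 ⟨Subtype.property _, ?_⟩⟩
      simp
  meet x y h := ((inl_eq_glueInr_iff f).1 h).1
  cover x := by
    rcases x with p | ⟨q, hq⟩
    · exact Or.inl ⟨p, rfl⟩
    · exact Or.inr ⟨q, glueInr_of_notMem f hq⟩
  lt x hx y hy := Or.inr (Or.inr ⟨x, y, rfl, rfl, hx, hy⟩)

/-- A gluing composition exists as soon as both interfaces are isomorphic to a third lo-set. -/
theorem exists_glued {U : LoSet α} (f : LoIso U P.tgtLo) (g : LoIso U Q.srcLo) :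
    ∃ (G : Iposet α) (u : P.carrier → G.carrier) (v : Q.carrier → G.carrier),
      Glued P Q G u v ∧ ∀ x, u (f.toEquiv x).1 = v (g.toEquiv x).1 := by
  refine ⟨_, _, _, glued_glue (f.symm.trans g), fun x => ?_⟩
  exact (inl_eq_glueInr_iff _).2 ⟨Subtype.property _, by simp [LoIso.trans, LoIso.symm]⟩

namespace Glued

variable {u : R.carrier → P.carrier} {v : Z.carrier → P.carrier}

/-- Each event of the target interface of `R` is matched with the event of `Z` that has the same
image in `P`. Thus `Glued` retains the isomorphism along which the factors were glued. -/
theorem exists_loIso (h : Glued R Z P u v) :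
    ∃ f : LoIso R.tgtLo Z.srcLo, ∀ x, v (f.toEquiv x).1 = u x.1 := by
  choose m hm hm' using fun x : R.tgt => h.exists_right x.2
  refine ⟨LoIso.ofBijective (U := R.tgtLo) (V := Z.srcLo) (fun x => ⟨m x, hm x⟩)
    ⟨fun x y e => ?_, fun y => ?_⟩ (fun x y k => ?_) fun x => ?_, hm'⟩
  · have e' : m x = m y := congrArg Subtype.val e
    exact Subtype.ext (h.left.injective (by rw [← hm', ← hm', e']))
  · obtain ⟨x, hx, e⟩ := h.exists_left y.2
    exact ⟨⟨x, hx⟩, Subtype.ext (h.right.injective ((hm' _).trans e))⟩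
  · refine h.right.reflect_evord ?_ (Z.src_min _ (hm y) (m x)) (Z.src_min _ (hm x) (m y))
    rw [hm', hm']
    exact h.left.evord _ _ k (R.tgt_max _ x.2 _) (R.tgt_max _ y.2 _)
  · change Z.label (m x) = R.label x
    rw [← h.right.label, hm', h.left.label]

/-- Gluing composition is monotone for subsumption. -/
theorem subsumed (h : Glued R Z P u v) {R' Z' P' : Iposet α} {u' : R'.carrier → P'.carrier}
    {v' : Z'.carrier → P'.carrier} (h' : Glued R' Z' P' u' v') (hR : Subsumed R R')
    (hZ : Subsumed Z Z') : Subsumed P P' := by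
  obtain ⟨φ, hφ⟩ := hR
  obtain ⟨ψ, hψ⟩ := hZ
  have inv : ∀ x, φ x ∈ R'.tgt → x ∈ R.tgt := by
    intro x hx
    rw [← hφ.tgt] at hx
    obtain ⟨y, hy, e⟩ := hx
    rwa [← hφ.bijective.injective e]
  refine h.subsumed_of_maps (h'.left.toIsRefining.comp hφ.isRefining)
    (h'.right.toIsRefining.comp hψ.isRefining)
    (by rw [Set.image_comp, Set.image_comp, hφ.tgt, hψ.src, h'.mid])
    (fun x y e => inv x (h'.meet _ _ e)) (fun x _ y _ => h'.not_prec _ _) (fun x => ?_)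
    (by rw [Set.image_comp, hφ.src, h'.src]) (by rw [Set.image_comp, hψ.tgt, h'.tgt])
  rcases h'.cover x with ⟨a, rfl⟩ | ⟨b, rfl⟩
  · obtain ⟨a, rfl⟩ := hφ.bijective.surjective a
    exact Or.inl ⟨a, rfl⟩
  · obtain ⟨b, rfl⟩ := hψ.bijective.surjective b
    exact Or.inr ⟨b, rfl⟩

/-- The gluing composition is unique up to isomorphism. -/
theorem isomorphic (h : Glued R Z P u v) {P' : Iposet α} {u' : R.carrier → P'.carrier}
    {v' : Z.carrier → P'.carrier} (h' : Glued R Z P' u' v') : Isomorphic P P' := by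
  obtain ⟨f, hf, hu, hv⟩ := h.exists_embedding h'.left h'.right h'.mid h'.meet h'.lt
  refine hf.isomorphic (fun x => ?_) ?_ ?_
  · rcases h'.cover x with ⟨a, rfl⟩ | ⟨b, rfl⟩
    · exact ⟨_, hu a⟩
    · exact ⟨_, hv b⟩
  · rw [← h.src, ← h'.src, Set.image_image]
    simp [hu]
  · rw [← h.tgt, ← h'.tgt, Set.image_image]
    simp [hv]

/-- Associativity: a gluing decomposition of the first factor can be moved to the second one. -/
theorem assoc {R₁ R₂ : Iposet α} {u₁ : R₁.carrier → R.carrier} {u₂ : R₂.carrier → R.carrier}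
    (h₁ : Glued R₁ R₂ R u₁ u₂) (h : Glued R Z P u v) :
    ∃ (Y : Iposet α) (w₁ : R₂.carrier → Y.carrier) (w₂ : Z.carrier → Y.carrier)
      (w : Y.carrier → P.carrier), Glued R₂ Z Y w₁ w₂ ∧ Glued R₁ Y P (u ∘ u₁) w ∧
      (∀ x, w (w₁ x) = u (u₂ x)) ∧ ∀ y, w (w₂ y) = v y := by
  -- The gluing of `R₂` and `Z` is found inside `P`, as the restriction to the events of these two
  -- factors.
  set C : Set P.carrier := Set.range (u ∘ u₂) ∪ Set.range v with hC
  set S : Set P.carrier := (u ∘ u₂) '' R₂.src with hS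
  have hw₁ : ∀ x, u (u₂ x) ∈ C := fun x => Or.inl ⟨x, rfl⟩
  have hw₂ : ∀ y, v y ∈ C := fun y => Or.inr ⟨y, rfl⟩
  have emb := P.sub_isEmbedding C S P.tgt
  have inj := Set.image_injective.2 emb.injective
  have hsrc : subVal '' (P.sub C S P.tgt).src = S := by
    refine sub_src ?_ ?_
    · rintro _ ⟨r, hr, rfl⟩ _ (⟨r', rfl⟩ | ⟨z, rfl⟩)
      · exact fun k => R₂.src_min r hr r' (h₁.right.prec _ _ (h.left.prec _ _ k))
      · exact h.not_prec _ _
    · rintro _ ⟨r, -, rfl⟩; exact hw₁ r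
  have htgt : subVal '' (P.sub C S P.tgt).tgt = P.tgt := by
    refine sub_tgt (fun x hx y _ => P.tgt_max x hx y) ?_
    rw [← h.tgt]
    rintro _ ⟨z, -, rfl⟩; exact hw₂ z
  have hR : ∀ r, u₂ r ∈ R.tgt ↔ r ∈ R₂.tgt := by
    intro r
    rw [← h₁.tgt]
    exact h₁.right.injective.mem_set_image
  refine ⟨P.sub C S P.tgt, fun x => subMk _ _ (u (u₂ x)) (hw₁ x),
    fun y => subMk _ _ (v y) (hw₂ y), subVal,
    ⟨?_, ?_, ?_, ?_, ?_, ?_, ?_, ?_⟩, ⟨?_, emb, ?_, htgt, ?_, ?_, ?_, ?_⟩,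
    fun _ => rfl, fun _ => rfl⟩
  · exact (h.left.comp h₁.right).of_comp emb fun _ => rfl
  · exact h.right.of_comp emb fun _ => rfl
  · apply inj
    rw [hsrc, Set.image_image, hS]; rfl
  · apply inj
    rw [htgt, Set.image_image, ← h.tgt]; rfl
  · apply inj
    simp only [Set.image_image, subVal_subMk]
    rw [← h.mid, ← h₁.tgt, Set.image_image]
  · intro x y e
    exact (hR x).1 (h.meet _ _ (congrArg subVal e))
  · rintro ⟨_, ⟨r, rfl⟩ | ⟨z, rfl⟩⟩
    · exact Or.inl ⟨r, rfl⟩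
    · exact Or.inr ⟨z, rfl⟩
  · exact fun x hx y hy => h.lt _ (fun k => hx ((hR x).1 k)) _ hy
  · exact h.left.comp h₁.left
  · rw [Set.image_comp, h₁.src, h.src]
  · rw [hsrc, Set.image_comp, h₁.mid, hS, Set.image_comp]
  · rintro x ⟨_, ⟨r, rfl⟩ | ⟨z, rfl⟩⟩ e
    · exact h₁.meet x r (h.left.injective e)
    · have := h.meet _ _ e
      rw [← h₁.tgt] at this
      obtain ⟨r, -, e'⟩ := this
      exact h₁.meet x r e'.symm
  · intro x
    rcases h.cover x with ⟨r, rfl⟩ | ⟨z, rfl⟩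
    · rcases h₁.cover r with ⟨r, rfl⟩ | ⟨r, rfl⟩
      · exact Or.inl ⟨r, rfl⟩
      · exact Or.inr ⟨⟨_, hw₁ r⟩, rfl⟩
    · exact Or.inr ⟨⟨_, hw₂ z⟩, rfl⟩
  · have key : ∀ x ∉ R₁.tgt, ∀ r, u (u₂ r) ∉ S → P.prec (u (u₁ x)) (u (u₂ r)) := by
      intro x hx r hr
      exact h.left.map_prec _ _ (h₁.lt x hx r fun k => hr ⟨r, k, rfl⟩)
    have mem : ∀ y : (P.sub C S P.tgt).carrier, y ∉ (P.sub C S P.tgt).src → subVal y ∉ S := by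
      intro y hy k
      rw [← hsrc] at k
      obtain ⟨y', hy', e⟩ := k
      exact hy (emb.injective e ▸ hy')
    intro x hx y hy
    have hy := mem y hy
    obtain ⟨_, ⟨r, rfl⟩ | ⟨z, rfl⟩⟩ := y
    · exact key x hx r hy
    -- An event in the source interface of `Z` comes from the target interface of `R`, hence from
    -- `R₂`, which reduces to `key`.
    · by_cases hz : z ∈ Z.src
      · obtain ⟨r', hr', e⟩ := h.exists_left hz
        rw [← h₁.tgt] at hr'
        obtain ⟨r, -, rfl⟩ := hr'
        change v z ∉ S at hy
        change P.prec _ (v z)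
        rw [← e] at hy ⊢
        exact key x hx r hy
      · refine h.lt _ (fun k => ?_) _ hz
        rw [← h₁.tgt] at k
        obtain ⟨r, -, e⟩ := k
        exact hx (h₁.meet x r e.symm)

/-- Associativity: a gluing decomposition of the second factor can be moved to the first one. -/
theorem assoc_symm {Z₁ Z₂ : Iposet α} {v₁ : Z₁.carrier → Z.carrier} {v₂ : Z₂.carrier → Z.carrier}
    (h₁ : Glued Z₁ Z₂ Z v₁ v₂) (h : Glued R Z P u v) :
    ∃ (Y : Iposet α) (w₁ : R.carrier → Y.carrier) (w₂ : Z₁.carrier → Y.carrier)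
      (w : Y.carrier → P.carrier), Glued R Z₁ Y w₁ w₂ ∧ Glued Y Z₂ P w (v ∘ v₂) ∧
      (∀ x, w (w₁ x) = u x) ∧ ∀ y, w (w₂ y) = v (v₁ y) := by
  obtain ⟨Y, w₁, w₂, w, hY, hP, e₁, e₂⟩ := h₁.rev.assoc h.rev
  exact ⟨Y.rev, w₂, w₁, w, hY.rev, hP.rev, e₂, e₁⟩

end Glued

/-! ### Interval orders -/

/-- Interval iposets are those that do not contain two parallel chains of length two. -/
theorem isInterval_iff : P.IsInterval ↔
    ∀ w x y z, P.prec w x → P.prec y z → P.prec w z ∨ P.prec y x := by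
  constructor
  · rintro ⟨b, e, -, h⟩ w x y z hwx hyz
    rw [h] at *
    rw [h]
    by_contra! k
    linarith [k.1, k.2]
  · intro h
    have := P.finite
    -- Without two parallel chains, the sets of predecessors are linearly ordered by inclusion, so
    -- their cardinalities can serve as left endpoints.
    let D : P.carrier → Set P.carrier := fun y => {x | P.prec x y}
    have hD : ∀ y z, (D y).ncard ≤ (D z).ncard → D y ⊆ D z := by
      intro y z hyz w hw
      by_contra hwz
      have hzy : D z ⊆ D y := fun x hx => (h x z w y hx hw).resolve_right hwz
      rw [Set.eq_of_subset_of_ncard_le hzy hyz] at hwz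
      exact hwz hw
    have hlt : ∀ x y, P.prec x y → (D x).ncard < (D y).ncard := fun x y hxy =>
      Set.ncard_lt_ncard ⟨fun w hw => P.prec_trans _ _ _ hw hxy,
        fun k => P.prec_irrefl x (k hxy)⟩
    -- The right endpoint is one less than the least left endpoint of a successor. That left
    -- endpoint is positive, as a successor has `x` among its predecessors. For a maximal event, any
    -- bound for all left endpoints will do.
    have he : ∀ x, ∃ e : ℕ, (D x).ncard ≤ e ∧ ∀ y, P.prec x y ↔ e < (D y).ncard := by
      intro x
      by_cases hx : ∃ y, P.prec x y
      · obtain ⟨y, hxy, hy⟩ := Set.exists_min_image {y | P.prec x y} (fun y => (D y).ncard)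
          (Set.toFinite _) hx
        have hp := hlt x y hxy
        refine ⟨(D y).ncard - 1, by omega, fun z => ⟨fun hz => ?_, fun hz => ?_⟩⟩
        · have := hy z hz
          omega
        · exact hD y z (by omega) hxy
      · push Not at hx
        refine ⟨Nat.card P.carrier, Set.ncard_le_card _, fun z => ⟨fun hz => absurd hz (hx z), ?_⟩⟩
        intro k
        exact absurd k (not_lt.2 (Set.ncard_le_card _))
    choose e he₁ he₂ using he
    exact ⟨fun x => (D x).ncard, fun x => e x, fun x => Nat.cast_le.2 (he₁ x),
      fun x y => by rw [he₂]; exact Nat.cast_lt.symm⟩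

theorem IsEmbedding.isInterval {f : P.carrier → Q.carrier} (h : IsEmbedding P Q f)
    (hQ : Q.IsInterval) : P.IsInterval := by
  obtain ⟨b, e, hbe, hp⟩ := hQ
  exact ⟨b ∘ f, e ∘ f, fun x => hbe _, fun x y => by rw [← h.prec_iff, hp]; rfl⟩

theorem isInterval_discrete (w : List α) (S T : Set (Fin w.length)) :
    (discrete w S T).IsInterval :=
  isInterval_iff.2 fun _ _ _ _ h _ => h.elim

/-- Events proper to the first factor precede all events proper to the second one. Hence two
parallel chains in a gluing would already lie in a single factor. -/
theorem Glued.isInterval {u : R.carrier → P.carrier} {v : Z.carrier → P.carrier}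
    (h : Glued R Z P u v) (hR : R.IsInterval) (hZ : Z.IsInterval) : P.IsInterval := by
  rw [isInterval_iff] at *
  have left : ∀ w x, P.prec w (u x) → ∃ a ∉ R.tgt, u a = w ∧ R.prec a x := by
    intro w x k
    rcases h.cover w with ⟨a, rfl⟩ | ⟨b, rfl⟩
    · have := h.left.prec _ _ k
      exact ⟨a, fun ha => R.tgt_max _ ha _ this, rfl, this⟩
    · exact absurd k (h.not_prec _ _)
  have right : ∀ x ∉ Set.range u, ∃ b ∉ Z.src, v b = x := by
    intro x hx
    obtain ⟨b, rfl⟩ := (h.cover x).resolve_left hx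
    refine ⟨b, fun hb => hx ?_, rfl⟩
    obtain ⟨a, -, e⟩ := h.exists_left hb
    exact ⟨a, e⟩
  have cross : ∀ w ∉ Set.range v, ∀ x ∉ Set.range u, P.prec w x := by
    intro w hw x hx
    obtain ⟨b, hb, rfl⟩ := right x hx
    obtain ⟨a, rfl⟩ := (h.cover w).resolve_right hw
    refine h.lt a (fun ha => hw ?_) b hb
    obtain ⟨b, -, e⟩ := h.exists_right ha
    exact ⟨b, e⟩
  intro w x y z hwx hyz
  by_cases hx : x ∈ Set.range u
  · obtain ⟨x, rfl⟩ := hx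
    obtain ⟨w, hw, rfl, hwx'⟩ := left _ _ hwx
    by_cases hz : z ∈ Set.range u
    · obtain ⟨z, rfl⟩ := hz
      obtain ⟨y, hy, rfl, hyz'⟩ := left _ _ hyz
      simp only [h.left.prec_iff]
      exact hR _ _ _ _ hwx' hyz'
    · obtain ⟨b, hb, rfl⟩ := right z hz
      exact Or.inl (h.lt _ hw _ hb)
  · by_cases hz : z ∈ Set.range u
    · obtain ⟨z, rfl⟩ := hz
      obtain ⟨y, hy, rfl, hyz⟩ := left _ _ hyz
      obtain ⟨b, hb, rfl⟩ := right x hx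
      exact Or.inr (h.lt _ hy _ hb)
    · by_cases hw : w ∈ Set.range v
      · by_cases hy : y ∈ Set.range v
        · obtain ⟨b, hb, rfl⟩ := right x hx
          obtain ⟨c, hc, rfl⟩ := right z hz
          obtain ⟨w, rfl⟩ := hw
          obtain ⟨y, rfl⟩ := hy
          simp only [h.right.prec_iff] at *
          exact hZ _ _ _ _ hwx hyz
        · exact Or.inr (cross y hy x hx)
      · exact Or.inl (cross w hw z hz)

/-! ### Cuts -/

/-- A cut of `P`: the set `C` of events that have been started, and the set `T ⊆ C` of events
that are active. -/
structure IsCut (P : Iposet α) (C T : Set P.carrier) : Prop where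
  subset : T ⊆ C
  src : P.src ⊆ C
  tgt : ∀ x ∈ P.tgt, x ∈ C → x ∈ T
  max : ∀ x ∈ T, ∀ y ∈ C, ¬ P.prec x y
  min : ∀ x ∈ T, ∀ y ∉ C, ¬ P.prec y x
  lt : ∀ x ∈ C, x ∉ T → ∀ y ∉ C, P.prec x y

/-- The active events `T` form the common interface, and the clause `lt` says that terminated events
precede unstarted ones, just as a gluing requires. -/
theorem IsCut.glued {C T : Set P.carrier} (h : IsCut P C T) :
    Glued (P.sub C P.src T) (P.sub (T ∪ Cᶜ) T P.tgt) P subVal subVal := by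
  have hT : ∀ x ∈ T, ∀ y ∈ T ∪ Cᶜ, ¬ P.prec y x := by
    rintro x hx y (hy | hy)
    · exact h.max y hy x (h.subset hx)
    · exact h.min x hx y hy
  have e₁ := sub_tgt (S := P.src) h.max h.subset
  have e₂ := sub_src (T := P.tgt) hT Set.subset_union_left
  refine ⟨sub_isEmbedding _ _ _ _, sub_isEmbedding _ _ _ _,
    sub_src (fun x hx y _ => P.src_min x hx y) h.src,
    sub_tgt (fun x hx y _ => P.tgt_max x hx y) fun x hx => ?_, ?_, ?_, ?_, ?_⟩
  · by_cases hC : x ∈ C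
    · exact Or.inl (h.tgt x hx hC)
    · exact Or.inr hC
  · rw [e₁, e₂]
  · rintro ⟨x, hx⟩ ⟨_, hy⟩ rfl
    have : x ∈ T := hy.resolve_right fun k => k hx
    exact ⟨this, h.max x this⟩
  · intro x
    by_cases hC : x ∈ C
    · exact Or.inl ⟨⟨x, hC⟩, rfl⟩
    · exact Or.inr ⟨⟨x, Or.inr hC⟩, rfl⟩
  · rintro ⟨x, hx⟩ hxT ⟨y, hy⟩ hyT
    have hx' : x ∉ T := fun k => hxT ⟨k, h.max x k⟩
    have hy' : y ∉ T := fun k => hyT ⟨k, hT y k⟩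
    exact h.lt x hx hx' y (hy.resolve_left hy')

/-- In an interval iposet, there is a cut after the last of the given events has been started. -/
theorem exists_isCut (hP : P.IsInterval) (X : Set P.carrier) (hX : P.src ⊆ X ∨ X.Nonempty) :
    ∃ C T, IsCut P C T ∧ X ⊆ C ∧ ∀ x ∈ C, x ∉ T → ∃ y ∈ X, P.prec x y := by
  rw [isInterval_iff] at hP
  -- Comparing predecessor sets compares starting times: `C` consists of the events that start no
  -- later than some event of `X`, and `T` of those among them that precede no event of `X`.
  refine ⟨{x | ∃ y ∈ X, ∀ w, P.prec w x → P.prec w y},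
    {x | (∃ y ∈ X, ∀ w, P.prec w x → P.prec w y) ∧ ¬ ∃ y ∈ X, P.prec x y},
    ⟨fun x hx => hx.1, ?_, ?_, ?_, ?_, ?_⟩, fun x hx => ⟨x, hx, fun _ h => h⟩, ?_⟩
  · intro x hx
    rcases hX with h | ⟨y, hy⟩
    · exact ⟨x, h hx, fun _ h => h⟩
    · exact ⟨y, hy, fun w hw => absurd hw (P.src_min x hx w)⟩
  · rintro x hx hxC
    exact ⟨hxC, fun ⟨y, _, h⟩ => P.tgt_max x hx y h⟩
  · rintro x ⟨-, hx⟩ y ⟨z, hz, h⟩ hxy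
    exact hx ⟨z, hz, h x hxy⟩
  · rintro x ⟨⟨z, hz, h⟩, hx⟩ y hy hyx
    exact hy ⟨z, hz, fun w hw => P.prec_trans _ _ _ hw (h y hyx)⟩
  · rintro x hx hxT y hy
    have : ∃ z ∈ X, P.prec x z := by
      by_contra k
      exact hxT ⟨hx, k⟩
    obtain ⟨z, hz, hxz⟩ := this
    -- If `x` does not precede `y`, then the interval condition for `x` before `z` and `w` before
    -- `y` puts every predecessor `w` of `y` before `z`, so that `y` would have been started.
    by_contra hxy
    exact hy ⟨z, hz, fun w hw => (hP x z w y hxz hw).resolve_left hxy⟩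
  · intro x hx hxT
    by_contra k
    exact hxT ⟨hx, k⟩

end Iposet

/-! ### Words of lo-sets -/

/-- A finite total order is enumerated in increasing order by an initial segment of the naturals;
the labels then spell the word. -/
theorem LoSet.exists_word {α : Type u} (U : LoSet α) :
    ∃ w : Precube α, Nonempty (LoIso w.lo U) := by
  classical
  have := U.finite
  have := Fintype.ofFinite U.carrier
  have : IsStrictTotalOrder U.carrier U.ord :=
    { irrefl := U.irrefl
      trans := U.trans
      trichotomous := fun x y h h' => (U.total x y).resolve_right (not_or.2 ⟨h, h'⟩) }
  let ord : LinearOrder U.carrier := linearOrderOfSTO U.ord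
  have hlen : (List.ofFn fun i => U.label (Fintype.orderIsoFinOfCardEq U.carrier rfl i)).length =
      Fintype.card U.carrier := List.length_ofFn
  let o : Fin (List.ofFn fun i => U.label
      (Fintype.orderIsoFinOfCardEq U.carrier rfl i)).length ≃o U.carrier :=
    (Fin.castOrderIso hlen).trans (Fintype.orderIsoFinOfCardEq U.carrier rfl)
  refine ⟨⟨List.ofFn fun i => U.label (Fintype.orderIsoFinOfCardEq U.carrier rfl i)⟩,
    ⟨LoIso.ofBijective (U := Precube.lo _) o o.bijective (fun x y h => ?_) fun x => ?_⟩⟩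
  · exact o.strictMono h
  · simp [o]
    rfl

/-! ### Words over a finite alphabet -/

namespace Precube

variable {α : Type u}

/-- Words of length at most `n` over `A`. -/
def words (A : Set α) (n : ℕ) : Set (Precube α) :=
  {U | U.word.length ≤ n ∧ ∀ i, U.word.get i ∈ A}

theorem finite_words {A : Set α} (hA : A.Finite) (n : ℕ) : (words A n).Finite := by
  have := hA.to_subtype
  refine ((List.finite_length_le A n).image fun l => ⟨l.map Subtype.val⟩).subset ?_
  rintro ⟨w⟩ ⟨hn, h⟩
  have h' : ∀ a ∈ w, a ∈ A := by
    intro a ha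
    obtain ⟨i, rfl⟩ := List.get_of_mem ha
    exact h i
  refine ⟨w.attach.map fun a => ⟨a.1, h' a.1 a.2⟩, by simpa using hn, ?_⟩
  simp [List.map_map, Function.comp_def]

end Precube

namespace Iposet

variable {α : Type u} {P Q R Z : Iposet α}

/-! ### Operations on sets of iposets -/

/-- The gluing compositions of elements of `A` and `B`. -/
def prod (A B : Set (Iposet α)) : Set (Iposet α) :=
  {P | ∃ a ∈ A, ∃ b ∈ B, ∃ u v, Glued a b P u v}

/-- The interval iposets that are subsumed by an element of `A`. -/
def down (A : Set (Iposet α)) : Set (Iposet α) :=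
  {P | P.IsInterval ∧ ∃ Q ∈ A, Subsumed P Q}

theorem prod_mono {A B A' B' : Set (Iposet α)} (hA : A ⊆ A') (hB : B ⊆ B') :
    prod A B ⊆ prod A' B' := by
  rintro P ⟨a, ha, b, hb, h⟩
  exact ⟨a, hA ha, b, hB hb, h⟩

theorem prod_assoc (A B C : Set (Iposet α)) : prod (prod A B) C = prod A (prod B C) := by
  ext P
  constructor
  · rintro ⟨_, ⟨a, ha, b, hb, _, _, h₁⟩, c, hc, _, _, h⟩
    obtain ⟨Y, _, _, _, hY, hP, -⟩ := h₁.assoc h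
    exact ⟨a, ha, Y, ⟨b, hb, c, hc, _, _, hY⟩, _, _, hP⟩
  · rintro ⟨a, ha, _, ⟨b, hb, c, hc, _, _, h₁⟩, _, _, h⟩
    obtain ⟨Y, _, _, _, hY, hP, -⟩ := h₁.assoc_symm h
    exact ⟨Y, ⟨a, ha, b, hb, _, _, hY⟩, c, hc, _, _, hP⟩

/-! ### Recognizable sets of iposets -/

/-- A family of pairs of sets of prefixes and suffixes that describes all gluing decompositions of
the elements of `L`. -/
structure IsSplitFamily (L : Set (Iposet α)) (F : Set (Set (Iposet α) × Set (Iposet α))) :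
    Prop where
  sound : ∀ f ∈ F, ∀ r ∈ f.1, ∀ z ∈ f.2, ∀ (R : Iposet α) u v, Glued r z R u v → R ∈ L
  complete : ∀ R ∈ L, ∀ (r z : Iposet α) u v, Glued r z R u v → ∃ f ∈ F, r ∈ f.1 ∧ z ∈ f.2

/-- The elements of `L` have labels in `A` and width at most `n`. -/
structure IsBounded (L : Set (Iposet α)) (A : Set α) (n : ℕ) : Prop where
  label : ∀ P ∈ L, ∀ x, P.label x ∈ A
  width : ∀ P ∈ L, ∀ X : Set P.carrier, (∀ x ∈ X, ∀ y ∈ X, ¬ P.prec x y) → X.ncard ≤ n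

/-- `L` has finitely many types of gluing decompositions, finitely many labels and bounded
width. -/
structure IsRecognizable (L : Set (Iposet α)) : Prop where
  split : ∃ F, F.Finite ∧ IsSplitFamily L F
  bounded : ∃ A n, A.Finite ∧ IsBounded L A n

/-- Sets of active events and interfaces are antichains, so only finitely many words arise from them
in a bounded set. -/
theorem IsBounded.mem_words {L : Set (Iposet α)} {A : Set α} {n : ℕ} (h : IsBounded L A n)
    (hP : P ∈ L) {U : Precube α} {e : Fin U.word.length → P.carrier} (he : Function.Injective e)
    (hlab : ∀ i, P.label (e i) = U.word.get i) (hanti : ∀ i j, ¬ P.prec (e i) (e j)) :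
    U ∈ Precube.words A n := by
  refine ⟨?_, fun i => hlab i ▸ h.label P hP _⟩
  have := h.width P hP (Set.range e) (by rintro _ ⟨i, rfl⟩ _ ⟨j, rfl⟩; exact hanti i j)
  rwa [← Set.image_univ, Set.ncard_image_of_injective _ he, Set.ncard_univ, Nat.card_fin] at this

theorem IsBounded.mem_words_tgt {L : Set (Iposet α)} {A : Set α} {n : ℕ} (h : IsBounded L A n)
    (hP : P ∈ L) {u : R.carrier → P.carrier} (hu : IsEmbedding R P u) {U : Precube α}
    (e : LoIso U.lo R.tgtLo) : U ∈ Precube.words A n := by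
  refine h.mem_words (e := fun i => u (e.toEquiv i).1) hP ?_ (fun i => ?_) fun i j k => ?_
  · exact fun i j k => e.toEquiv.injective (Subtype.ext (hu.injective k))
  · rw [hu.label]; exact e.map_label i
  · exact R.tgt_max _ (e.toEquiv i).2 _ (hu.prec _ _ k)

theorem IsBounded.down {L : Set (Iposet α)} {A : Set α} {n : ℕ} (h : IsBounded L A n) :
    IsBounded (down L) A n where
  label := by
    rintro P ⟨-, Q, hQ, f, hf⟩ x
    rw [← hf.label]; exact h.label Q hQ _
  width := by
    rintro P ⟨-, Q, hQ, f, hf⟩ X hX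
    rw [← Set.ncard_image_of_injective X hf.bijective.injective]
    refine h.width Q hQ _ ?_
    rintro _ ⟨x, hx, rfl⟩ _ ⟨y, hy, rfl⟩ k
    exact hX x hx y hy (hf.prec _ _ k)

theorem IsBounded.mono {L L' : Set (Iposet α)} {A A' : Set α} {n n' : ℕ} (h : IsBounded L A n)
    (hL : L' ⊆ L) (hA : A ⊆ A') (hn : n ≤ n') : IsBounded L' A' n' :=
  ⟨fun P hP x => hA (h.label P (hL hP) x), fun P hP X hX => (h.width P (hL hP) X hX).trans hn⟩

/-- An antichain of a gluing lies entirely in one factor, so the width does not grow. This is what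
keeps Kleene plus bounded. -/
theorem IsBounded.prod {L M : Set (Iposet α)} {A : Set α} {n : ℕ} (hL : IsBounded L A n)
    (hM : IsBounded M A n) : IsBounded (prod L M) A n where
  label := by
    rintro P ⟨a, ha, b, hb, u, v, h⟩ x
    rcases h.cover x with ⟨x, rfl⟩ | ⟨x, rfl⟩
    · rw [h.left.label]; exact hL.label a ha x
    · rw [h.right.label]; exact hM.label b hb x
  width := by
    rintro P ⟨a, ha, b, hb, u, v, h⟩ X hX
    by_cases hXa : X ⊆ Set.range u
    · rw [← Set.image_preimage_eq_of_subset hXa, Set.ncard_image_of_injective _ h.left.injective]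
      exact hL.width a ha _ fun x hx y hy k => hX _ hx _ hy (h.left.map_prec _ _ k)
    · obtain ⟨x, hx, hxa⟩ := Set.not_subset.1 hXa
      have hXb : X ⊆ Set.range v := by
        intro y hy
        by_contra hyb
        obtain ⟨x', rfl⟩ := (h.cover x).resolve_left hxa
        obtain ⟨y', rfl⟩ := (h.cover y).resolve_right hyb
        refine hX _ hy _ hx (h.lt y' (fun k => hyb ?_) x' fun k => hxa ?_)
        · obtain ⟨z, -, e⟩ := h.exists_right k; exact ⟨z, e⟩
        · obtain ⟨z, -, e⟩ := h.exists_left k; exact ⟨z, e⟩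
      rw [← Set.image_preimage_eq_of_subset hXb, Set.ncard_image_of_injective _ h.right.injective]
      exact hM.width b hb _ fun x hx y hy k => hX _ hx _ hy (h.right.map_prec _ _ k)

/-! ### Splitting between two sets of events -/

/-- Every element of `A` can be cut, according to a pair in `F`, such that a prescribed set `X` of
events has been started and a prescribed set `Y` of events has not been terminated. -/
def Splits (A : Set (Iposet α)) (F : Set (Set (Iposet α) × Set (Iposet α))) : Prop :=
  ∀ P ∈ A, ∀ X Y : Set P.carrier, P.src ⊆ X → P.tgt ⊆ Y → (∀ y ∈ Y, ∀ x ∈ X, ¬ P.prec y x) →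
    ∃ f ∈ F, ∃ p ∈ f.1, ∃ s ∈ f.2, ∃ u v, Glued p s P u v ∧ X ⊆ Set.range u ∧ Y ⊆ Set.range v

/-- Cut as `exists_isCut` does for `X`. A terminated event precedes some event of `X`, so it cannot
belong to `Y`. -/
theorem IsSplitFamily.splits {L : Set (Iposet α)} {F : Set (Set (Iposet α) × Set (Iposet α))}
    (h : IsSplitFamily L F) (hL : ∀ P ∈ L, P.IsInterval) : Splits L F := by
  intro P hP X Y hX hY hXY
  obtain ⟨C, T, hCT, hXC, hlt⟩ := exists_isCut (hL P hP) X (Or.inl hX)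
  obtain ⟨f, hf, hp, hs⟩ := h.complete P hP _ _ _ _ hCT.glued
  refine ⟨f, hf, _, hp, _, hs, _, _, hCT.glued, by rwa [range_subVal], ?_⟩
  rw [range_subVal]
  intro y hy
  by_cases hyC : y ∈ C
  · refine Or.inl (by_contra fun hyT => ?_)
    obtain ⟨x, hx, k⟩ := hlt y hyC hyT
    exact hXY y hy x hx k
  · exact Or.inr hyC

theorem Splits.mono {A : Set (Iposet α)} {F F' : Set (Set (Iposet α) × Set (Iposet α))}
    (h : Splits A F) (hF : ∀ f ∈ F, ∃ f' ∈ F', f.1 ⊆ f'.1 ∧ f.2 ⊆ f'.2) : Splits A F' := by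
  intro P hP X Y hX hY hXY
  obtain ⟨f, hf, p, hp, s, hs, k⟩ := h P hP X Y hX hY hXY
  obtain ⟨f', hf', h₁, h₂⟩ := hF f hf
  exact ⟨f', hf', p, h₁ hp, s, h₂ hs, k⟩

/-- If all events of `X` occur in the first factor, that factor is split, and its target interface
is kept active so that the second factor can still be attached. Otherwise some event of `X` is
proper to the second factor; every event proper to the first one precedes it, so `Y` lies in the
second factor and that one is split. -/
theorem Splits.prod {A B : Set (Iposet α)} {F G : Set (Set (Iposet α) × Set (Iposet α))}
    (hA : Splits A F) (hB : Splits B G) : Splits (prod A B)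
      ((fun f => (f.1, Iposet.prod f.2 B)) '' F ∪ (fun g => (Iposet.prod A g.1, g.2)) '' G) := by
  rintro P ⟨a, ha, b, hb, u, v, h⟩ X Y hX hY hXY
  by_cases hXa : X ⊆ Set.range u
  · obtain ⟨f, hf, p, hp, s, hs, u₁, u₂, h₁, hX₁, hY₁⟩ := hA a ha (u ⁻¹' X) (u ⁻¹' Y ∪ a.tgt)
      (fun x hx => hX (h.src ▸ Set.mem_image_of_mem u hx)) Set.subset_union_right (by
        rintro y (hy | hy) x hx k
        · exact hXY _ hy _ hx (h.left.map_prec _ _ k)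
        · exact a.tgt_max y hy x k)
    obtain ⟨s', w₁, w₂, w, hs', hP, e₁, e₂⟩ := h₁.assoc h
    refine ⟨_, Or.inl ⟨f, hf, rfl⟩, p, hp, s', ⟨s, hs, b, hb, _, _, hs'⟩, _, _, hP, ?_, ?_⟩
    · intro x hx
      obtain ⟨x, rfl⟩ := hXa hx
      obtain ⟨z, rfl⟩ := hX₁ hx
      exact ⟨z, rfl⟩
    · intro y hy
      rcases h.cover y with ⟨y, rfl⟩ | ⟨y, rfl⟩
      · obtain ⟨z, rfl⟩ := hY₁ (Or.inl hy)
        exact ⟨_, e₁ z⟩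
      · exact ⟨_, e₂ y⟩
  · obtain ⟨x₀, hx₀, hxa⟩ := Set.not_subset.1 hXa
    obtain ⟨g, hg, p, hp, s, hs, v₁, v₂, h₁, hX₁, hY₁⟩ := hB b hb (v ⁻¹' X ∪ b.src) (v ⁻¹' Y)
      Set.subset_union_right (fun x hx => hY (h.tgt ▸ Set.mem_image_of_mem v hx)) (by
        rintro y hy x (hx | hx) k
        · exact hXY _ hy _ hx (h.right.map_prec _ _ k)
        · exact b.src_min x hx y k)
    obtain ⟨p', w₁, w₂, w, hp', hP, e₁, e₂⟩ := h₁.assoc_symm h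
    refine ⟨_, Or.inr ⟨g, hg, rfl⟩, p', ⟨a, ha, p, hp, _, _, hp'⟩, s, hs, _, _, hP, ?_, ?_⟩
    · intro x hx
      rcases h.cover x with ⟨x, rfl⟩ | ⟨x, rfl⟩
      · exact ⟨_, e₁ x⟩
      · obtain ⟨z, rfl⟩ := hX₁ (Or.inl hx)
        exact ⟨_, e₂ z⟩
    · intro y hy
      have hyb : y ∈ Set.range v := by
        by_contra hyb
        obtain ⟨x', rfl⟩ := (h.cover x₀).resolve_left hxa
        obtain ⟨y', rfl⟩ := (h.cover y).resolve_right hyb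
        refine hXY _ hy _ hx₀ (h.lt y' (fun k => hyb ?_) x' fun k => hxa ?_)
        · obtain ⟨z, -, e⟩ := h.exists_right k; exact ⟨z, e⟩
        · obtain ⟨z, -, e⟩ := h.exists_left k; exact ⟨z, e⟩
      obtain ⟨y, rfl⟩ := hyb
      obtain ⟨z, rfl⟩ := hY₁ hy
      exact ⟨z, rfl⟩

/-! ### Cuts and subsumptions -/

theorem IsRefining.rev {f : P.carrier → Q.carrier} (h : IsRefining P Q f) :
    IsRefining P.rev Q.rev f :=
  ⟨h.injective, h.label, fun x y => h.prec y x, fun x y k k₁ k₂ => h.evord x y k k₂ k₁⟩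

/-- The prefix `r` refines the prefix `p` with target interface `U`, after the events in `F` have
been deleted from `p` and those in `D` have been terminated. -/
def PrefixBelow (U : Precube α) (D F : Set (Fin U.word.length)) (r p : Iposet α) : Prop :=
  ∃ (e : LoIso U.lo p.tgtLo) (φ : r.carrier → p.carrier), IsRefining r p φ ∧
    Set.range φ = ((fun i => (e.toEquiv i).1) '' F)ᶜ ∧ φ '' r.src = p.src ∧
    φ '' r.tgt = (fun i => (e.toEquiv i).1) '' (D ∪ F)ᶜ

/-- The suffix `z` refines the suffix `s` with source interface `U`, after the events in `D` have
been deleted from `s` and those in `F` have been removed from the source interface. -/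
def SuffixBelow (U : Precube α) (D F : Set (Fin U.word.length)) (z s : Iposet α) : Prop :=
  ∃ (e : LoIso U.lo s.srcLo) (ψ : z.carrier → s.carrier), IsRefining z s ψ ∧
    Set.range ψ = ((fun i => (e.toEquiv i).1) '' D)ᶜ ∧ ψ '' z.tgt = s.tgt ∧
    ψ '' z.src = (fun i => (e.toEquiv i).1) '' (D ∪ F)ᶜ

theorem PrefixBelow.rev {U : Precube α} {D F : Set (Fin U.word.length)} {z s : Iposet α}
    (h : PrefixBelow U F D z.rev s.rev) : SuffixBelow U D F z s := by
  obtain ⟨e, ψ, h₁, h₂, h₃, h₄⟩ := h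
  rw [Set.union_comm] at h₄
  exact ⟨e, ψ, h₁.rev, h₂, h₃, h₄⟩

/-- The isomorphisms with `U` make `p` and `s` composable, and the two refining maps combine by the
universal property. Disjointness of `D` and `F` gives surjectivity: an active event missing from `r`
occurs in `z`, and conversely. -/
theorem exists_glued_of_below {U : Precube α} {D F : Set (Fin U.word.length)} {r p z s : Iposet α}
    {u : r.carrier → R.carrier} {v : z.carrier → R.carrier} (h : Glued r z R u v)
    (hDF : Disjoint D F) (hr : PrefixBelow U D F r p) (hz : SuffixBelow U D F z s) :
    ∃ P u' v', Glued p s P u' v' ∧ Subsumed R P := by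
  obtain ⟨e, φ, hφ, hφr, hφs, hφt⟩ := hr
  obtain ⟨e', ψ, hψ, hψr, hψt, hψs⟩ := hz
  rw [Set.disjoint_left] at hDF
  obtain ⟨P, u', v', h', huv⟩ := exists_glued (P := p) (Q := s) e e'
  have mem : ∀ x i, φ x = (e.toEquiv i).1 → i ∉ F := by
    intro x i k hi
    have : φ x ∈ Set.range φ := ⟨x, rfl⟩
    rw [hφr] at this
    exact this ⟨i, hi, k.symm⟩
  have mem' : ∀ y i, ψ y = (e'.toEquiv i).1 → i ∉ D := by
    intro x i k hi
    have : ψ x ∈ Set.range ψ := ⟨x, rfl⟩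
    rw [hψr] at this
    exact this ⟨i, hi, k.symm⟩
  refine ⟨P, u', v', h', h.subsumed_of_maps (h'.left.toIsRefining.comp hφ)
    (h'.right.toIsRefining.comp hψ) (by
      rw [Set.image_comp, Set.image_comp, hφt, hψs, Set.image_image, Set.image_image]
      exact Set.image_congr fun i _ => huv i) (by
      intro x y k
      have hx := h'.meet _ _ k
      obtain ⟨i, hi⟩ := e.toEquiv.surjective ⟨φ x, hx⟩
      have hi : (e.toEquiv i).1 = φ x := congrArg Subtype.val hi
      have hi' : ψ y = (e'.toEquiv i).1 := h'.right.injective (by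
        rw [← huv i, hi]; exact k.symm)
      have : φ x ∈ φ '' r.tgt := by
        rw [hφt]
        exact ⟨i, by rintro (k | k); exacts [mem' y i hi' k, mem x i hi.symm k], hi⟩
      rwa [hφ.injective.mem_set_image] at this) (fun x _ y _ => h'.not_prec _ _) ?_
    (by rw [Set.image_comp, hφs, h'.src]) (by rw [Set.image_comp, hψt, h'.tgt])⟩
  have left : ∀ x, x ∉ (fun i => (e.toEquiv i).1) '' F → u' x ∈ Set.range (u' ∘ φ) := by
    intro x hx
    obtain ⟨y, rfl⟩ : x ∈ Set.range φ := by rw [hφr]; exact hx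
    exact ⟨y, rfl⟩
  have right : ∀ x, x ∉ (fun i => (e'.toEquiv i).1) '' D → v' x ∈ Set.range (v' ∘ ψ) := by
    intro x hx
    obtain ⟨y, rfl⟩ : x ∈ Set.range ψ := by rw [hψr]; exact hx
    exact ⟨y, rfl⟩
  intro x
  rcases h'.cover x with ⟨x, rfl⟩ | ⟨x, rfl⟩
  · by_cases hx : x ∈ (fun i => (e.toEquiv i).1) '' F
    · obtain ⟨i, hi, rfl⟩ := hx
      simp only
      rw [huv]
      refine Or.inr (right _ ?_)
      rintro ⟨j, hj, k⟩
      rw [e'.toEquiv.injective (Subtype.ext k)] at hj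
      exact hDF hj hi
    · exact Or.inl (left x hx)
  · by_cases hx : x ∈ (fun i => (e'.toEquiv i).1) '' D
    · obtain ⟨i, hi, rfl⟩ := hx
      simp only
      rw [← huv]
      refine Or.inl (left _ ?_)
      rintro ⟨j, hj, k⟩
      rw [e.toEquiv.injective (Subtype.ext k)] at hj
      exact hDF hi hj
    · exact Or.inr (right x hx)

/-- An event of `p` not reached from `r` is reached from `z`, hence also lies in `s` and is active.
So the difference between `r` and `p` is visible on the interface. The sets `D` and `F` are
characterised by equivalences so that the lemma also applies to reversals, where they trade places.
-/
theorem prefixBelow_of_glued {U : Precube α} {r p z s : Iposet α} {u : r.carrier → R.carrier}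
    {v : z.carrier → R.carrier} (h : Glued r z R u v) {u' : p.carrier → P.carrier}
    {v' : s.carrier → P.carrier} (h' : Glued p s P u' v') {f : R.carrier → P.carrier}
    (hf : IsSubsumption R P f) (hu : ∀ x, f (u x) ∈ Set.range u')
    (hv : ∀ y, f (v y) ∈ Set.range v') (e : LoIso U.lo p.tgtLo) {D F : Set (Fin U.word.length)}
    (hD : ∀ i, i ∈ D ↔ u' (e.toEquiv i).1 ∉ Set.range (f ∘ v))
    (hF : ∀ i, i ∈ F ↔ u' (e.toEquiv i).1 ∉ Set.range (f ∘ u)) : PrefixBelow U D F r p := by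
  choose φ hφ using hu
  have hφ' : IsRefining r p φ := (hf.isRefining.comp h.left.toIsRefining).of_comp h'.left hφ
  have hrange : ∀ x, x ∈ Set.range φ ↔ u' x ∈ Set.range (f ∘ u) := by
    intro x
    constructor
    · rintro ⟨y, rfl⟩; exact ⟨y, (hφ y).symm⟩
    · rintro ⟨y, hy⟩; exact ⟨y, h'.left.injective ((hφ y).trans hy)⟩
  have hcover : ∀ x, u' x ∈ Set.range (f ∘ u) ∨ u' x ∈ Set.range (f ∘ v) := by
    intro x
    obtain ⟨y, hy⟩ := hf.bijective.surjective (u' x)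
    rcases h.cover y with ⟨y, rfl⟩ | ⟨y, rfl⟩
    · exact Or.inl ⟨y, hy⟩
    · exact Or.inr ⟨y, hy⟩
  have htgt : ∀ x, u' x ∈ Set.range (f ∘ v) → ∃ i, (e.toEquiv i).1 = x := by
    rintro x ⟨y, hy⟩
    obtain ⟨y', hy'⟩ := hv y
    have hx : x ∈ p.tgt := h'.meet x y' (hy.symm.trans hy'.symm)
    obtain ⟨i, hi⟩ := e.toEquiv.surjective ⟨x, hx⟩
    exact ⟨i, congrArg Subtype.val hi⟩
  refine ⟨e, φ, hφ', ?_, ?_, ?_⟩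
  · ext x
    rw [hrange]
    constructor
    · rintro hx ⟨i, hi, rfl⟩
      exact (hF i).1 hi hx
    · intro hx
      by_contra k
      obtain ⟨i, rfl⟩ := htgt x ((hcover x).resolve_left k)
      exact hx ⟨i, (hF i).2 k, rfl⟩
  · apply Set.image_injective.2 h'.left.injective
    rw [h'.src, ← hf.src, ← h.src, Set.image_image, Set.image_image]
    simp [hφ]
  · ext x
    constructor
    · rintro ⟨y, hy, rfl⟩
      obtain ⟨z', -, hz'⟩ := h.exists_right hy
      have h₁ : u' (φ y) ∈ Set.range (f ∘ v) := ⟨z', by rw [hφ, ← hz']; rfl⟩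
      obtain ⟨i, hi⟩ := htgt _ h₁
      refine ⟨i, ?_, hi⟩
      rintro (k | k)
      · exact (hD i).1 k (by rw [hi]; exact h₁)
      · exact (hF i).1 k (by rw [hi]; exact ⟨y, (hφ y).symm⟩)
    · rintro ⟨i, hi, rfl⟩
      rw [Set.mem_compl_iff, Set.mem_union, hD, hF, not_or, not_not, not_not] at hi
      obtain ⟨y, hy⟩ := (hrange _).2 hi.2
      refine ⟨y, ?_, hy⟩
      obtain ⟨z', hz'⟩ := hi.1
      refine h.meet y z' (hf.bijective.injective ?_)
      rw [← hφ, hy]; exact hz'.symm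

/-- `D` collects the active events that do not occur in `z`, and `F` those that do not occur in `r`.
The statement on suffixes is the one on prefixes for the reversed iposets, with the enumeration
carried over to the source interface of `s`. -/
theorem exists_below_of_glued {r p z s : Iposet α} {u : r.carrier → R.carrier}
    {v : z.carrier → R.carrier} (h : Glued r z R u v) {u' : p.carrier → P.carrier}
    {v' : s.carrier → P.carrier} (h' : Glued p s P u' v') {f : R.carrier → P.carrier}
    (hf : IsSubsumption R P f) (hu : ∀ x, f (u x) ∈ Set.range u')
    (hv : ∀ y, f (v y) ∈ Set.range v') {U : Precube α} (e : LoIso U.lo p.tgtLo) :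
    ∃ D F, Disjoint D F ∧ PrefixBelow U D F r p ∧ SuffixBelow U D F z s := by
  obtain ⟨g, hg⟩ := h'.exists_loIso
  have hf' : IsSubsumption R.rev P.rev f :=
    hf.isRefining.rev.isSubsumption hf.bijective.surjective hf.tgt hf.src
  refine ⟨{i | u' (e.toEquiv i).1 ∉ Set.range (f ∘ v)},
    {i | u' (e.toEquiv i).1 ∉ Set.range (f ∘ u)},
    ?_, prefixBelow_of_glued h h' hf hu hv e (fun _ => Iff.rfl) (fun _ => Iff.rfl),
    (prefixBelow_of_glued h.rev h'.rev hf' hv hu (e.trans g) (fun i => ?_) fun i => ?_).rev⟩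
  · rw [Set.disjoint_left]
    intro i hi hi'
    obtain ⟨y, hy⟩ := hf.bijective.surjective (u' (e.toEquiv i).1)
    rcases h.cover y with ⟨y, rfl⟩ | ⟨y, rfl⟩
    · exact hi' ⟨y, hy⟩
    · exact hi ⟨y, hy⟩
  · exact (congrArg (· ∉ Set.range (f ∘ u)) (hg (e.toEquiv i)).symm).to_iff
  · exact (congrArg (· ∉ Set.range (f ∘ v)) (hg (e.toEquiv i)).symm).to_iff

/-- If the gluing decompositions of elements of `A` are described by a finite family, then the
down-closure of `A` is recognizable. -/
theorem isRecognizable_down {A : Set (Iposet α)} {F : Set (Set (Iposet α) × Set (Iposet α))}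
    (hF : F.Finite) (hs : Splits A F)
    (sound : ∀ f ∈ F, ∀ r ∈ f.1, ∀ z ∈ f.2, ∀ (R : Iposet α) u v, Glued r z R u v → R ∈ A)
    {B : Set α} {n : ℕ} (hB : B.Finite) (hA : IsBounded A B n) : IsRecognizable (down A) := by
  refine ⟨?_, B, n, hB, hA.down⟩
  -- Possible words of active events, each with the events already terminated and those not yet
  -- started in the finer decomposition.
  let I : Set (Σ U : Precube α, Set (Fin U.word.length) × Set (Fin U.word.length)) :=
    {c | c.1 ∈ Precube.words B n ∧ Disjoint c.2.1 c.2.2}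
  have hI : I.Finite := by
    refine ((Precube.finite_words hB n).biUnion
      (t := fun U => Set.range (Sigma.mk U)) fun U _ => Set.finite_range _).subset ?_
    rintro ⟨U, c⟩ hc
    exact Set.mem_biUnion hc.1 ⟨c, rfl⟩
  refine ⟨_, hF.image2 (fun f c => ((
    {r | r.IsInterval ∧ ∃ p ∈ f.1, PrefixBelow c.1 c.2.1 c.2.2 r p},
    {z | z.IsInterval ∧ ∃ s ∈ f.2, SuffixBelow c.1 c.2.1 c.2.2 z s}) :
      Set (Iposet α) × Set (Iposet α))) hI, ?_, ?_⟩
  · rintro _ ⟨f, hf, c, hc, rfl⟩ r ⟨hr, p, hp, hrp⟩ z ⟨hz, s, hs, hzs⟩ R u v h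
    obtain ⟨P, _, _, hP, hRP⟩ := exists_glued_of_below h hc.2 hrp hzs
    exact ⟨h.isInterval hr hz, P, sound f hf p hp s hs P _ _ hP, hRP⟩
  · rintro R ⟨hR, P, hP, φ, hφ⟩ r z u v h
    -- The generator `P` is cut after the events of `r` have been started and before those of `z`
    -- are terminated. This is permitted because a subsumption reflects precedence and no event of
    -- `z` precedes one of `r`.
    obtain ⟨f, hf, p, hp, s, hs, u', v', h', hu, hv⟩ := hs P hP (Set.range (φ ∘ u))
      (Set.range (φ ∘ v)) (by
        rw [← hφ.src, ← h.src, Set.image_image]; rintro _ ⟨x, -, rfl⟩; exact ⟨x, rfl⟩) (by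
        rw [← hφ.tgt, ← h.tgt, Set.image_image]; rintro _ ⟨x, -, rfl⟩; exact ⟨x, rfl⟩) (by
        rintro _ ⟨y, rfl⟩ _ ⟨x, rfl⟩ k
        exact h.not_prec x y (hφ.prec _ _ k))
    obtain ⟨U, ⟨e⟩⟩ := p.tgtLo.exists_word
    obtain ⟨D, E, hDE, hr, hz⟩ := exists_below_of_glued h h' hφ (fun x => hu ⟨x, rfl⟩)
      (fun y => hv ⟨y, rfl⟩) e
    refine ⟨_, ⟨f, hf, ⟨U, D, E⟩, ⟨hA.mem_words_tgt hP h'.left e, hDE⟩, rfl⟩,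
      ⟨h.left.isInterval hR, p, hp, hr⟩, h.right.isInterval hR, s, hs, hz⟩

end Iposet

namespace Iposet

variable {α : Type u} {P Q R Z : Iposet α}

/-! ### Closure properties of recognizable sets -/

theorem IsSplitFamily.prod_subset {L : Set (Iposet α)}
    {F : Set (Set (Iposet α) × Set (Iposet α))} (h : IsSplitFamily L F) {f} (hf : f ∈ F) :
    prod f.1 f.2 ⊆ L := by
  rintro P ⟨r, hr, z, hz, u, v, k⟩
  exact h.sound f hf r hr z hz P u v k

theorem isRecognizable_empty : IsRecognizable (∅ : Set (Iposet α)) :=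
  ⟨⟨∅, Set.finite_empty, by simp, by simp⟩, ∅, 0, Set.finite_empty, by simp, by simp⟩

theorem IsRecognizable.union {L M : Set (Iposet α)} (hL : IsRecognizable L)
    (hM : IsRecognizable M) : IsRecognizable (L ∪ M) := by
  obtain ⟨⟨F, hF, hLF⟩, A, n, hA, hLA⟩ := hL
  obtain ⟨⟨G, hG, hMG⟩, B, m, hB, hMB⟩ := hM
  have hLA' := hLA.mono subset_rfl (A' := A ∪ B) Set.subset_union_left (le_max_left n m)
  have hMB' := hMB.mono subset_rfl (A' := A ∪ B) Set.subset_union_right (le_max_right n m)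
  refine ⟨⟨F ∪ G, hF.union hG, ?_, ?_⟩, A ∪ B, max n m, hA.union hB, ?_, ?_⟩
  · rintro f (hf | hf) r hr z hz R u v h
    · exact Or.inl (hLF.sound f hf r hr z hz R u v h)
    · exact Or.inr (hMG.sound f hf r hr z hz R u v h)
  · rintro R (hR | hR) r z u v h
    · obtain ⟨f, hf, k⟩ := hLF.complete R hR r z u v h
      exact ⟨f, Or.inl hf, k⟩
    · obtain ⟨f, hf, k⟩ := hMG.complete R hR r z u v h
      exact ⟨f, Or.inr hf, k⟩
  · rintro P (hP | hP)
    exacts [hLA'.label P hP, hMB'.label P hP]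
  · rintro P (hP | hP)
    exacts [hLA'.width P hP, hMB'.width P hP]

/-- Only the products themselves need to be split, and `Splits.prod` does so. Soundness is
associativity: a prefix from the first family, its suffix and an element of `M` regroup to an
element of `L` glued with one of `M`, and similarly on the other side. -/
theorem IsRecognizable.glue {L M : Set (Iposet α)} (hL : IsRecognizable L)
    (hM : IsRecognizable M) (hLi : ∀ P ∈ L, P.IsInterval) (hMi : ∀ P ∈ M, P.IsInterval) :
    IsRecognizable (down (prod L M)) := by
  obtain ⟨⟨F, hF, hLF⟩, A, n, hA, hLA⟩ := hL
  obtain ⟨⟨G, hG, hMG⟩, B, m, hB, hMB⟩ := hM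
  refine isRecognizable_down ((hF.image _).union (hG.image _))
    ((hLF.splits hLi).prod (hMG.splits hMi)) ?_ (hA.union hB)
    ((hLA.mono subset_rfl Set.subset_union_left (le_max_left n m)).prod
      (hMB.mono subset_rfl Set.subset_union_right (le_max_right n m)))
  rintro _ (⟨f, hf, rfl⟩ | ⟨f, hf, rfl⟩) r hr z hz R u v h
  · have : R ∈ prod f.1 (prod f.2 M) := ⟨r, hr, z, hz, u, v, h⟩
    rw [← prod_assoc] at this
    exact prod_mono (hLF.prod_subset hf) subset_rfl this
  · have : R ∈ prod (prod L f.1) f.2 := ⟨r, hr, z, hz, u, v, h⟩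
    rw [prod_assoc] at this
    exact prod_mono subset_rfl (hMG.prod_subset hf) this

/-- The gluing compositions of `n + 1` elements of `L`. -/
def powProd (L : Set (Iposet α)) : ℕ → Set (Iposet α)
  | 0 => L
  | n + 1 => prod L (powProd L n)

theorem prod_powProd_subset (L : Set (Iposet α)) (m n : ℕ) :
    prod (powProd L m) (powProd L n) ⊆ powProd L (m + n + 1) := by
  induction m with
  | zero => rw [Nat.zero_add]; exact subset_rfl
  | succ m ih =>
    rw [powProd, prod_assoc, Nat.succ_add m n, Nat.succ_add]
    exact prod_mono subset_rfl ih

/-- A product of elements of `L` is split inside one factor; whatever stands to its left or right is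
empty or again a product, that is, an element of `M`. -/
theorem IsRecognizable.plus {L : Set (Iposet α)} (hL : IsRecognizable L)
    (hLi : ∀ P ∈ L, P.IsInterval) : IsRecognizable (down (⋃ n, powProd L n)) := by
  obtain ⟨⟨F, hF, hLF⟩, A, n, hA, hLA⟩ := hL
  set M := ⋃ n, powProd L n with hM
  have hsub : ∀ n, powProd L n ⊆ M := fun n => Set.subset_iUnion _ n
  have hMM : prod M M ⊆ M := by
    rintro P ⟨a, ha, b, hb, h⟩
    obtain ⟨i, hi⟩ := Set.mem_iUnion.1 ha
    obtain ⟨j, hj⟩ := Set.mem_iUnion.1 hb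
    exact hsub _ (prod_powProd_subset L i j ⟨a, hi, b, hj, h⟩)
  have hLM : prod L M ⊆ M := (prod_mono (hsub 0) subset_rfl).trans hMM
  have hb : ∀ k, IsBounded (powProd L k) A n := by
    intro k
    induction k with
    | zero => exact hLA
    | succ k ih => exact hLA.prod ih
  -- The family does not depend on `k`: absorbing the other factors into `M` keeps it finite
  -- although the number of factors is unbounded.
  have hs : ∀ k, Splits (powProd L k)
      ((fun f => (f.1 ∪ prod M f.1, f.2 ∪ prod f.2 M)) '' F) := by
    intro k
    induction k with
    | zero =>
      refine (hLF.splits hLi).mono fun f hf => ⟨_, ⟨f, hf, rfl⟩, ?_, ?_⟩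
      · exact Set.subset_union_left
      · exact Set.subset_union_left
    | succ k ih =>
      refine ((hLF.splits hLi).prod ih).mono ?_
      rintro _ (⟨f, hf, rfl⟩ | ⟨_, ⟨f, hf, rfl⟩, rfl⟩)
      · exact ⟨_, ⟨f, hf, rfl⟩, Set.subset_union_left,
          (prod_mono subset_rfl (hsub k)).trans Set.subset_union_right⟩
      · refine ⟨_, ⟨f, hf, rfl⟩, ?_, subset_rfl⟩
        refine le_trans ?_ Set.subset_union_right
        rintro P ⟨a, ha, b, hb | hb, h⟩
        · exact ⟨a, hsub 0 ha, b, hb, h⟩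
        · have : P ∈ prod L (prod M f.1) := ⟨a, ha, b, hb, h⟩
          rw [← prod_assoc] at this
          exact prod_mono hLM subset_rfl this
  refine isRecognizable_down (hF.image _)
    (F := (fun f => (f.1 ∪ prod M f.1, f.2 ∪ prod f.2 M)) '' F)
    ?_ ?_ hA (n := n) ⟨?_, ?_⟩
  · intro P hP
    obtain ⟨k, hk⟩ := Set.mem_iUnion.1 hP
    exact hs k P hk
  · rintro _ ⟨f, hf, rfl⟩ r hr z hz R u v h
    have hfM : prod f.1 f.2 ⊆ M := (hLF.prod_subset hf).trans (hsub 0)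
    have h₁ : prod f.1 (f.2 ∪ prod f.2 M) ⊆ M := by
      rintro P ⟨a, ha, b, hb | hb, h⟩
      · exact hfM ⟨a, ha, b, hb, h⟩
      · have : P ∈ prod f.1 (prod f.2 M) := ⟨a, ha, b, hb, h⟩
        rw [← prod_assoc] at this
        exact hMM (prod_mono hfM subset_rfl this)
    rcases hr with hr | hr
    · exact h₁ ⟨r, hr, z, hz, u, v, h⟩
    · have : R ∈ prod (prod M f.1) (f.2 ∪ prod f.2 M) := ⟨r, hr, z, hz, u, v, h⟩
      rw [prod_assoc] at this
      exact hMM (prod_mono subset_rfl h₁ this)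
  · intro P hP
    obtain ⟨k, hk⟩ := Set.mem_iUnion.1 hP
    exact (hb k).label P hk
  · intro P hP
    obtain ⟨k, hk⟩ := Set.mem_iUnion.1 hP
    exact (hb k).width P hk

/-- The down-closure of a single isomorphism class is recognizable. -/
theorem isRecognizable_singleton (hR : R.IsInterval) :
    IsRecognizable (down {P | Isomorphic P R}) := by
  have := R.finite
  have hb : IsBounded {R} (Set.range R.label) (Nat.card R.carrier) := by
    refine ⟨?_, ?_⟩
    · rintro _ rfl x; exact ⟨x, rfl⟩
    · rintro _ rfl X -; exact Set.ncard_le_card X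
  -- One pair for each pair of subsets of `R`; if these do not form a cut, the set of prefixes is
  -- empty and soundness is vacuous.
  refine isRecognizable_down (F := Set.range fun c : Set R.carrier × Set R.carrier =>
    ({p | IsCut R c.1 c.2 ∧ p = R.sub c.1 R.src c.2},
      {s | s = R.sub (c.2 ∪ c.1ᶜ) c.2 R.tgt})) (Set.finite_range _) ?_ ?_
    (Set.finite_range R.label) (hb.down.mono ?_ subset_rfl le_rfl)
  · rintro P ⟨f, hf, hf'⟩ X Y hX hY hXY
    obtain ⟨C, T, hCT, hXC, hlt⟩ := exists_isCut hR (f '' X)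
      (Or.inl (by rw [← hf.src]; exact Set.image_mono hX))
    obtain ⟨h, hh, hhf⟩ : ∃ h : R.carrier → P.carrier, Function.RightInverse h f ∧
        Function.LeftInverse h f := by
      obtain ⟨h, h₁, h₂⟩ := Function.bijective_iff_has_inverse.1 hf.bijective
      exact ⟨h, h₂, h₁⟩
    have hemb : IsEmbedding R P h :=
      (IsEmbedding.id R).of_comp ⟨hf.isRefining, hf'⟩ hh
    refine ⟨_, ⟨(C, T), rfl⟩, _, ⟨hCT, rfl⟩, _, rfl, h ∘ subVal, h ∘ subVal,
      ⟨hemb.comp hCT.glued.left, hemb.comp hCT.glued.right, ?_, ?_, ?_, ?_, ?_, ?_⟩, ?_, ?_⟩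
    · rw [Set.image_comp, hCT.glued.src, ← hf.src, Set.image_image]; simp [hhf _]
    · rw [Set.image_comp, hCT.glued.tgt, ← hf.tgt, Set.image_image]; simp [hhf _]
    · rw [Set.image_comp, hCT.glued.mid, Set.image_comp]
    · exact fun x y k => hCT.glued.meet x y (hh.injective k)
    · intro x
      rcases hCT.glued.cover (f x) with ⟨y, hy⟩ | ⟨y, hy⟩
      · exact Or.inl ⟨y, by rw [Function.comp_apply, hy, hhf]⟩
      · exact Or.inr ⟨y, by rw [Function.comp_apply, hy, hhf]⟩
    · exact fun x hx y hy => hemb.map_prec _ _ (hCT.glued.lt x hx y hy)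
    · intro x hx
      exact ⟨subMk _ _ (f x) (hXC ⟨x, hx, rfl⟩), hhf x⟩
    · intro y hy
      have : f y ∈ T ∪ Cᶜ := by
        by_cases hyC : f y ∈ C
        · refine Or.inl (by_contra fun hyT => ?_)
          obtain ⟨_, ⟨x, hx, rfl⟩, k⟩ := hlt _ hyC hyT
          exact hXY y hy x hx (hf.prec _ _ k)
        · exact Or.inr hyC
      exact ⟨subMk _ _ (f y) this, hhf y⟩
  · rintro _ ⟨⟨C, T⟩, rfl⟩ r ⟨hCT, rfl⟩ z rfl P u v h
    exact h.isomorphic hCT.glued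
  · intro P hP
    exact ⟨hR.of_isomorphic hP, R, rfl, hP.subsumed⟩

/-! ### Parallel composition -/

/-- The first structural inclusion of a parallel composition. -/
def parInl (P Q : Iposet α) : P.carrier → (P.par Q).carrier := Sum.inl

/-- The second structural inclusion of a parallel composition. -/
def parInr (P Q : Iposet α) : Q.carrier → (P.par Q).carrier := Sum.inr

/-- The parallel composition of two maps. -/
def parMap {P' Q' : Iposet α} (u : P.carrier → P'.carrier) (v : Q.carrier → Q'.carrier) :
    (P.par Q).carrier → (P'.par Q').carrier :=
  Sum.map u v

theorem par_cases (x : (P.par Q).carrier) : (∃ y, parInl P Q y = x) ∨ ∃ y, parInr P Q y = x := by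
  rcases x with x | x
  exacts [Or.inl ⟨x, rfl⟩, Or.inr ⟨x, rfl⟩]

theorem parMap_image {P' Q' : Iposet α} (u : P.carrier → P'.carrier) (v : Q.carrier → Q'.carrier)
    (A : Set P.carrier) (B : Set Q.carrier) :
    parMap u v '' (parInl P Q '' A ∪ parInr P Q '' B) =
      (parInl P' Q') '' (u '' A) ∪ (parInr P' Q') '' (v '' B) := by
  rw [Set.image_union, Set.image_image, Set.image_image, Set.image_image, Set.image_image]
  rfl

theorem parInl_mem (A : Set P.carrier) (B : Set Q.carrier) (x : P.carrier) :
    parInl P Q x ∈ parInl P Q '' A ∪ parInr P Q '' B ↔ x ∈ A := by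
  constructor
  · rintro (⟨y, hy, e⟩ | ⟨y, -, e⟩)
    · cases e; exact hy
    · cases e
  · exact fun hx => Or.inl ⟨x, hx, rfl⟩

theorem parInr_mem (A : Set P.carrier) (B : Set Q.carrier) (x : Q.carrier) :
    parInr P Q x ∈ parInl P Q '' A ∪ parInr P Q '' B ↔ x ∈ B := by
  constructor
  · rintro (⟨y, -, e⟩ | ⟨y, hy, e⟩)
    · cases e
    · cases e; exact hy
  · exact fun hx => Or.inr ⟨x, hx, rfl⟩

theorem IsEmbedding.par {P' Q' : Iposet α} {u : P.carrier → P'.carrier}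
    {v : Q.carrier → Q'.carrier} (hu : IsEmbedding P P' u) (hv : IsEmbedding Q Q' v) :
    IsEmbedding (P.par Q) (P'.par Q') (parMap u v) := by
  refine ⟨⟨hu.injective.sumMap hv.injective, ?_, ?_, ?_⟩, ?_⟩
  · rintro (x | x)
    exacts [hu.label x, hv.label x]
  · rintro (x | x) (y | y) h
    · cases h with | inl h => exact .inl (hu.prec _ _ h)
    · cases h
    · cases h
    · cases h with | inr h => exact .inr (hv.prec _ _ h)
  · rintro (x | x) (y | y) h h₁ h₂
    · cases h with
      | inl h => exact .inl (hu.evord _ _ h (fun k => h₁ (.inl k)) (fun k => h₂ (.inl k)))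
    · exact .sep _ _
    · cases h
    · cases h with
      | inr h => exact .inr (hv.evord _ _ h (fun k => h₁ (.inr k)) (fun k => h₂ (.inr k)))
  · rintro (x | x) (y | y) h
    · cases h with | inl h => exact .inl (hu.map_prec _ _ h)
    · cases h
    · cases h
    · cases h with | inr h => exact .inr (hv.map_prec _ _ h)

theorem isEmbedding_inl (P Q : Iposet α) : IsEmbedding P (P.par Q) (parInl P Q) where
  injective := Sum.inl_injective
  label _ := rfl
  prec _ _ h := by cases h with | inl h => exact h
  evord _ _ h _ _ := .inl h
  map_prec _ _ h := .inl h

theorem isEmbedding_inr (P Q : Iposet α) : IsEmbedding Q (P.par Q) (parInr P Q) where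
  injective := Sum.inr_injective
  label _ := rfl
  prec _ _ h := by cases h with | inr h => exact h
  evord _ _ h _ _ := .inr h
  map_prec _ _ h := .inr h

/-- Lax interchange of gluing and parallel composition, up to subsumption. -/
theorem Glued.par_subsumed {r z p q s t : Iposet α} {u : r.carrier → R.carrier}
    {v : z.carrier → R.carrier} (h : Glued r z R u v) (hr : Subsumed r (p.par q))
    (hz : Subsumed z (s.par t)) {u₁ : p.carrier → P.carrier} {v₁ : s.carrier → P.carrier}
    (h₁ : Glued p s P u₁ v₁) {u₂ : q.carrier → Q.carrier} {v₂ : t.carrier → Q.carrier}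
    (h₂ : Glued q t Q u₂ v₂) : Subsumed R (P.par Q) := by
  obtain ⟨φ, hφ⟩ := hr
  obtain ⟨ψ, hψ⟩ := hz
  have eu := h₁.left.par h₂.left
  have ev := h₁.right.par h₂.right
  have hback : ∀ x y, ¬ (P.par Q).prec (parMap v₁ v₂ y) (parMap u₁ u₂ x) := by
    rintro (x | x) (y | y) k
    · cases k with | inl k => exact h₁.not_prec _ _ k
    · cases k
    · cases k
    · cases k with | inr k => exact h₂.not_prec _ _ k
  have hmeet : ∀ x y, parMap u₁ u₂ x = parMap v₁ v₂ y → x ∈ (p.par q).tgt := by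
    rintro (x | x) (y | y) k
    · exact Or.inl ⟨x, h₁.meet x y (Sum.inl_injective k), rfl⟩
    · cases k
    · cases k
    · exact Or.inr ⟨x, h₂.meet x y (Sum.inr_injective k), rfl⟩
  have hmid : parMap u₁ u₂ '' (p.par q).tgt = parMap v₁ v₂ '' (s.par t).src := by
    refine (parMap_image _ _ _ _).trans (Eq.trans ?_ (parMap_image _ _ _ _).symm)
    rw [h₁.mid, h₂.mid]
  have hsrc : parMap u₁ u₂ '' (p.par q).src = (P.par Q).src := by
    refine (parMap_image _ _ _ _).trans ?_
    rw [h₁.src, h₂.src]; rfl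
  have htgt : parMap v₁ v₂ '' (s.par t).tgt = (P.par Q).tgt := by
    refine (parMap_image _ _ _ _).trans ?_
    rw [h₁.tgt, h₂.tgt]; rfl
  refine h.subsumed_of_maps (eu.toIsRefining.comp hφ.isRefining)
    (ev.toIsRefining.comp hψ.isRefining)
    (by rw [Set.image_comp, Set.image_comp, hφ.tgt, hψ.src, hmid]) (by
      intro x y k
      have := hmeet _ _ k
      rw [← hφ.tgt] at this
      rwa [hφ.bijective.injective.mem_set_image] at this) (fun x _ y _ => hback _ _) (fun x => ?_)
    (by rw [Set.image_comp, hφ.src, hsrc]) (by rw [Set.image_comp, hψ.tgt, htgt])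
  rw [hφ.bijective.surjective.range_comp, hψ.bijective.surjective.range_comp]
  rcases par_cases x with ⟨x, rfl⟩ | ⟨x, rfl⟩
  · rcases h₁.cover x with ⟨y, rfl⟩ | ⟨y, rfl⟩
    exacts [Or.inl ⟨parInl _ _ y, rfl⟩, Or.inr ⟨parInl _ _ y, rfl⟩]
  · rcases h₂.cover x with ⟨y, rfl⟩ | ⟨y, rfl⟩
    exacts [Or.inl ⟨parInr _ _ y, rfl⟩, Or.inr ⟨parInr _ _ y, rfl⟩]

/-- Gluing compositions can be restricted to a set of events. -/
theorem Glued.restrict {u : R.carrier → P.carrier} {v : Z.carrier → P.carrier}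
    (h : Glued R Z P u v) (C : Set P.carrier) :
    Glued (R.sub (u ⁻¹' C) R.src R.tgt) (Z.sub (v ⁻¹' C) Z.src Z.tgt) (P.sub C P.src P.tgt)
      (fun x => subMk _ _ (u (subVal x)) (subVal_mem x))
      (fun y => subMk _ _ (v (subVal y)) (subVal_mem y)) := by
  have mem_src : ∀ {Q : Iposet α} {C : Set Q.carrier} (x : (Q.sub C Q.src Q.tgt).carrier),
      x ∈ (Q.sub C Q.src Q.tgt).src ↔ subVal x ∈ Q.src :=
    fun x => ⟨fun k => k.1, fun k => ⟨k, fun y _ => Iposet.src_min _ _ k y⟩⟩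
  have mem_tgt : ∀ {Q : Iposet α} {C : Set Q.carrier} (x : (Q.sub C Q.src Q.tgt).carrier),
      x ∈ (Q.sub C Q.src Q.tgt).tgt ↔ subVal x ∈ Q.tgt :=
    fun x => ⟨fun k => k.1, fun k => ⟨k, fun y _ => Iposet.tgt_max _ _ k y⟩⟩
  have emb := P.sub_isEmbedding C P.src P.tgt
  refine ⟨(h.left.comp (R.sub_isEmbedding _ _ _)).of_comp emb fun _ => rfl,
    (h.right.comp (Z.sub_isEmbedding _ _ _)).of_comp emb fun _ => rfl, ?_, ?_, ?_, ?_, ?_, ?_⟩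
  · ext x
    constructor
    · rintro ⟨y, hy, rfl⟩
      rw [mem_src] at hy ⊢
      exact h.src ▸ Set.mem_image_of_mem u hy
    · intro hx
      rw [mem_src, ← h.src] at hx
      obtain ⟨y, hy, e⟩ := hx
      exact ⟨subMk _ _ y (by rw [Set.mem_preimage, e]; exact subVal_mem x), (mem_src _).2 hy,
        emb.injective e⟩
  · ext x
    constructor
    · rintro ⟨y, hy, rfl⟩
      rw [mem_tgt] at hy ⊢
      exact h.tgt ▸ Set.mem_image_of_mem v hy
    · intro hx
      rw [mem_tgt, ← h.tgt] at hx
      obtain ⟨y, hy, e⟩ := hx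
      exact ⟨subMk _ _ y (by rw [Set.mem_preimage, e]; exact subVal_mem x), (mem_tgt _).2 hy,
        emb.injective e⟩
  · ext x
    constructor
    · rintro ⟨y, hy, rfl⟩
      rw [mem_tgt] at hy
      obtain ⟨z, hz, e⟩ := h.exists_right hy
      exact ⟨subMk _ _ z (by rw [Set.mem_preimage, e]; exact subVal_mem y), (mem_src _).2 hz,
        emb.injective e⟩
    · rintro ⟨y, hy, rfl⟩
      rw [mem_src] at hy
      obtain ⟨z, hz, e⟩ := h.exists_left hy
      exact ⟨subMk _ _ z (by rw [Set.mem_preimage, e]; exact subVal_mem y), (mem_tgt _).2 hz,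
        emb.injective e⟩
  · exact fun x y k => (mem_tgt x).2 (h.meet _ _ (congrArg subVal k))
  · intro x
    rcases h.cover (subVal x) with ⟨y, e⟩ | ⟨y, e⟩
    · exact Or.inl ⟨subMk _ _ y (by rw [Set.mem_preimage, e]; exact subVal_mem x),
        emb.injective e⟩
    · exact Or.inr ⟨subMk _ _ y (by rw [Set.mem_preimage, e]; exact subVal_mem x),
        emb.injective e⟩
  · intro x hx y hy
    rw [mem_tgt] at hx
    rw [mem_src] at hy
    exact h.lt _ hx _ hy

open Classical in
/-- An iposet is subsumed by the parallel composition of its restrictions to complementary sets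
of events, provided that the event order is compatible. -/
theorem subsumed_par (P : Iposet α) {C D : Set P.carrier} (hCD : ∀ x, x ∈ D ↔ x ∉ C)
    (h : ∀ x ∉ C, ∀ y ∈ C, P.evord x y → P.prec x y ∨ P.prec y x) :
    Subsumed P ((P.sub C P.src P.tgt).par (P.sub D P.src P.tgt)) := by
  let f : P.carrier → ((P.sub C P.src P.tgt).par (P.sub D P.src P.tgt)).carrier := fun x =>
    if hx : x ∈ C then Sum.inl (subMk _ _ x hx) else Sum.inr (subMk _ _ x ((hCD x).2 hx))
  have hl : ∀ x (hx : x ∈ C), f x = Sum.inl (subMk _ _ x hx) := fun x hx => dif_pos hx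
  have hr : ∀ x (hx : x ∈ D), f x = Sum.inr (subMk _ _ x hx) := fun x hx =>
    dif_neg ((hCD x).1 hx)
  have hC : ∀ x, x ∈ C ∨ x ∈ D := fun x => (Classical.em (x ∈ C)).imp_right (hCD x).2
  have himage : ∀ S : Set P.carrier, ∀ x, (x ∈ f '' S ↔ Sum.elim subVal subVal x ∈ S) := by
    intro S x
    constructor
    · rintro ⟨y, hy, rfl⟩
      rcases hC y with k | k
      · rw [hl y k]; exact hy
      · rw [hr y k]; exact hy
    · intro hx
      rcases x with x | x
      · exact ⟨subVal x, hx, hl _ (subVal_mem x)⟩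
      · exact ⟨subVal x, hx, hr _ (subVal_mem x)⟩
  refine ⟨f, ⟨⟨fun x y k => ?_, fun x => ?_⟩, fun x => ?_, ?_, ?_, fun x y k => ?_,
    fun x y k k₁ k₂ => ?_⟩⟩
  · rcases hC x with hx | hx <;> rcases hC y with hy | hy
    · rw [hl x hx, hl y hy] at k; exact congrArg subVal (Sum.inl_injective k)
    · rw [hl x hx, hr y hy] at k; cases k
    · rw [hr x hx, hl y hy] at k; cases k
    · rw [hr x hx, hr y hy] at k; exact congrArg subVal (Sum.inr_injective k)
  · have := (himage Set.univ x).2 trivial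
    obtain ⟨y, -, hy⟩ := this
    exact ⟨y, hy⟩
  · rcases hC x with hx | hx
    · rw [hl x hx]; rfl
    · rw [hr x hx]; rfl
  · ext x
    rw [himage]
    rcases x with x | x
    · constructor
      · exact fun hx => Or.inl ⟨x, ⟨hx, fun y _ => P.src_min _ hx y⟩, rfl⟩
      · rintro (⟨y, hy, e⟩ | ⟨y, hy, e⟩)
        · cases e; exact hy.1
        · cases e
    · constructor
      · exact fun hx => Or.inr ⟨x, ⟨hx, fun y _ => P.src_min _ hx y⟩, rfl⟩
      · rintro (⟨y, hy, e⟩ | ⟨y, hy, e⟩)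
        · cases e
        · cases e; exact hy.1
  · ext x
    rw [himage]
    rcases x with x | x
    · constructor
      · exact fun hx => Or.inl ⟨x, ⟨hx, fun y _ => P.tgt_max _ hx y⟩, rfl⟩
      · rintro (⟨y, hy, e⟩ | ⟨y, hy, e⟩)
        · cases e; exact hy.1
        · cases e
    · constructor
      · exact fun hx => Or.inr ⟨x, ⟨hx, fun y _ => P.tgt_max _ hx y⟩, rfl⟩
      · rintro (⟨y, hy, e⟩ | ⟨y, hy, e⟩)
        · cases e
        · cases e; exact hy.1
  · rcases hC x with hx | hx <;> rcases hC y with hy | hy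
    · rw [hl x hx, hl y hy] at k; cases k with | inl k => exact k
    · rw [hl x hx, hr y hy] at k; cases k
    · rw [hr x hx, hl y hy] at k; cases k
    · rw [hr x hx, hr y hy] at k; cases k with | inr k => exact k
  · rcases hC x with hx | hx <;> rcases hC y with hy | hy
    · rw [hl x hx, hl y hy]; exact .inl k
    · rw [hl x hx, hr y hy]; exact .sep _ _
    · rcases h x ((hCD x).1 hx) y hy k with k | k
      exacts [absurd k k₁, absurd k k₂]
    · rw [hr x hx, hr y hy]; exact .inr k

/-- The parallel compositions of elements of `L` and `M`. -/
def parProd (L M : Set (Iposet α)) : Set (Iposet α) :=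
  {P | ∃ a ∈ L, ∃ b ∈ M, P = a.par b}

theorem IsBounded.par {L M : Set (Iposet α)} {A B : Set α} {n m : ℕ} (hL : IsBounded L A n)
    (hM : IsBounded M B m) : IsBounded (parProd L M) (A ∪ B) (n + m) where
  label := by
    rintro _ ⟨a, ha, b, hb, rfl⟩ (x | x)
    · exact Or.inl (hL.label a ha x)
    · exact Or.inr (hM.label b hb x)
  width := by
    rintro _ ⟨a, ha, b, hb, rfl⟩ X hX
    have e : X = parInl a b '' (parInl a b ⁻¹' X) ∪ parInr a b '' (parInr a b ⁻¹' X) :=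
      (Set.image_preimage_inl_union_image_preimage_inr X).symm
    rw [e]
    refine (Set.ncard_union_le _ _).trans (add_le_add ?_ ?_)
    · rw [Set.ncard_image_of_injective _ (isEmbedding_inl a b).injective]
      exact hL.width a ha _ fun x hx y hy k => hX _ hx _ hy (.inl k)
    · rw [Set.ncard_image_of_injective _ (isEmbedding_inr a b).injective]
      exact hM.width b hb _ fun x hx y hy k => hX _ hx _ hy (.inr k)

/-- If `R` is subsumed by `P`, then the part of `R` that lies over an embedded `Q` is subsumed by
`Q`. -/
theorem IsSubsumption.restrict {f : R.carrier → P.carrier} (hf : IsSubsumption R P f)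
    {g : Q.carrier → P.carrier} (hg : IsEmbedding Q P g) (hs : ∀ x, g x ∈ P.src ↔ x ∈ Q.src)
    (ht : ∀ x, g x ∈ P.tgt ↔ x ∈ Q.tgt) :
    Subsumed (R.sub (f ⁻¹' Set.range g) R.src R.tgt) Q := by
  choose h hh using fun x : (R.sub (f ⁻¹' Set.range g) R.src R.tgt).carrier =>
    (subVal_mem x : subVal x ∈ f ⁻¹' Set.range g)
  have key : ∀ (x : R.carrier) (y : Q.carrier) (e : f x = g y),
      h (subMk _ _ x ⟨y, e.symm⟩) = y := fun x y e => hg.injective ((hh _).trans e)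
  refine ⟨h, ((hf.isRefining.comp (R.sub_isEmbedding _ _ _).toIsRefining).of_comp hg
    hh).isSubsumption (fun y => ?_) ?_ ?_⟩
  · obtain ⟨x, hx⟩ := hf.bijective.surjective (g y)
    exact ⟨_, key x y hx⟩
  · ext y
    constructor
    · rintro ⟨x, hx, rfl⟩
      rw [← hs, hh, ← hf.src]
      exact Set.mem_image_of_mem f hx.1
    · intro hy
      rw [← hs, ← hf.src] at hy
      obtain ⟨x, hx, e⟩ := hy
      exact ⟨subMk _ _ x ⟨y, e.symm⟩, ⟨hx, fun z _ => R.src_min x hx z⟩, key x y e⟩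
  · ext y
    constructor
    · rintro ⟨x, hx, rfl⟩
      rw [← ht, hh, ← hf.tgt]
      exact Set.mem_image_of_mem f hx.1
    · intro hy
      rw [← ht, ← hf.tgt] at hy
      obtain ⟨x, hx, e⟩ := hy
      exact ⟨subMk _ _ x ⟨y, e.symm⟩, ⟨hx, fun z _ => R.tgt_max x hx z⟩, key x y e⟩

/-- Below a parallel composition, the events over each component form an iposet in the corresponding
down-closed language, and a gluing decomposition restricts to each of them. Conversely, prefixes and
suffixes that match in both components are recombined by lax interchange. -/
theorem IsRecognizable.par {L M : Set (Iposet α)} (hL : IsRecognizable L)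
    (hM : IsRecognizable M) (hLd : down L ⊆ L) (hMd : down M ⊆ M) :
    IsRecognizable (down (parProd L M)) := by
  obtain ⟨⟨F, hF, hLF⟩, A, n, hA, hLA⟩ := hL
  obtain ⟨⟨G, hG, hMG⟩, B, m, hB, hMB⟩ := hM
  refine ⟨?_, A ∪ B, n + m, hA.union hB, (hLA.par hMB).down⟩
  -- The two words record the interface of each component separately. Composability of `r` and `z`
  -- alone would not make `p` composable with `s` and `q` with `t`.
  refine ⟨_, (hF.prod hG).image2 (fun f c => (({r | r.IsInterval ∧ ∃ p ∈ f.1.1, ∃ q ∈ f.2.1,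
      Nonempty (LoIso c.1.lo p.tgtLo) ∧ Nonempty (LoIso c.2.lo q.tgtLo) ∧ Subsumed r (p.par q)},
    {z | z.IsInterval ∧ ∃ s ∈ f.1.2, ∃ t ∈ f.2.2,
      Nonempty (LoIso c.1.lo s.srcLo) ∧ Nonempty (LoIso c.2.lo t.srcLo) ∧
        Subsumed z (s.par t)}) : Set (Iposet α) × Set (Iposet α)))
    ((Precube.finite_words hA n).prod (Precube.finite_words hB m)), ?_, ?_⟩
  · rintro _ ⟨f, hf, c, -, rfl⟩ r ⟨hr, p, hp, q, hq, ⟨e₁⟩, ⟨e₂⟩, hrpq⟩ z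
      ⟨hz, s, hs, t, ht, ⟨e₃⟩, ⟨e₄⟩, hzst⟩ R u v h
    obtain ⟨P, _, _, h₁, -⟩ := exists_glued e₁ e₃
    obtain ⟨Q, _, _, h₂, -⟩ := exists_glued e₂ e₄
    exact ⟨h.isInterval hr hz, _, ⟨P, hLF.sound f.1 hf.1 p hp s hs P _ _ h₁, Q,
      hMG.sound f.2 hf.2 q hq t ht Q _ _ h₂, rfl⟩, h.par_subsumed hrpq hzst h₁ h₂⟩
  · rintro R ⟨hR, _, ⟨P, hP, Q, hQ, rfl⟩, φ, hφ⟩ r z u v h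
    set C : Set R.carrier := φ ⁻¹' Set.range (parInl P Q) with hC
    set D : Set R.carrier := φ ⁻¹' Set.range (parInr P Q) with hD
    have hCD : ∀ x, x ∈ D ↔ x ∉ C := by
      intro x
      rw [hC, hD, Set.mem_preimage, Set.mem_preimage]
      rcases par_cases (φ x) with ⟨y, e⟩ | ⟨y, e⟩
      · refine ⟨?_, fun k => absurd ⟨y, e⟩ k⟩
        rintro ⟨z, e'⟩
        cases e.trans e'.symm
      · refine ⟨?_, fun _ => ⟨y, e⟩⟩
        rintro - ⟨z, e'⟩
        cases e.trans e'.symm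
    have hL' : R.sub C R.src R.tgt ∈ L := hLd ⟨(R.sub_isEmbedding _ _ _).isInterval hR, P, hP,
      hφ.restrict (isEmbedding_inl P Q) (parInl_mem _ _) (parInl_mem _ _)⟩
    have hM' : R.sub D R.src R.tgt ∈ M := hMd ⟨(R.sub_isEmbedding _ _ _).isInterval hR, Q, hQ,
      hφ.restrict (isEmbedding_inr P Q) (parInr_mem _ _) (parInr_mem _ _)⟩
    -- In the parallel composition, events of `P` come before those of `Q` in the event order. So
    -- incomparable events of `R` over different components are never in the wrong order, and any
    -- part of `R` is subsumed by the parallel composition of its two restrictions.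
    have hev : ∀ {S : Iposet α} {w : S.carrier → R.carrier}, IsEmbedding S R w →
        Subsumed S ((S.sub (w ⁻¹' C) S.src S.tgt).par (S.sub (w ⁻¹' D) S.src S.tgt)) := by
      intro S w hw
      refine S.subsumed_par (fun x => hCD (w x)) fun x hx y hy k => ?_
      by_contra! hk
      have hxD : w x ∈ D := (hCD _).2 hx
      obtain ⟨a, ha⟩ := hxD
      obtain ⟨b, hb⟩ : φ (w y) ∈ Set.range (parInl P Q) := hy
      have := hφ.evord _ _ (hw.evord _ _ k hk.1 hk.2) (fun k => hk.1 (hw.prec _ _ k))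
        (fun k => hk.2 (hw.prec _ _ k))
      rw [← ha, ← hb] at this
      cases this
    have h₁ := h.restrict C
    have h₂ := h.restrict D
    obtain ⟨f, hf, hf₁, hf₂⟩ := hLF.complete _ hL' _ _ _ _ h₁
    obtain ⟨g, hg, hg₁, hg₂⟩ := hMG.complete _ hM' _ _ _ _ h₂
    obtain ⟨U, ⟨e₁⟩⟩ := (r.sub (u ⁻¹' C) r.src r.tgt).tgtLo.exists_word
    obtain ⟨V, ⟨e₂⟩⟩ := (r.sub (u ⁻¹' D) r.src r.tgt).tgtLo.exists_word
    obtain ⟨i₁, -⟩ := h₁.exists_loIso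
    obtain ⟨i₂, -⟩ := h₂.exists_loIso
    exact ⟨_, ⟨(f, g), ⟨hf, hg⟩, (U, V),
      ⟨hLA.mem_words_tgt hL' h₁.left e₁, hMB.mem_words_tgt hM' h₂.left e₂⟩, rfl⟩,
      ⟨h.left.isInterval hR, _, hf₁, _, hg₁, ⟨e₁⟩, ⟨e₂⟩, hev h.left⟩,
      h.right.isInterval hR, _, hf₂, _, hg₂, ⟨e₁.trans i₁⟩, ⟨e₂.trans i₂⟩, hev h.right⟩

end Iposet

/-! ### Postponing down-closures in iterated products -/

namespace Iposet

variable {α : Type u} {P Q R Z : Iposet α}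

theorem IsSubsumption.exists_srcIso {f : P.carrier → Q.carrier} (hf : IsSubsumption P Q f) :
    Nonempty (LoIso P.srcLo Q.srcLo) := by
  have mem : ∀ x : P.src, f x.1 ∈ Q.src := fun x => hf.src ▸ Set.mem_image_of_mem f x.2
  refine ⟨LoIso.ofBijective (U := P.srcLo) (V := Q.srcLo) (fun x => ⟨f x.1, mem x⟩)
    ⟨fun x y e => ?_, fun y => ?_⟩ (fun x y k => ?_) fun x => hf.label x.1⟩
  · exact Subtype.ext (hf.bijective.injective (congrArg Subtype.val e))
  · obtain ⟨x, hx, e⟩ : y.1 ∈ f '' P.src := by rw [hf.src]; exact y.2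
    exact ⟨⟨x, hx⟩, Subtype.ext e⟩
  · exact hf.evord _ _ k (P.src_min _ y.2 _) (P.src_min _ x.2 _)

/-- The down-closure of a gluing composition absorbs a down-closure of the second factor. -/
theorem down_prod_down {L M : Set (Iposet α)} (hM : ∀ P ∈ M, P.IsInterval) :
    down (prod L (down M)) = down (prod L M) := by
  ext P
  constructor
  · rintro ⟨hP, Q, ⟨a, ha, b, ⟨-, c, hc, f, hf⟩, u, v, h⟩, hPQ⟩
    obtain ⟨i, -⟩ := h.exists_loIso
    -- A subsumption preserves the source interface, so `a` is composable with the coarser `c` as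
    -- well.
    obtain ⟨j⟩ := hf.exists_srcIso
    obtain ⟨G, u', v', hG, -⟩ := exists_glued i.symm j
    exact ⟨hP, G, ⟨a, ha, c, hc, u', v', hG⟩,
      hPQ.trans (h.subsumed hG ⟨_, IsSubsumption.id a⟩ ⟨f, hf⟩)⟩
  · rintro ⟨hP, Q, ⟨a, ha, b, hb, h⟩, hPQ⟩
    exact ⟨hP, Q, ⟨a, ha, b, ⟨hM b hb, b, hb, _, IsSubsumption.id b⟩, h⟩, hPQ⟩

theorem powProd_isInterval {L : Set (Iposet α)} (hL : ∀ P ∈ L, P.IsInterval) (n : ℕ) :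
    ∀ P ∈ powProd L n, P.IsInterval := by
  induction n with
  | zero => exact hL
  | succ n ih =>
    rintro P ⟨a, ha, b, hb, u, v, h⟩
    exact h.isInterval (hL a ha) (ih b hb)

end Iposet

/-! ### Rational languages are recognizable -/

namespace Ipomset

variable {α : Type u}

/-- The representatives of a set of ipomsets. -/
def reps (L : Set (Ipomset α)) : Set (Iposet α) := {P | mk P ∈ L}

theorem mk_eq_mk {P Q : Iposet α} : mk P = mk Q ↔ Iposet.Isomorphic P Q :=
  ⟨fun h => Quotient.exact h, fun h => Quotient.sound h⟩

theorem exists_mk (P : Ipomset α) : ∃ Q, mk Q = P := Quotient.exists_rep P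

theorem Subsumed.trans {P Q R : Ipomset α} (h : P.Subsumed Q) (h' : Q.Subsumed R) :
    P.Subsumed R := by
  obtain ⟨P, rfl⟩ := exists_mk P
  obtain ⟨Q, rfl⟩ := exists_mk Q
  obtain ⟨R, rfl⟩ := exists_mk R
  exact Iposet.Subsumed.trans h h'

theorem IsLanguage.reps_isInterval {L : Set (Ipomset α)} (h : IsLanguage L) :
    ∀ P ∈ reps L, P.IsInterval :=
  fun P hP => h.interval (Ipomset.mk P) hP

theorem IsLanguage.down_reps {L : Set (Ipomset α)} (h : IsLanguage L) :
    Iposet.down (reps L) ⊆ reps L := by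
  rintro P ⟨hP, Q, hQ, hPQ⟩
  exact h.down_closed (Ipomset.mk P) (Ipomset.mk Q) hP hPQ hQ

theorem isLanguage_down (A : Set (Ipomset α)) : IsLanguage (down A) where
  interval _ hP := hP.1
  down_closed := by
    rintro P Q hP hPQ ⟨-, R, hR, hQR⟩
    exact ⟨hP, R, hR, hPQ.trans hQR⟩

theorem reps_langGlue (L M : Set (Ipomset α)) :
    reps (langGlue L M) = Iposet.down (Iposet.prod (reps L) (reps M)) := by
  ext R
  constructor
  · rintro ⟨hR, _, ⟨P, Q, f, hP, hQ, rfl⟩, hRQ⟩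
    exact ⟨hR, _, ⟨P, hP, Q, hQ, _, _, Iposet.glued_glue f⟩, hRQ⟩
  · rintro ⟨hR, G, ⟨P, hP, Q, hQ, u, v, h⟩, hRG⟩
    obtain ⟨f, -⟩ := h.exists_loIso
    exact ⟨hR, _, ⟨P, Q, f, hP, hQ, rfl⟩,
      Iposet.Subsumed.trans hRG (h.isomorphic (Iposet.glued_glue f)).subsumed⟩

theorem reps_langPar (L M : Set (Ipomset α)) :
    reps (langPar L M) = Iposet.down (Iposet.parProd (reps L) (reps M)) := by
  ext R
  constructor
  · rintro ⟨hR, _, ⟨P, Q, hP, hQ, rfl⟩, hRQ⟩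
    exact ⟨hR, _, ⟨P, hP, Q, hQ, rfl⟩, hRQ⟩
  · rintro ⟨hR, _, ⟨P, hP, Q, hQ, rfl⟩, hRG⟩
    exact ⟨hR, _, ⟨P, Q, hP, hQ, rfl⟩, hRG⟩

/-- Each power of a language takes a new down-closure; by monotonicity of gluing a single one at the
end gives the same set, which allows arguing with plain products. -/
theorem reps_langPow {L : Set (Ipomset α)} (hL : IsLanguage L) (n : ℕ) :
    reps (langPow L n) = Iposet.down (Iposet.powProd (reps L) n) := by
  induction n with
  | zero =>
    refine le_antisymm (fun P hP => ?_) hL.down_reps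
    exact ⟨hL.reps_isInterval P hP, P, hP, _, Iposet.IsSubsumption.id P⟩
  | succ n ih =>
    rw [langPow, reps_langGlue, ih,
      Iposet.down_prod_down (Iposet.powProd_isInterval hL.reps_isInterval n)]
    rfl

theorem reps_langPlus {L : Set (Ipomset α)} (hL : IsLanguage L) :
    reps (langPlus L) = Iposet.down (⋃ n, Iposet.powProd (reps L) n) := by
  ext P
  constructor
  · intro hP
    obtain ⟨n, hn⟩ := Set.mem_iUnion.1 hP
    have hn : P ∈ reps (langPow L n) := hn
    rw [reps_langPow hL] at hn
    obtain ⟨h, Q, hQ, hPQ⟩ := hn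
    exact ⟨h, Q, Set.mem_iUnion.2 ⟨n, hQ⟩, hPQ⟩
  · rintro ⟨h, Q, hQ, hPQ⟩
    obtain ⟨n, hn⟩ := Set.mem_iUnion.1 hQ
    have : P ∈ reps (langPow L n) := by
      rw [reps_langPow hL]
      exact ⟨h, Q, hn, hPQ⟩
    exact Set.mem_iUnion.2 ⟨n, this⟩

theorem isLanguage_langPow {L : Set (Ipomset α)} (hL : IsLanguage L) :
    ∀ n, IsLanguage (langPow L n)
  | 0 => hL
  | _ + 1 => isLanguage_down _

/-- The language of a discrete ipomset with at most one event. -/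
theorem isLanguage_singleton_discrete {w : List α} (hw : w.length ≤ 1)
    (S T : Set (Fin w.length)) : IsLanguage {mk (Iposet.discrete w S T)} ∧
      Iposet.IsRecognizable (reps {mk (Iposet.discrete w S T)}) := by
  -- With at most one event, precedence is empty on both sides and every subsumption is an
  -- isomorphism.
  have hsub : ∀ i j : Fin w.length, i = j := fun i j => Fin.ext (by omega)
  have key : ∀ P : Iposet α, P.Subsumed (Iposet.discrete w S T) →
      P.Isomorphic (Iposet.discrete w S T) := by
    rintro P ⟨f, hf⟩
    refine ⟨f, hf, fun x y h => ?_⟩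
    rw [hf.bijective.injective (hsub (f x) (f y))] at h
    exact absurd h (P.prec_irrefl _)
  have hlang : IsLanguage {mk (Iposet.discrete w S T)} := by
    refine ⟨?_, ?_⟩
    · rintro _ rfl
      exact Iposet.isInterval_discrete w S T
    · rintro P _ - h rfl
      obtain ⟨P, rfl⟩ := exists_mk P
      exact mk_eq_mk.2 (key P h)
  refine ⟨hlang, ?_⟩
  have e : reps {mk (Iposet.discrete w S T)} =
      Iposet.down {P | P.Isomorphic (Iposet.discrete w S T)} := by
    ext P
    constructor
    · intro hP
      exact ⟨hlang.reps_isInterval P hP, P, mk_eq_mk.1 hP, _, Iposet.IsSubsumption.id P⟩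
    · rintro ⟨-, Q, hQ, hPQ⟩
      exact mk_eq_mk.2 (key P (hPQ.trans hQ.subsumed))
  rw [e]
  exact Iposet.isRecognizable_singleton (Iposet.isInterval_discrete w S T)

/-- The induction carries along that `L` is a language: gluing and Kleene plus need the interval
property in order to cut, and parallel composition needs down-closedness. -/
theorem IsRational.isRecognizable {L : Set (Ipomset α)} (h : IsRational L) :
    IsLanguage L ∧ Iposet.IsRecognizable (reps L) := by
  induction h with
  | empty => exact ⟨⟨by simp, by simp⟩, Iposet.isRecognizable_empty⟩
  | epsilon => exact isLanguage_singleton_discrete (by simp) _ _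
  | letter a => exact isLanguage_singleton_discrete (by simp) _ _
  | letterSrc a => exact isLanguage_singleton_discrete (by simp) _ _
  | letterTgt a => exact isLanguage_singleton_discrete (by simp) _ _
  | letterSrcTgt a => exact isLanguage_singleton_discrete (by simp) _ _
  | union _ _ hL hM =>
    refine ⟨⟨?_, ?_⟩, hL.2.union hM.2⟩
    · rintro P (hP | hP)
      exacts [hL.1.interval P hP, hM.1.interval P hP]
    · rintro P Q hP hPQ (hQ | hQ)
      exacts [Or.inl (hL.1.down_closed P Q hP hPQ hQ), Or.inr (hM.1.down_closed P Q hP hPQ hQ)]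
  | glue _ _ hL hM =>
    refine ⟨isLanguage_down _, ?_⟩
    rw [reps_langGlue]
    exact hL.2.glue hM.2 hL.1.reps_isInterval hM.1.reps_isInterval
  | par _ _ hL hM =>
    refine ⟨isLanguage_down _, ?_⟩
    rw [reps_langPar]
    exact hL.2.par hM.2 hL.1.down_reps hM.1.down_reps
  | plus _ hL =>
    refine ⟨⟨?_, ?_⟩, ?_⟩
    · intro P hP
      obtain ⟨n, hn⟩ := Set.mem_iUnion.1 hP
      exact (isLanguage_langPow hL.1 n).interval P hn
    · intro P Q hP hPQ hQ
      obtain ⟨n, hn⟩ := Set.mem_iUnion.1 hQ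
      exact Set.mem_iUnion.2 ⟨n, (isLanguage_langPow hL.1 n).down_closed P Q hP hPQ hn⟩
    · rw [reps_langPlus hL.1]
      exact hL.2.plus hL.1.reps_isInterval

end Ipomset

/-! ### Composition of coface maps -/

namespace Precube

variable {α : Type u} {U V W : Precube α}

theorem comp_A (d : U ⟶ V) (e : V ⟶ W) : (d ≫ e).A = e.emb '' d.A ∪ e.A := rfl

theorem comp_B (d : U ⟶ V) (e : V ⟶ W) : (d ≫ e).B = e.emb '' d.B ∪ e.B := rfl

theorem comp_emb (d : U ⟶ V) (e : V ⟶ W) : (d ≫ e).emb = e.emb ∘ d.emb := rfl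

theorem id_A (U : Precube α) : Coface.A (𝟙 U) = ∅ := rfl

theorem id_B (U : Precube α) : Coface.B (𝟙 U) = ∅ := rfl

theorem mem_words_of_hom {A : Set α} {n : ℕ} (d : U ⟶ V) (hV : V ∈ words A n) :
    U ∈ words A n := by
  refine ⟨?_, fun i => d.label i ▸ hV.2 _⟩
  have := Fintype.card_le_of_injective d.emb d.strictMono.injective
  rw [Fintype.card_fin, Fintype.card_fin] at this
  exact this.trans hV.1

end Precube

/-! ### The automaton of a family of sets of suffixes

A cell over `U` assigns to all disjoint sets `A` and `B` of unstarted and terminated events either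
no condition on suffixes (`none`), or the condition to belong to the union of a subfamily. -/

section Automaton

variable {α : Type u} {ι : Type} (suf : ι → Set (Iposet α))

/-- The suffixes allowed by a state. -/
def stateSuffixes : Option (Set ι) → Set (Iposet α)
  | none => Set.univ
  | some I => {Z | ∃ i ∈ I, Z ∈ suf i}

/-- The states of the faces of a cell are compatible with up-steps and down-steps. -/
structure IsCell (U : Precube α)
    (q : Set (Fin U.word.length) → Set (Fin U.word.length) → Option (Set ι)) : Prop where
  up : ∀ {W V : Precube α} (g : V ⟶ U) (d : W ⟶ V) (hd : d.B = ∅) {T : LoSet α}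
    (Z : IposetHom V.lo T), Z.iposet ∈ stateSuffixes suf (q g.A g.B) →
      ((IposetHom.upStep d hd).comp Z).iposet ∈ stateSuffixes suf (q (d ≫ g).A (d ≫ g).B)
  down : ∀ {W V : Precube α} (g : V ⟶ U) (d : W ⟶ V) (hd : d.A = ∅) {T : LoSet α}
    (Z : IposetHom W.lo T), Z.iposet ∈ stateSuffixes suf (q (d ≫ g).A (d ≫ g).B) →
      ((IposetHom.downStep d hd).comp Z).iposet ∈ stateSuffixes suf (q g.A g.B)

/-- The face of a cell along a coface map. -/
def cellFace {U V : Precube α} (d : U ⟶ V)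
    (q : Set (Fin V.word.length) → Set (Fin V.word.length) → Option (Set ι)) :
    Set (Fin U.word.length) → Set (Fin U.word.length) → Option (Set ι) :=
  fun A B => q (d.emb '' A ∪ d.A) (d.emb '' B ∪ d.B)

variable {suf}

/-- The conditions on a cell quantify over all its faces, so those for a face along `d` are
instances at the composites with `d`. -/
theorem IsCell.face {U V : Precube α} (d : U ⟶ V)
    {q : Set (Fin V.word.length) → Set (Fin V.word.length) → Option (Set ι)}
    (h : IsCell suf V q) : IsCell suf U (cellFace d q) := by
  refine ⟨fun g c hc T Z hZ => ?_, fun g c hc T Z hZ => ?_⟩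
  · have := h.up (g ≫ d) c hc Z hZ
    rwa [← Category.assoc] at this
  · refine h.down (g ≫ d) c hc Z ?_
    rwa [← Category.assoc]

theorem cellFace_id {U : Precube α}
    (q : Set (Fin U.word.length) → Set (Fin U.word.length) → Option (Set ι)) :
    cellFace (𝟙 U) q = q := by
  funext A B
  have h : ∀ A, Precube.Coface.emb (𝟙 U) '' A ∪ ∅ = A := fun A => by
    rw [Set.union_empty]; exact Set.image_id A
  rw [cellFace, Precube.id_A, Precube.id_B, h, h]

theorem cellFace_comp {U V W : Precube α} (d : U ⟶ V) (e : V ⟶ W)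
    (q : Set (Fin W.word.length) → Set (Fin W.word.length) → Option (Set ι)) :
    cellFace (d ≫ e) q = cellFace d (cellFace e q) := by
  funext A B
  simp only [cellFace, Precube.comp_A, Precube.comp_B, Precube.comp_emb, Set.image_union,
    Set.image_comp, Set.union_assoc]

variable (suf)

/-- The precubical set of cells over words of length at most `n` over `A`. -/
def cellFunctor (A : Set α) (n : ℕ) : (Precube α)ᵒᵖ ⥤ Type where
  obj U := {q : Set (Fin U.unop.word.length) → Set (Fin U.unop.word.length) → Option (Set ι) //
    IsCell suf U.unop q ∧ U.unop ∈ Precube.words A n}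
  map d := ↾ fun q => ⟨cellFace d.unop q.1, q.2.1.face d.unop,
    Precube.mem_words_of_hom d.unop q.2.2⟩
  map_id _ := ConcreteCategory.hom_ext _ _ fun q => Subtype.ext (cellFace_id q.1)
  map_comp d e := ConcreteCategory.hom_ext _ _ fun q =>
    Subtype.ext (cellFace_comp e.unop d.unop q.1)

/-- The bound on words is part of a cell, so only finitely many words carry cells, and each of them
has finitely many assignments of states. -/
theorem cellFunctor_finite [Finite ι] {A : Set α} (hA : A.Finite) (n : ℕ) :
    Finite (Σ U : Precube α, (cellFunctor suf A n).obj (op U)) := by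
  have : Finite (Precube.words A n) := (Precube.finite_words hA n).to_subtype
  have : ∀ U : Precube α, Finite ((cellFunctor suf A n).obj (op U)) := by
    intro U
    change Finite {q : Set (Fin U.word.length) → Set (Fin U.word.length) → Option (Set ι) // _}
    infer_instance
  refine Finite.of_injective (β := Σ U : Precube.words A n, (cellFunctor suf A n).obj (op U.1))
    (fun x => ⟨⟨x.1, x.2.2.2⟩, x.2⟩) ?_
  rintro ⟨U, x⟩ ⟨V, y⟩ h
  simp only [Sigma.mk.injEq, Subtype.mk.injEq] at h
  obtain ⟨rfl, h⟩ := h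
  rw [eq_of_heq h]

/-- The automaton: start cells only allow suffixes in `L`, accept cells allow the identity. -/
def cellHDA [Finite ι] (L : Set (Iposet α)) {A : Set α} (hA : A.Finite) (n : ℕ) : HDA α where
  cells := cellFunctor suf A n
  finite := cellFunctor_finite suf hA n
  start U := {x | ∀ (V : Precube α) (Z : IposetHom U.lo V.lo),
    Z.iposet ∈ stateSuffixes suf (x.1 ∅ ∅) → Z.iposet ∈ L}
  accept U := {x | (IposetHom.identity U).iposet ∈ stateSuffixes suf (x.1 ∅ ∅)}

variable {suf}

/-- Soundness of the automaton, by induction from the end of the path: the compatibility condition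
of the cell traversed by a step, taken at the identity face, carries membership back over that step.
-/
theorem ev_mem_stateSuffixes {A : Set α} {n : ℕ} {U V : Precube α}
    {x : (cellFunctor suf A n).obj (op U)} {y : (cellFunctor suf A n).obj (op V)}
    (p : HDA.Path (cellFunctor suf A n) x y)
    (hy : (IposetHom.identity V).iposet ∈ stateSuffixes suf (y.1 ∅ ∅)) :
    p.ev.iposet ∈ stateSuffixes suf (x.1 ∅ ∅) := by
  induction p with
  | nil x => exact hy
  | @up U V W d hd y z p ih =>
    have := y.2.1.up (𝟙 V) d hd p.ev (ih hy)
    rw [Category.comp_id] at this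
    have e : ((cellFunctor suf A n).map d.op y).1 ∅ ∅ = y.1 d.A d.B := by
      change y.1 (d.emb '' ∅ ∪ d.A) (d.emb '' ∅ ∪ d.B) = _
      rw [Set.image_empty, Set.empty_union, Set.empty_union]
    rw [e]
    exact this
  | @down U V W d hd x z p ih =>
    refine x.2.1.down (𝟙 U) d hd p.ev ?_
    rw [Category.comp_id]
    have e : ((cellFunctor suf A n).map d.op x).1 ∅ ∅ = x.1 d.A d.B := by
      change x.1 (d.emb '' ∅ ∪ d.A) (d.emb '' ∅ ∪ d.B) = _
      rw [Set.image_empty, Set.empty_union, Set.empty_union]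
    rw [← e]
    exact ih hy

end Automaton

namespace Iposet

variable {α : Type u} {P Q R Z : Iposet α}

/-! ### Enumerations of antichains -/

/-- `e` enumerates `T` along the event order, with labels given by the word `U`. -/
structure Enumerates (P : Iposet α) (U : Precube α) (T : Set P.carrier)
    (e : Fin U.word.length → P.carrier) : Prop where
  mono : ∀ i j, i < j → P.evord (e i) (e j)
  label : ∀ i, P.label (e i) = U.word.get i
  range : Set.range e = T

theorem exists_enumerates {T : Set P.carrier} (hT : ∀ x ∈ T, ∀ y ∈ T, ¬ P.prec x y) :
    ∃ U e, Enumerates P U T e := by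
  have := P.finite
  let S : LoSet α :=
    { carrier := T
      finite := inferInstance
      ord := fun x y => P.evord x y
      label := fun x => P.label x
      irrefl := fun x => P.evord_irrefl x
      trans := fun x y z => P.evord_trans x y z
      total := fun x y => by
        rcases P.comparable x y with h | h | h | h | h
        · exact Or.inl (Subtype.ext h)
        · exact absurd h (hT _ x.2 _ y.2)
        · exact absurd h (hT _ y.2 _ x.2)
        · exact Or.inr (Or.inl h)
        · exact Or.inr (Or.inr h) }
  obtain ⟨U, ⟨f⟩⟩ := S.exists_word
  refine ⟨U, fun i => (f.toEquiv i : T).1, fun i j h => (f.map_ord i j).1 h, f.map_label, ?_⟩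
  ext x
  constructor
  · rintro ⟨i, rfl⟩; exact (f.toEquiv i : T).2
  · intro hx
    obtain ⟨i, hi⟩ := f.toEquiv.surjective (⟨x, hx⟩ : T)
    exact ⟨i, congrArg Subtype.val hi⟩

namespace Enumerates

variable {U V : Precube α} {T T' : Set P.carrier} {e : Fin U.word.length → P.carrier}
  {e' : Fin V.word.length → P.carrier}

theorem injective (h : Enumerates P U T e) : Function.Injective e := by
  intro i j k
  rcases lt_trichotomy i j with hij | hij | hij
  · have := h.mono _ _ hij
    rw [k] at this
    exact absurd this (P.evord_irrefl _)
  · exact hij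
  · have := h.mono _ _ hij
    rw [k] at this
    exact absurd this (P.evord_irrefl _)

theorem mem (h : Enumerates P U T e) (i) : e i ∈ T := h.range ▸ Set.mem_range_self i

theorem image_range (h : Enumerates P U T e) (g : V ⟶ U) :
    e '' Set.range g.emb = T \ (e '' g.A ∪ e '' g.B) := by
  rw [g.range, Set.image_compl_eq_range_sdiff_image h.injective, h.range, Set.image_union]

theorem comp (h : Enumerates P U T e) (g : V ⟶ U) :
    Enumerates P V (T \ (e '' g.A ∪ e '' g.B)) (e ∘ g.emb) where
  mono i j hij := h.mono _ _ (g.strictMono hij)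
  label i := (h.label _).trans (g.label i)
  range := by rw [Set.range_comp, h.image_range]

theorem isEmbedding (h : Enumerates P U T e) (hT : ∀ x ∈ T, ∀ y ∈ T, ¬ P.prec x y)
    (S S' : Set (Fin U.word.length)) : IsEmbedding (discrete U.word S S') P e where
  injective := h.injective
  label := h.label
  prec i j k := hT _ (h.mem i) _ (h.mem j) k
  evord i j k _ _ := h.mono i j k
  map_prec _ _ k := k.elim

theorem tgtIso (h : Enumerates P U T e) {w : R.carrier → P.carrier} (hw : IsEmbedding R P w)
    (hT : w '' R.tgt = T) : Nonempty (LoIso U.lo R.tgtLo) := by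
  have hmem : ∀ i, ∃ x ∈ R.tgt, w x = e i := by
    intro i
    have := h.mem i
    rwa [← hT] at this
  choose f hf hwf using hmem
  refine ⟨LoIso.ofBijective (U := U.lo) (V := R.tgtLo) (fun i => ⟨f i, hf i⟩)
    ⟨fun i j k => ?_, fun x => ?_⟩ (fun i j k => ?_) fun i => ?_⟩
  · have k' : f i = f j := congrArg Subtype.val k
    exact h.injective (by rw [← hwf, ← hwf, k'])
  · obtain ⟨i, hi⟩ : w x.1 ∈ Set.range e := by
      rw [h.range, ← hT]; exact Set.mem_image_of_mem w x.2
    exact ⟨i, Subtype.ext (hw.injective ((hwf i).trans hi))⟩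
  · refine hw.reflect_evord ?_ (R.tgt_max _ (hf i) _) (R.tgt_max _ (hf j) _)
    rw [hwf, hwf]
    exact h.mono i j k
  · change R.label (f i) = _
    rw [← hw.label, hwf, h.label]

/-- The inclusion of an enumerated set in another one. -/
theorem exists_strictMono (h : Enumerates P U T e) (h' : Enumerates P V T' e') (hT : T ⊆ T') :
    ∃ f : Fin U.word.length → Fin V.word.length, StrictMono f ∧
      (∀ i, V.word.get (f i) = U.word.get i) ∧ ∀ i, e' (f i) = e i := by
  have : ∀ i, ∃ j, e' j = e i := by
    intro i
    have := hT (h.mem i)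
    rwa [← h'.range] at this
  choose f hf using this
  refine ⟨f, fun i j hij => ?_, fun i => by rw [← h'.label, hf, h.label], hf⟩
  have hev := h.mono i j hij
  rw [← hf, ← hf] at hev
  rcases lt_trichotomy (f i) (f j) with k | k | k
  · exact k
  · rw [k] at hev; exact absurd hev (P.evord_irrefl _)
  · exact absurd (P.evord_trans _ _ _ hev (h'.mono _ _ k)) (P.evord_irrefl _)

end Enumerates

theorem IsCut.antichain {C T : Set P.carrier} (h : IsCut P C T) :
    ∀ x ∈ T, ∀ y ∈ T, ¬ P.prec x y :=
  fun x hx y hy => h.max x hx y (h.subset hy)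

/-! ### Prefixes at the faces of a cut -/

/-- The prefix of `P` at the cut `(C, T)`, with the events in `X` deleted and those in `Y`
terminated. -/
abbrev cutPrefix (P : Iposet α) (C T X Y : Set P.carrier) : Iposet α :=
  P.sub (C \ X) P.src (T \ (X ∪ Y))

namespace IsCut

variable {C T X Y : Set P.carrier}

theorem cutPrefix_isEmbedding (P : Iposet α) (C T X Y : Set P.carrier) :
    IsEmbedding (P.cutPrefix C T X Y) P subVal :=
  P.sub_isEmbedding _ _ _

theorem cutPrefix_tgt (h : IsCut P C T) :
    subVal '' (P.cutPrefix C T X Y).tgt = T \ (X ∪ Y) :=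
  sub_tgt (fun x hx y hy => h.max x hx.1 y hy.1)
    fun _ hx => ⟨h.subset hx.1, fun k => hx.2 (Or.inl k)⟩

theorem cutPrefix_src (h : IsCut P C T) (hX : ∀ x ∈ X, x ∉ P.src) :
    subVal '' (P.cutPrefix C T X Y).src = P.src :=
  sub_src (fun x hx y _ => P.src_min x hx y) fun x hx => ⟨h.src hx, fun k => hX x k hx⟩

theorem cutPrefix_mem_tgt (h : IsCut P C T) (x : (P.cutPrefix C T X Y).carrier) :
    x ∈ (P.cutPrefix C T X Y).tgt ↔ subVal x ∈ T \ (X ∪ Y) :=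
  (cutPrefix_isEmbedding P C T X Y).injective.mem_set_image.symm.trans
    (Set.ext_iff.1 h.cutPrefix_tgt _)

variable {U V W : Precube α} {e : Fin U.word.length → P.carrier}

/-- Starting events later yields a finer prefix. -/
theorem subsumed_up (h : IsCut P C T) (he : Enumerates P U T e) (g : V ⟶ U) (d : W ⟶ V)
    (hd : d.B = ∅) (hsrc : ∀ x ∈ e '' (d ≫ g).A, x ∉ P.src) {Q : Iposet α} {u v}
    (hQ : Glued (P.cutPrefix C T (e '' (d ≫ g).A) (e '' (d ≫ g).B))
      (IposetHom.upStep d hd).iposet Q u v) :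
    Subsumed Q (P.cutPrefix C T (e '' g.A) (e '' g.B)) := by
  have emb := cutPrefix_isEmbedding P C T (e '' g.A) (e '' g.B)
  have hA : e '' (d ≫ g).A = e '' (g.emb '' d.A) ∪ e '' g.A := by
    rw [Precube.comp_A, Set.image_union]
  have hmem : ∀ j, e (g.emb j) ∈ C \ e '' g.A := by
    intro j
    refine ⟨h.subset (he.mem _), ?_⟩
    rintro ⟨i, hi, k⟩
    rw [he.injective k] at hi
    exact (g.notMem j).1 hi
  have hincl : ∀ x : (P.cutPrefix C T (e '' (d ≫ g).A) (e '' (d ≫ g).B)).carrier,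
      subVal x ∈ C \ e '' g.A := by
    intro x
    obtain ⟨h₁, h₂⟩ := subVal_mem x
    exact ⟨h₁, fun k => h₂ ((Set.ext_iff.1 hA _).2 (Or.inr k))⟩
  have hg : ∀ x ∈ e '' g.A, x ∉ P.src := fun x hx => hsrc x (by rw [hA]; exact Or.inr hx)
  let φ : (P.cutPrefix C T (e '' (d ≫ g).A) (e '' (d ≫ g).B)).carrier →
      (P.cutPrefix C T (e '' g.A) (e '' g.B)).carrier := fun x => subMk _ _ (subVal x) (hincl x)
  let ψ : (IposetHom.upStep d hd).iposet.carrier →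
      (P.cutPrefix C T (e '' g.A) (e '' g.B)).carrier := fun j => subMk _ _ _ (hmem j)
  have hφ : ∀ x, subVal (φ x) = subVal x := fun _ => rfl
  have hψ : ∀ j, subVal (ψ j) = e (g.emb j) := fun _ => rfl
  have hdrange : (d.A)ᶜ = Set.range d.emb := by rw [d.range, hd, Set.union_empty]
  -- In general this is only a subsumption: the gluing puts the events terminated at the face before
  -- those started by the step, though both may be active at the cut and hence incomparable in `P`.
  refine hQ.subsumed_of_maps (φ := φ) (ψ := ψ)
    ((cutPrefix_isEmbedding P C T _ _).toIsRefining.of_comp emb hφ)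
    ((((he.comp g).isEmbedding
      (fun x hx y hy => h.antichain x hx.1 y hy.1) _ _).of_comp emb hψ).toIsRefining)
    ?_ ?_ ?_ ?_ ?_ ?_
  · apply Set.image_injective.2 emb.injective
    rw [Set.image_image, Set.image_image]
    simp only [hφ, hψ]
    rw [h.cutPrefix_tgt]
    change _ = (fun j => e (g.emb j)) '' (d.A)ᶜ
    rw [← he.image_range (d ≫ g), hdrange, Precube.comp_emb, Set.range_comp, Set.image_image]
  · intro x y k
    have k : subVal x = e (g.emb y) := congrArg subVal k
    rw [h.cutPrefix_mem_tgt, k]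
    refine ⟨he.mem _, ?_⟩
    rintro (k' | k')
    · rw [← k] at k'
      exact (subVal_mem x).2 k'
    · rw [Precube.comp_B, hd, Set.image_empty, Set.empty_union] at k'
      obtain ⟨i, hi, k'⟩ := k'
      rw [he.injective k'] at hi
      exact (g.notMem y).2 hi
  · intro x _ y _ k
    exact h.max _ (he.mem (g.emb y)) _ (subVal_mem x).1 (emb.map_prec _ _ k)
  · intro x
    by_cases hx : subVal x ∈ e '' (d ≫ g).A
    · rw [hA] at hx
      rcases hx with ⟨_, ⟨j, -, rfl⟩, k⟩ | hx
      · exact Or.inr ⟨j, emb.injective k⟩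
      · exact absurd hx (subVal_mem x).2
    · exact Or.inl ⟨subMk _ _ (subVal x) ⟨(subVal_mem x).1, hx⟩, rfl⟩
  · apply Set.image_injective.2 emb.injective
    rw [Set.image_image]
    simp only [hφ]
    rw [h.cutPrefix_src hsrc, h.cutPrefix_src hg]
  · apply Set.image_injective.2 emb.injective
    rw [Set.image_image]
    simp only [hψ]
    rw [h.cutPrefix_tgt, ← he.image_range g]
    change (fun j => e (g.emb j)) '' Set.univ = _
    rw [← Set.image_univ, Set.image_image]

/-- Terminating events of a prefix. -/
theorem subsumed_down (h : IsCut P C T) (he : Enumerates P U T e) (g : V ⟶ U) (d : W ⟶ V)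
    (hd : d.A = ∅) (hsrc : ∀ x ∈ e '' g.A, x ∉ P.src) {Q : Iposet α} {u v}
    (hQ : Glued (P.cutPrefix C T (e '' g.A) (e '' g.B)) (IposetHom.downStep d hd).iposet Q u v) :
    Subsumed Q (P.cutPrefix C T (e '' g.A) (e '' (d ≫ g).B)) := by
  have emb := cutPrefix_isEmbedding P C T (e '' g.A) (e '' (d ≫ g).B)
  have hA : (d ≫ g).A = g.A := by
    rw [Precube.comp_A, hd, Set.image_empty, Set.empty_union]
  have hmem : ∀ j, e (g.emb j) ∈ C \ e '' g.A := by
    intro j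
    refine ⟨h.subset (he.mem _), ?_⟩
    rintro ⟨i, hi, k⟩
    rw [he.injective k] at hi
    exact (g.notMem j).1 hi
  let φ : (P.cutPrefix C T (e '' g.A) (e '' g.B)).carrier →
      (P.cutPrefix C T (e '' g.A) (e '' (d ≫ g).B)).carrier :=
    fun x => subMk _ _ (subVal x) (subVal_mem x)
  let ψ : (IposetHom.downStep d hd).iposet.carrier →
      (P.cutPrefix C T (e '' g.A) (e '' (d ≫ g).B)).carrier := fun j => subMk _ _ _ (hmem j)
  have hφ : ∀ x, subVal (φ x) = subVal x := fun _ => rfl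
  have hψ : ∀ j, subVal (ψ j) = e (g.emb j) := fun _ => rfl
  have hdrange : (d.B)ᶜ = Set.range d.emb := by rw [d.range, hd, Set.empty_union]
  refine hQ.subsumed_of_maps (φ := φ) (ψ := ψ)
    ((cutPrefix_isEmbedding P C T _ _).toIsRefining.of_comp emb hφ)
    ((((he.comp g).isEmbedding
      (fun x hx y hy => h.antichain x hx.1 y hy.1) _ _).of_comp emb hψ).toIsRefining)
    ?_ ?_ ?_ ?_ ?_ ?_
  · apply Set.image_injective.2 emb.injective
    rw [Set.image_image, Set.image_image]
    simp only [hφ, hψ]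
    rw [h.cutPrefix_tgt, ← he.image_range g]
    change _ = (fun j => e (g.emb j)) '' Set.univ
    rw [← Set.image_univ, Set.image_image]
  · intro x y k
    have k : subVal x = e (g.emb y) := congrArg subVal k
    rw [h.cutPrefix_mem_tgt, k, ← he.image_range g]
    exact ⟨_, ⟨y, rfl⟩, rfl⟩
  · exact fun x _ y hy => absurd trivial hy
  · exact fun x => Or.inl ⟨subMk _ _ (subVal x) (subVal_mem x), rfl⟩
  · apply Set.image_injective.2 emb.injective
    rw [Set.image_image]
    simp only [hφ]
    rw [h.cutPrefix_src hsrc, h.cutPrefix_src hsrc]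
  · apply Set.image_injective.2 emb.injective
    rw [Set.image_image]
    simp only [hψ]
    rw [h.cutPrefix_tgt, ← hA, ← he.image_range (d ≫ g)]
    change (fun j => e (g.emb j)) '' (d.B)ᶜ = _
    rw [hdrange, Precube.comp_emb, Set.range_comp, Set.image_image]

end IsCut

end Iposet

namespace Iposet

variable {α : Type u} {P Q R Z : Iposet α} {ι : Type} {L : Set (Iposet α)}
  {pre suf : ι → Set (Iposet α)}

/-! ### States of cuts -/

/-- The sets `pre i` and `suf i` describe all gluing decompositions of the elements of the
down-closed set `L` of interval iposets. -/
structure IsPresentation (L : Set (Iposet α)) (pre suf : ι → Set (Iposet α)) : Prop where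
  interval : ∀ P ∈ L, P.IsInterval
  down : Iposet.down L ⊆ L
  sound : ∀ i, ∀ r ∈ pre i, ∀ z ∈ suf i, ∀ (R : Iposet α) u v, Glued r z R u v → R ∈ L
  complete : ∀ R ∈ L, ∀ (r z : Iposet α) u v, Glued r z R u v → ∃ i, r ∈ pre i ∧ z ∈ suf i

/-- Moving a factor `E` from the prefix to the suffix, up to subsumption of the prefix. -/
theorem IsPresentation.step (h : IsPresentation L pre suf) {R₁ R₂ E Z Z' : Iposet α}
    {V W : LoSet α} (hR₁ : R₁.IsInterval) (hE : E.IsInterval) {a b} (hZ' : Glued E Z Z' a b)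
    (f₁ : LoIso V R₁.tgtLo) (g₁ : LoIso V Z'.srcLo) (f₂ : LoIso W R₂.tgtLo) (g₂ : LoIso W Z.srcLo)
    (hsub : ∀ (Y : Iposet α) u v, Glued R₁ E Y u v → Subsumed Y R₂) {i : ι} (hR₂ : R₂ ∈ pre i)
    (hZ : Z ∈ suf i) : ∃ j, R₁ ∈ pre j ∧ Z' ∈ suf j := by
  obtain ⟨G, u, v, hG, -⟩ := exists_glued f₁ g₁
  obtain ⟨K, u', v', hK, -⟩ := exists_glued f₂ g₂
  have hKL := h.sound i _ hR₂ _ hZ _ _ _ hK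
  -- `G` is also the gluing of `Y`, itself glued from `R₁` and `E`, with `Z`. It is thus subsumed by
  -- the gluing `K` of `R₂` and `Z`, which is in `L`; down-closedness gives `G ∈ L`, and
  -- completeness supplies the pair.
  obtain ⟨Y, w₁, w₂, w, hY, hYG, -⟩ := hZ'.assoc_symm hG
  have hGL : G ∈ L := h.down ⟨hYG.isInterval (hY.isInterval hR₁ hE)
    (hK.right.isInterval (h.interval _ hKL)), K, hKL,
    hYG.subsumed hK (hsub _ _ _ hY) ⟨_, IsSubsumption.id Z⟩⟩
  exact h.complete G hGL _ _ _ _ hG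

open Classical in
/-- The states of the faces of the cell at a cut, whose active events are enumerated by `e`. -/
noncomputable def cutCode (pre : ι → Set (Iposet α)) (P : Iposet α) (C T : Set P.carrier) {k : ℕ}
    (e : Fin k → P.carrier) (A B : Set (Fin k)) : Option (Set ι) :=
  if ∃ i ∈ A, e i ∈ P.src then none else some {i | P.cutPrefix C T (e '' A) (e '' B) ∈ pre i}

/-- The first alternative concerns faces that would unstart a source event. No prefix with the
source interface of `P` corresponds to them, so they impose no condition. -/
theorem mem_cutCode {C T : Set P.carrier} {k : ℕ} {e : Fin k → P.carrier} {A B : Set (Fin k)} :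
    Z ∈ stateSuffixes suf (cutCode pre P C T e A B) ↔ (∃ i ∈ A, e i ∈ P.src) ∨
      ∃ j, P.cutPrefix C T (e '' A) (e '' B) ∈ pre j ∧ Z ∈ suf j := by
  by_cases h : ∃ i ∈ A, e i ∈ P.src
  · rw [cutCode, if_pos h]
    exact iff_of_true trivial (Or.inl h)
  · rw [cutCode, if_neg h, or_iff_right h]
    rfl

/-- The state depends only on the remaining started events, the remaining active events and the
source test. This is how faces of cells at different cuts are identified. -/
theorem cutCode_congr {C T C' T' : Set P.carrier} {k k' : ℕ} {e : Fin k → P.carrier}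
    {e₁ : Fin k' → P.carrier} {A B : Set (Fin k)} {A' B' : Set (Fin k')}
    (h : (∃ i ∈ A, e i ∈ P.src) ↔ ∃ i ∈ A', e₁ i ∈ P.src) (hC : C \ e '' A = C' \ e₁ '' A')
    (hT : T \ (e '' A ∪ e '' B) = T' \ (e₁ '' A' ∪ e₁ '' B')) :
    cutCode pre P C T e A B = cutCode pre P C' T' e₁ A' B' := by
  classical
  simp only [cutCode, cutPrefix, hC, hT]
  exact if_congr h rfl rfl

/-- Gluing a step to the prefix at its initial face gives something below the prefix at its final
face, so `step` moves the step from the prefix to the suffix. Faces without condition cause no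
trouble: an up-step only removes unstarted events and a down-step keeps them, so a step that ends at
such a face also begins at one. -/
theorem isCell_cutCode (h : IsPresentation L pre suf) (hP : P.IsInterval) {C T : Set P.carrier}
    (hc : IsCut P C T) {U : Precube α} {e : Fin U.word.length → P.carrier}
    (he : Enumerates P U T e) : IsCell suf U (cutCode pre P C T e) := by
  have iso : ∀ {V : Precube α} (g : V ⟶ U),
      Nonempty (LoIso V.lo (P.cutPrefix C T (e '' g.A) (e '' g.B)).tgtLo) := fun g =>
    (he.comp g).tgtIso (IsCut.cutPrefix_isEmbedding P _ _ _ _) hc.cutPrefix_tgt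
  have int : ∀ X Y, (P.cutPrefix C T X Y).IsInterval := fun X Y =>
    (IsCut.cutPrefix_isEmbedding P C T X Y).isInterval hP
  refine ⟨fun {W V} g d hd S Z hZ => ?_, fun {W V} g d hd S Z hZ => ?_⟩
  · rw [mem_cutCode] at hZ ⊢
    by_cases hit : ∃ i ∈ (d ≫ g).A, e i ∈ P.src
    · exact Or.inl hit
    · right
      rcases hZ with ⟨i, hi, k⟩ | ⟨j, hj, hZ⟩
      · exact absurd ⟨i, Or.inr hi, k⟩ hit
      · obtain ⟨f₁⟩ := iso (d ≫ g)
        obtain ⟨f₂⟩ := iso g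
        refine h.step (int _ _) (isInterval_discrete _ _ _) (glued_glue _) f₁
          ((IposetHom.upStep d hd).comp Z).srcIso f₂ Z.srcIso (fun Y u v hY => ?_) hj hZ
        refine hc.subsumed_up he g d hd ?_ hY
        rintro _ ⟨i, hi, rfl⟩ k
        exact hit ⟨i, hi, k⟩
  · rw [mem_cutCode] at hZ ⊢
    have hA : (d ≫ g).A = g.A := by
      rw [Precube.comp_A, hd, Set.image_empty, Set.empty_union]
    by_cases hit : ∃ i ∈ g.A, e i ∈ P.src
    · exact Or.inl hit
    · right
      rcases hZ with hZ | ⟨j, hj, hZ⟩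
      · rw [hA] at hZ
        exact absurd hZ hit
      · obtain ⟨f₁⟩ := iso g
        obtain ⟨f₂⟩ := iso (d ≫ g)
        refine h.step (int _ _) (isInterval_discrete _ _ _) (glued_glue _) f₁
          ((IposetHom.downStep d hd).comp Z).srcIso f₂ Z.srcIso (fun Y u v hY => ?_) hj hZ
        rw [hA]
        refine hc.subsumed_down he g d hd ?_ hY
        rintro _ ⟨i, hi, rfl⟩ k
        exact hit ⟨i, hi, k⟩

/-! ### Faces of the cells of cuts -/

section Faces

variable {C T T' : Set P.carrier} {U V : Precube α} {e : Fin U.word.length → P.carrier}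
  {e₁ : Fin V.word.length → P.carrier}

/-- A lower face of the cell at a cut is the cell at the cut with fewer started events. As the
removed events are not source events, the source test is unaffected. -/
theorem cellFace_up (d : U ⟶ V) (hd : d.B = ∅) (hsrc : ∀ i ∈ d.A, e₁ i ∉ P.src) :
    cellFace d (cutCode pre P C T e₁) =
      cutCode pre P (C \ e₁ '' d.A) (T \ e₁ '' d.A) (e₁ ∘ d.emb) := by
  funext A B
  apply cutCode_congr
  · constructor
    · rintro ⟨_, ⟨i, hi, rfl⟩ | hi, k⟩
      · exact ⟨i, hi, k⟩
      · exact absurd k (hsrc _ hi)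
    · rintro ⟨i, hi, k⟩
      exact ⟨_, Or.inl ⟨i, hi, rfl⟩, k⟩
  · rw [Set.image_union, Set.image_comp, Set.sdiff_sdiff, Set.union_comm]
  · rw [Set.image_union, Set.image_union, Set.image_comp, Set.image_comp, Set.sdiff_sdiff, hd,
      Set.image_empty, Set.union_empty, Set.union_comm (_ '' (_ '' A)), Set.union_assoc]

theorem cellFace_down (d : V ⟶ U) (hd : d.A = ∅) :
    cellFace d (cutCode pre P C T e) = cutCode pre P C (T \ e '' d.B) (e ∘ d.emb) := by
  funext A B
  apply cutCode_congr
  · rw [hd, Set.union_empty]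
    constructor
    · rintro ⟨_, ⟨i, hi, rfl⟩, k⟩
      exact ⟨i, hi, k⟩
    · rintro ⟨i, hi, k⟩
      exact ⟨_, ⟨i, hi, rfl⟩, k⟩
  · rw [hd, Set.union_empty, Set.image_comp]
  · rw [hd, Set.union_empty, Set.image_union, Set.image_comp, Set.image_comp, Set.sdiff_sdiff]
    congr 1
    ac_rfl

theorem Enumerates.image_compl_range (h : Enumerates P U T e) (h' : Enumerates P V T' e₁)
    {f : Fin U.word.length → Fin V.word.length} (hf : ∀ i, e₁ (f i) = e i) :
    e₁ '' (Set.range f)ᶜ = T' \ T := by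
  rw [Set.image_compl_eq_range_sdiff_image h'.injective, h'.range, ← Set.range_comp, ← h.range]
  congr 2
  exact funext hf

theorem Enumerates.exists_up (h : Enumerates P U T e) (h' : Enumerates P V T' e₁) (hT : T ⊆ T') :
    ∃ d : U ⟶ V, d.B = ∅ ∧ e₁ ∘ d.emb = e ∧ e₁ '' d.A = T' \ T := by
  obtain ⟨f, hf, hlab, hfe⟩ := h.exists_strictMono h' hT
  let d : Precube.Coface U V := ⟨f, (Set.range f)ᶜ, ∅, hf, hlab, disjoint_bot_right,
    by rw [Set.union_empty, compl_compl]⟩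
  exact ⟨d, rfl, funext hfe, h.image_compl_range h' hfe⟩

theorem Enumerates.exists_down (h : Enumerates P U T e) (h' : Enumerates P V T' e₁) (hT : T ⊆ T') :
    ∃ d : U ⟶ V, d.A = ∅ ∧ e₁ ∘ d.emb = e ∧ e₁ '' d.B = T' \ T := by
  obtain ⟨f, hf, hlab, hfe⟩ := h.exists_strictMono h' hT
  let d : Precube.Coface U V := ⟨f, ∅, (Set.range f)ᶜ, hf, hlab, disjoint_bot_left,
    by rw [Set.empty_union, compl_compl]⟩
  exact ⟨d, rfl, funext hfe, h.image_compl_range h' hfe⟩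

end Faces

end Iposet

namespace Iposet

variable {α : Type u} {P Q R Z : Iposet α} {ι : Type} {L : Set (Iposet α)}
  {pre suf : ι → Set (Iposet α)}

/-! ### Accepting paths -/

/-- There is a path from `x` to an accept cell, whose ipomset is the suffix of `P` at the cut
`(C, T)`. -/
def Accepts (suf : ι → Set (Iposet α)) (A : Set α) (n : ℕ) (P : Iposet α) (C T : Set P.carrier)
    {U : Precube α} (x : (cellFunctor suf A n).obj (op U)) : Prop :=
  ∃ (V : Precube α) (y : (cellFunctor suf A n).obj (op V)) (p : HDA.Path (cellFunctor suf A n) x y),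
    (IposetHom.identity V).iposet ∈ stateSuffixes suf (y.1 ∅ ∅) ∧
      ∃ j, IsEmbedding p.ev.iposet P j ∧ Set.range j = T ∪ Cᶜ ∧ j '' p.ev.iposet.src = T ∧
        j '' p.ev.iposet.tgt = P.tgt

/-! ### Extending accepting paths at their beginning -/

section Steps

variable {A : Set α} {n : ℕ} {C T : Set P.carrier} {U V : Precube α}

theorem Glued.range_union {u : R.carrier → P.carrier} {v : Z.carrier → P.carrier}
    (h : Glued R Z P u v) {X : Type*} {f : P.carrier → X} {φ : R.carrier → X} {ψ : Z.carrier → X}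
    (hu : ∀ x, f (u x) = φ x) (hv : ∀ y, f (v y) = ψ y) :
    Set.range f = Set.range φ ∪ Set.range ψ := by
  ext q
  constructor
  · rintro ⟨x, rfl⟩
    rcases h.cover x with ⟨a, rfl⟩ | ⟨b, rfl⟩
    · exact Or.inl ⟨a, (hu a).symm⟩
    · exact Or.inr ⟨b, (hv b).symm⟩
  · rintro (⟨a, rfl⟩ | ⟨b, rfl⟩)
    · exact ⟨_, hu a⟩
    · exact ⟨_, hv b⟩

/-- Active events that are unstarted again stay in the suffix and merely leave its source interface,
which is exactly the effect of gluing an up-step in front. -/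
theorem Accepts.up {e : Fin V.word.length → P.carrier} (hc : IsCut P C T)
    (he : Enumerates P V T e) (d : U ⟶ V) (hd : d.B = ∅) {y : (cellFunctor suf A n).obj (op V)}
    (h : Accepts suf A n P C T y) :
    Accepts suf A n P (C \ e '' d.A) (T \ e '' d.A) ((cellFunctor suf A n).map d.op y) := by
  obtain ⟨W, z, p, hz, j, hj, hrange, hsrc, htgt⟩ := h
  refine ⟨W, z, .up d hd y p, hz, ?_⟩
  have hG := glued_glue ((IposetHom.upStep d hd).tgtIso.symm.trans p.ev.srcIso)
  obtain ⟨f, hf, hu, hv⟩ := hG.exists_embedding (φ := e) (he.isEmbedding hc.antichain _ _) hj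
    (by rw [hsrc, ← he.range]; exact Set.image_univ) (fun _ _ _ => trivial)
    fun x hx => absurd trivial hx
  refine ⟨f, hf, ?_, ?_, ?_⟩
  · refine (hG.range_union hu hv).trans ?_
    have hr : Set.range e = T := he.range
    have hD : e '' d.A ⊆ T := hr ▸ Set.image_subset_range e d.A
    change Set.range e ∪ _ = _
    rw [hrange, hr]
    ext x
    have := @hD x
    have := @hc.subset x
    simp only [Set.mem_union, Set.mem_sdiff, Set.mem_compl_iff]
    tauto
  · refine (congrArg (f '' ·) hG.src).symm.trans ?_
    refine (Set.image_image _ _ _).trans ?_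
    simp only [hu]
    change e '' (d.A)ᶜ = _
    rw [Set.image_compl_eq_range_sdiff_image he.injective, he.range]
  · refine (congrArg (f '' ·) hG.tgt).symm.trans ?_
    refine (Set.image_image _ _ _).trans ?_
    simp only [hv]
    exact htgt

/-- Gluing makes the terminated events precede everything proper to the rest of the path. That this
holds in `P` is the clause `lt` of the later cut `hc'`. -/
theorem Accepts.down {e : Fin U.word.length → P.carrier} (hc : IsCut P C T)
    (he : Enumerates P U T e) (d : V ⟶ U) (hd : d.A = ∅) (hc' : IsCut P C (T \ e '' d.B))
    {x : (cellFunctor suf A n).obj (op U)}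
    (h : Accepts suf A n P C (T \ e '' d.B) ((cellFunctor suf A n).map d.op x)) :
    Accepts suf A n P C T x := by
  obtain ⟨W, z, p, hz, j, hj, hrange, hsrc, htgt⟩ := h
  refine ⟨W, z, .down d hd x p, hz, ?_⟩
  have hG := glued_glue ((IposetHom.downStep d hd).tgtIso.symm.trans p.ev.srcIso)
  have hjmem : ∀ y, j y ∈ (T \ e '' d.B) ∪ Cᶜ := fun y => hrange ▸ Set.mem_range_self y
  obtain ⟨f, hf, hu, hv⟩ := hG.exists_embedding (φ := e) (he.isEmbedding hc.antichain _ _) hj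
    (by
      rw [hsrc]
      change e '' (d.B)ᶜ = _
      rw [Set.image_compl_eq_range_sdiff_image he.injective, he.range])
    (fun i y k hi => by
      rcases hjmem y with h | h
      · exact h.2 ⟨i, hi, k⟩
      · exact h (k ▸ hc.subset (he.mem i)))
    (fun i hi y hy => by
      have hi : i ∈ d.B := not_not.1 hi
      refine hc'.lt _ (hc.subset (he.mem i)) (fun k => k.2 ⟨i, hi, rfl⟩) _ ?_
      refine (hjmem y).resolve_left fun k => hy ?_
      rwa [← hsrc, hj.injective.mem_set_image] at k)
  refine ⟨f, hf, ?_, ?_, ?_⟩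
  · refine (hG.range_union hu hv).trans ?_
    have hr : Set.range e = T := he.range
    change Set.range e ∪ _ = _
    rw [hrange, hr, ← Set.union_assoc, Set.union_eq_self_of_subset_right Set.sdiff_subset]
  · refine (congrArg (f '' ·) hG.src).symm.trans ?_
    refine (Set.image_image _ _ _).trans ?_
    simp only [hu]
    change e '' Set.univ = _
    rw [Set.image_univ, he.range]
  · refine (congrArg (f '' ·) hG.tgt).symm.trans ?_
    refine (Set.image_image _ _ _).trans ?_
    simp only [hv]
    exact htgt

/-- Terminating active events. -/
theorem Accepts.of_subset {T' : Set P.carrier} {e : Fin U.word.length → P.carrier}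
    (hc : IsCut P C T) (hc' : IsCut P C T') (hT : T' ⊆ T) (he : Enumerates P U T e)
    (h : ∀ (V : Precube α) (e' : Fin V.word.length → P.carrier), Enumerates P V T' e' →
      ∀ x : (cellFunctor suf A n).obj (op V), x.1 = cutCode pre P C T' e' →
        Accepts suf A n P C T' x)
    {x : (cellFunctor suf A n).obj (op U)} (hx : x.1 = cutCode pre P C T e) :
    Accepts suf A n P C T x := by
  obtain ⟨V, e', he'⟩ := exists_enumerates hc'.antichain
  obtain ⟨d, hd, hde, hdB⟩ := he'.exists_down he hT
  have hTT : T \ e '' d.B = T' := by rw [hdB, Set.sdiff_sdiff_cancel_left hT]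
  refine Accepts.down hc he d hd (hTT.symm ▸ hc') ?_
  rw [hTT]
  refine h V e' he' _ ?_
  change cellFace d x.1 = _
  rw [hx, cellFace_down d hd, hTT, hde]

end Steps

/-- The empty path, once all events outside of the target interface have been terminated. -/
theorem accepts_univ {A : Set α} {n : ℕ} (h : IsPresentation L pre suf) (hP : P ∈ L)
    {V : Precube α} {e : Fin V.word.length → P.carrier} (he : Enumerates P V P.tgt e)
    {x : (cellFunctor suf A n).obj (op V)} (hx : x.1 = cutCode pre P Set.univ P.tgt e) :
    Accepts suf A n P Set.univ P.tgt x := by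
  have hanti : ∀ x ∈ P.tgt, ∀ y ∈ P.tgt, ¬ P.prec x y := fun x hx y _ => P.tgt_max x hx y
  have himg : e '' Set.univ = P.tgt := by rw [Set.image_univ, he.range]
  have emb := he.isEmbedding hanti Set.univ Set.univ
  refine ⟨V, x, .nil x, ?_, e, emb, ?_, himg, himg⟩
  · rw [hx, mem_cutCode]
    right
    have hC : (Set.univ : Set P.carrier) \ e '' ∅ = Set.univ := by
      rw [Set.image_empty, Set.sdiff_empty]
    have hT : P.tgt \ (e '' ∅ ∪ e '' ∅) = P.tgt := by
      rw [Set.image_empty, Set.union_empty, Set.sdiff_empty]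
    rw [cutPrefix, hC, hT]
    have ht := sub_tgt (S := P.src) (fun x hx y (_ : y ∈ Set.univ) => P.tgt_max x hx y)
      (Set.subset_univ P.tgt)
    -- `P` is glued from the prefix that contains all its events and the identity on its target
    -- interface, so completeness yields the acceptance condition.
    refine h.complete P hP _ _ subVal e ⟨sub_isEmbedding _ _ _ _, emb,
      sub_src (fun x hx y _ => P.src_min x hx y) (Set.subset_univ _), himg, ht.trans himg.symm,
      fun x i k => ⟨?_, fun y _ => ?_⟩, fun x => Or.inl ⟨subMk _ _ x trivial, rfl⟩,
      fun x _ i hi => absurd trivial hi⟩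
    · exact (k ▸ he.mem i : subVal x ∈ P.tgt)
    · exact P.tgt_max (subVal x) (k ▸ he.mem i) y
  · rw [Set.compl_univ, Set.union_empty]
    exact he.range

/-- From any cut, the remaining events can be started in the order of their left endpoints. -/
theorem accepts_of_isCut {A : Set α} {n : ℕ} (h : IsPresentation L pre suf) (hP : P ∈ L)
    (hb : IsBounded L A n) (m : ℕ) : ∀ {C T : Set P.carrier}, Cᶜ.ncard = m → IsCut P C T →
      ∀ {U : Precube α} {e : Fin U.word.length → P.carrier}, Enumerates P U T e →
      ∀ {x : (cellFunctor suf A n).obj (op U)}, x.1 = cutCode pre P C T e →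
        Accepts suf A n P C T x := by
  have := P.finite
  obtain ⟨b, t, hbt, hp⟩ := h.interval P hP
  induction m with
  | zero =>
    intro C T hm hc U e he x hx
    obtain rfl : C = Set.univ := by
      rwa [Set.ncard_eq_zero, Set.compl_empty_iff] at hm
    -- Nothing remains to be started, so it only remains to terminate the active events outside the
    -- target interface.
    refine Accepts.of_subset hc (T' := P.tgt) ?_ (fun x hx => hc.tgt x hx trivial) he
      (fun V e' he' x hx => accepts_univ h hP he' hx) hx
    exact ⟨Set.subset_univ _, Set.subset_univ _, fun x hx _ => hx,
      fun x hx y _ => P.tgt_max x hx y, fun x _ y hy => absurd trivial hy,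
      fun x _ _ y hy => absurd trivial hy⟩
  | succ m ih =>
    intro C T hm hc U e he x hx
    -- The next event to be started is an unstarted one with least left endpoint.
    obtain ⟨y, hy, hmin⟩ := Set.exists_min_image Cᶜ b (Set.toFinite _)
      (Set.nonempty_of_ncard_ne_zero (by rw [hm]; exact Nat.succ_ne_zero m))
    have hy : y ∉ C := hy
    -- First the active events that precede `y` are terminated. They precede every other unstarted
    -- event too, because none of these begins earlier than `y`.
    have hc₁ : IsCut P C {x ∈ T | ¬ P.prec x y} := by
      refine ⟨fun x hx => hc.subset hx.1, hc.src, fun x hx hC => ⟨hc.tgt x hx hC, P.tgt_max x hx y⟩,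
        fun x hx => hc.max x hx.1, fun x hx => hc.min x hx.1, fun x hx hxT z hz => ?_⟩
      by_cases k : x ∈ T
      · have hxy : P.prec x y := by
          by_contra k'
          exact hxT ⟨k, k'⟩
        rw [hp] at hxy ⊢
        exact hxy.trans_le (hmin z hz)
      · exact hc.lt x hx k z hz
    -- Then `y` is started. No unstarted event precedes `y`, since it would have a smaller left
    -- endpoint.
    have hc₂ : IsCut P (insert y C) (insert y {x ∈ T | ¬ P.prec x y}) := by
      refine ⟨Set.insert_subset_insert hc₁.subset, hc.src.trans (Set.subset_insert _ _),
        ?_, ?_, ?_, ?_⟩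
      · rintro x hx (rfl | hC)
        · exact Or.inl rfl
        · exact Or.inr (hc₁.tgt x hx hC)
      · rintro x (rfl | hx) z (rfl | hz)
        · exact P.prec_irrefl _
        · by_cases hzT : z ∈ T
          · exact hc.min z hzT x hy
          · exact fun k => P.prec_irrefl _ (P.prec_trans _ _ _ k (hc.lt z hz hzT x hy))
        · exact hx.2
        · exact hc.max x hx.1 z hz
      · rintro x (rfl | hx) z hz k
        · rw [hp] at k
          have := hmin z fun k => hz (Or.inr k)
          linarith [hbt z]
        · exact hc.min x hx.1 z (fun k => hz (Or.inr k)) k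
      · rintro x (rfl | hx) hxT z hz
        · exact absurd (Or.inl rfl) hxT
        · exact hc₁.lt x hx (fun k => hxT (Or.inr k)) z fun k => hz (Or.inr k)
    refine Accepts.of_subset hc hc₁ (fun x hx => hx.1) he (fun V e₁ he₁ x hx => ?_) hx
    obtain ⟨W, e₂, he₂⟩ := exists_enumerates hc₂.antichain
    obtain ⟨d, hd, hde, hdA⟩ := he₁.exists_up he₂ (Set.subset_insert _ _)
    have hyT : y ∉ {x ∈ T | ¬ P.prec x y} := fun k => hy (hc.subset k.1)
    have hdA' : e₂ '' d.A = {y} := by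
      rw [hdA]
      exact Set.Subset.antisymm (fun z hz => hz.1.resolve_right hz.2)
        fun z hz => ⟨Or.inl hz, fun k => hyT (hz ▸ k)⟩
    have hC : insert y C \ e₂ '' d.A = C := by rw [hdA', Set.insert_sdiff_self_of_notMem hy]
    have hT : insert y {x ∈ T | ¬ P.prec x y} \ e₂ '' d.A = {x ∈ T | ¬ P.prec x y} := by
      rw [hdA', Set.insert_sdiff_self_of_notMem hyT]
    have hw : W ∈ Precube.words A n := hb.mem_words hP he₂.injective he₂.label
      fun i j => hc₂.antichain _ (he₂.mem i) _ (he₂.mem j)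
    let z : (cellFunctor suf A n).obj (op W) :=
      ⟨cutCode pre P _ _ e₂, isCell_cutCode h (h.interval P hP) hc₂ he₂, hw⟩
    have hacc := ih (C := insert y C) ?_ hc₂ he₂ (x := z) rfl
    · have := Accepts.up hc₂ he₂ d hd hacc
      rw [hC, hT] at this
      -- The up-step must begin at the given cell `x`. It does, because the lower face of the new
      -- cell `z` is the cell of the cut before `y` was started; `y` is not a source event, as those
      -- lie in `C`.
      have hz : (cellFunctor suf A n).map d.op z = x := by
        refine Subtype.ext ?_
        change cellFace d (cutCode pre P _ _ e₂) = _
        rw [cellFace_up d hd ?_, hC, hT, hde, hx]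
        intro i hi k
        have : e₂ i ∈ e₂ '' d.A := ⟨i, hi, rfl⟩
        rw [hdA'] at this
        exact hy (this ▸ hc.src k)
      rwa [hz] at this
    · have : (insert y C)ᶜ = Cᶜ \ {y} := by
        ext x
        simp only [Set.mem_compl_iff, Set.mem_insert_iff, Set.mem_sdiff, Set.mem_singleton_iff]
        tauto
      rw [this, Set.ncard_sdiff_singleton_of_mem hy, hm, Nat.add_sub_cancel]

/-! ### Start cells and the language of the automaton -/

/-- The suffixes that match a prefix with all events in both interfaces belong to `L`. -/
theorem mem_of_prefix_src (h : IsPresentation L pre suf) {U : Precube α}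
    {e : Fin U.word.length → P.carrier} (he : Enumerates P U P.src e) {i : ι}
    (hi : P.sub P.src P.src P.src ∈ pre i) {T : LoSet α} (Z : IposetHom U.lo T)
    (hZ : Z.iposet ∈ suf i) : Z.iposet ∈ L := by
  have hanti : ∀ x ∈ P.src, ∀ y ∈ P.src, ¬ P.prec x y := fun x _ y hy => P.src_min y hy x
  have hs : ∀ x : (P.sub P.src P.src P.src).carrier, x ∈ (P.sub P.src P.src P.src).src :=
    fun x => ⟨subVal_mem x, fun y hy => hanti y hy _ (subVal_mem x)⟩
  have ht : ∀ x : (P.sub P.src P.src P.src).carrier, x ∈ (P.sub P.src P.src P.src).tgt :=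
    fun x => ⟨subVal_mem x, fun y hy => hanti _ (subVal_mem x) y hy⟩
  obtain ⟨f⟩ := he.tgtIso (sub_isEmbedding P P.src P.src P.src)
    (sub_tgt hanti subset_rfl)
  obtain ⟨G, u, v, hG, -⟩ := exists_glued f Z.srcIso
  have hGL := h.sound i _ hi _ hZ _ _ _ hG
  -- All events of the prefix are in its target interface, so they are events of `Z` already, and
  -- the gluing adds nothing to `Z`.
  have hcov : ∀ x, u x ∈ v '' Z.iposet.src := fun x => hG.mid ▸ ⟨x, ht x, rfl⟩
  refine h.down ⟨hG.right.isInterval (h.interval _ hGL), G, hGL, v,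
    hG.right.toIsRefining.isSubsumption (fun x => ?_) ?_ hG.tgt⟩
  · rcases hG.cover x with ⟨a, rfl⟩ | hx
    · obtain ⟨y, -, k⟩ := hcov a
      exact ⟨y, k⟩
    · exact hx
  · rw [← hG.mid, ← hG.src]
    congr 1
    ext x
    exact iff_of_true (ht x) (hs x)

theorem isCut_src (P : Iposet α) : IsCut P P.src P.src where
  subset := subset_rfl
  src := subset_rfl
  tgt _ _ h := h
  max _ _ y hy := P.src_min y hy _
  min x hx y _ := P.src_min x hx y
  lt _ hx hx' := absurd hx hx'

/-- An accepted ipomset meets the condition at its start cell, hence lies in `M`. For the converse,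
the path begins at the cut whose started and active events are the source events: the prefix there
is an identity, so the cell is a start cell, and the suffix is all of `P`. -/
theorem lang_cellHDA [Finite ι] {M : Set (Ipomset α)} (h : IsPresentation (Ipomset.reps M) pre suf)
    {A : Set α} (hA : A.Finite) {n : ℕ} (hb : IsBounded (Ipomset.reps M) A n) :
    (cellHDA suf (Ipomset.reps M) hA n).lang = M := by
  ext q
  constructor
  · rintro ⟨U, V, x, y, p, hx, hy, rfl⟩
    exact hx V p.ev (ev_mem_stateSuffixes p hy)
  · intro hq
    obtain ⟨P, rfl⟩ := Ipomset.exists_mk q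
    have hP : P ∈ Ipomset.reps M := hq
    have hc := isCut_src P
    obtain ⟨U, e, he⟩ := exists_enumerates hc.antichain
    have hw : U ∈ Precube.words A n := hb.mem_words hP he.injective he.label
      fun i j => hc.antichain _ (he.mem i) _ (he.mem j)
    let x : (cellFunctor suf A n).obj (op U) :=
      ⟨cutCode pre P _ _ e, isCell_cutCode h (h.interval P hP) hc he, hw⟩
    obtain ⟨V, y, p, hy, j, hj, hrange, hsrc, htgt⟩ :=
      accepts_of_isCut h hP hb _ rfl hc he (x := x) rfl
    refine ⟨U, V, x, y, p, fun W Z hZ => ?_, hy, ?_⟩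
    · change Z.iposet ∈ stateSuffixes suf (cutCode pre P _ _ e ∅ ∅) at hZ
      rw [mem_cutCode] at hZ
      rcases hZ with ⟨i, hi, -⟩ | ⟨i, hi, hZ⟩
      · exact hi.elim
      · rw [cutPrefix, Set.image_empty, Set.union_empty, Set.sdiff_empty] at hi
        exact mem_of_prefix_src h he hi Z hZ
    · refine Ipomset.mk_eq_mk.2 (hj.isomorphic (fun x => ?_) hsrc htgt).symm
      have : x ∈ Set.range j := by
        rw [hrange, Set.union_compl_self]
        trivial
      exact this

end Iposet

theorem mainTheorem2 {α : Type u} (L : Set (Ipomset α)) (hL : Ipomset.IsRational L) :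
    Ipomset.IsRegular L := by
  obtain ⟨hlang, ⟨F, hF, hsplit⟩, A, n, hA, hb⟩ := hL.isRecognizable
  have := hF.to_subtype
  -- The pairs are renamed by numbers, since cells must live in the lowest universe whereas sets of
  -- iposets do not.
  obtain ⟨k, ⟨σ⟩⟩ := Finite.exists_equiv_fin F
  have h : Iposet.IsPresentation (Ipomset.reps L) (fun i => (σ.symm i).1.1)
      fun i => (σ.symm i).1.2 :=
    { interval := hlang.reps_isInterval
      down := hlang.down_reps
      sound := fun i => hsplit.sound _ (σ.symm i).2
      complete := fun R hR r z u v hG => by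
        obtain ⟨f, hf, hr, hz⟩ := hsplit.complete R hR r z u v hG
        exact ⟨σ ⟨f, hf⟩, by simpa using hr, by simpa using hz⟩ }
  exact ⟨hlang, _, Iposet.lang_cellHDA h hA hb⟩
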